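/- All links are oriented and tame, and are considered up to ambient isotopy. A diagram of a link is a projection in general position (finitely many multiple points, all transverse double points) together with over/under information at each double point (crossing). A diagram is *positive* if every crossing has positive sign. It is *alternating* if over- and under-crossings appear alternately along every component, and *almost alternating* if changing over and under at some one crossing turns it into an alternating diagram. A link is *positive*, respectively *alternating*, if it has a positive, respectively an alternating, diagram; it is *almost alternating* if it has an almost alternating diagram and no alternating diagram. **Theorem 3.1.** Let $L$ be an oriented link. If $L$ has a diagram that is both positive and almost alternating, then $L$ is alternating. Consequently, if $L$ is positive and almost alternating, then no diagram of $L$ is at the same time positive and almost alternating. -/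

import Mathlib

/-- The oriented projection plane. -/
abbrev Plane : Type := ℝ × ℝ

/-- Three-dimensional space, written as plane times height. A diagram is seen from above, that is
from the side of large heights. -/
abbrev Space : Type := Plane × ℝ

/-- A finite family of oriented closed polygons. The components are the cycles of `next`, and the
edges are the oriented segments from `pos v` to `pos (next v)`, one for each vertex label `v`. -/
structure ClosedPolygons (E : Type) where
  n : ℕ
  next : Equiv.Perm (Fin n)
  pos : Fin n → E

namespace ClosedPolygons

section Points

variable {E : Type} [AddCommGroup E] [Module ℝ E]

/-- The parameters of the polygons. The pair `(v, t)` with `0 ≤ t < 1` stands for a point of the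
half-open edge that starts at `v`, so that every point of the abstract disjoint union of circles
has exactly one parameter. -/
def params (P : ClosedPolygons E) : Set (Fin P.n × ℝ) :=
  {p | p.2 ∈ Set.Ico (0 : ℝ) 1}

/-- The parametrization of the polygons. -/
def point (P : ClosedPolygons E) (p : Fin P.n × ℝ) : E :=
  AffineMap.lineMap (P.pos p.1) (P.pos (P.next p.1)) p.2

/-- The set of all points of the polygons. -/
def carrier (P : ClosedPolygons E) : Set E :=
  P.point '' P.params

/-- The parameter reached at time `x ≥ 0` when one starts at the vertex `v` and follows the
orientation, one edge per unit of time. -/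
noncomputable def walk (P : ClosedPolygons E) (v : Fin P.n) (x : ℝ) : Fin P.n × ℝ :=
  (P.next^[⌊x⌋₊] v, Int.fract x)

end Points

/-- The determinant of two vectors of the plane. -/
def det (a b : Plane) : ℝ := a.1 * b.2 - a.2 * b.1

/-- The direction of the edge that starts at `v`. -/
def dir (P : ClosedPolygons Plane) (v : Fin P.n) : Plane :=
  P.pos (P.next v) - P.pos v

/-- General position of plane polygons: no vertex is a multiple point, the edges through a
multiple point are transverse, and there are no triple points. -/
structure IsRegular (P : ClosedPolygons Plane) : Prop where
  vertex_simple : ∀ v, ∀ p ∈ P.params, P.point p = P.pos v → p = (v, 0)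
  transverse : ∀ p ∈ P.params, ∀ q ∈ P.params, p ≠ q → P.point p = P.point q →
    det (P.dir p.1) (P.dir q.1) ≠ 0
  no_triple : ∀ p ∈ P.params, ∀ q ∈ P.params, ∀ r ∈ P.params,
    P.point p = P.point q → P.point q = P.point r → p = q ∨ q = r ∨ p = r

/-- The edges that start at `v` and at `w` cross each other. In general position two edges cross
in at most one point, so a crossing is the same as an unordered pair of crossing edges. -/
def Crosses (P : ClosedPolygons Plane) (v w : Fin P.n) : Prop :=
  v ≠ w ∧ ∃ s ∈ Set.Ico (0 : ℝ) 1, ∃ t ∈ Set.Ico (0 : ℝ) 1, P.point (v, s) = P.point (w, t)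

theorem Crosses.symm {P : ClosedPolygons Plane} {v w : Fin P.n} (h : P.Crosses v w) :
    P.Crosses w v := by
  obtain ⟨hne, s, hs, t, ht, e⟩ := h
  exact ⟨hne.symm, t, ht, s, hs, e.symm⟩

/-- Two edges in general position meet in at most one point. -/
theorem IsRegular.unique {P : ClosedPolygons Plane} (hP : P.IsRegular) {v w : Fin P.n}
    {s t s' t' : ℝ} (hs : s ∈ Set.Ico (0 : ℝ) 1) (ht : t ∈ Set.Ico (0 : ℝ) 1)
    (hne : v ≠ w) (e : P.point (v, s) = P.point (w, t)) (e' : P.point (v, s') = P.point (w, t')) :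
    s = s' ∧ t = t' := by
  have hd := hP.transverse (v, s) hs (w, t) ht (by simp [hne]) e
  simp only [point, dir, det, AffineMap.lineMap_apply_module', Prod.ext_iff, Prod.fst_add,
    Prod.snd_add, Prod.smul_fst, Prod.smul_snd, Prod.fst_sub, Prod.snd_sub, smul_eq_mul]
    at hd e e'
  obtain ⟨e1, e2⟩ := e
  obtain ⟨e1', e2'⟩ := e'
  constructor
  · apply sub_eq_zero.1
    refine (mul_eq_zero.1 ?_).resolve_right hd
    linear_combination (e1 - e1') * ((P.pos (P.next w)).2 - (P.pos w).2) -
      (e2 - e2') * ((P.pos (P.next w)).1 - (P.pos w).1)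
  · apply sub_eq_zero.1
    refine (mul_eq_zero.1 ?_).resolve_right hd
    linear_combination (e1 - e1') * ((P.pos (P.next v)).2 - (P.pos v).2) -
      (e2 - e2') * ((P.pos (P.next v)).1 - (P.pos v).1)

end ClosedPolygons

/-- An oriented (tame) link: finitely many disjoint simple oriented closed polygons in space. -/
structure PolygonalLink extends ClosedPolygons Space where
  embedded : Set.InjOn toClosedPolygons.point toClosedPolygons.params

/-- An oriented link diagram: polygons in general position in the plane, together with over/under
information at the crossings. Here `isOver v w` says that the edge starting at `v` crosses over the
edge starting at `w`. -/
structure LinkDiagram extends ClosedPolygons Plane where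
  regular : toClosedPolygons.IsRegular
  isOver : Fin n → Fin n → Prop
  crosses_of_isOver : ∀ v w, isOver v w → toClosedPolygons.Crosses v w
  isOver_iff : ∀ v w, toClosedPolygons.Crosses v w → (isOver v w ↔ ¬ isOver w v)

namespace LinkDiagram

/-- The strand at the parameter `p` runs through a crossing. -/
def IsPassage (D : LinkDiagram) (p : Fin D.n × ℝ) : Prop :=
  p ∈ D.params ∧ ∃ q ∈ D.params, p ≠ q ∧ D.point p = D.point q

/-- The strand at the parameter `p` runs through a crossing as the over-strand. -/
def IsOverPassage (D : LinkDiagram) (p : Fin D.n × ℝ) : Prop :=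
  p ∈ D.params ∧ ∃ q ∈ D.params, p ≠ q ∧ D.point p = D.point q ∧ D.isOver p.1 q.1

/-- Along every component, any two consecutive passages through crossings consist of one
over-passage and one under-passage. -/
def Alternating (D : LinkDiagram) : Prop :=
  ∀ (v : Fin D.n) (x y : ℝ), 0 ≤ x → x < y →
    D.IsPassage (D.walk v x) → D.IsPassage (D.walk v y) →
    (∀ z, x < z → z < y → ¬ D.IsPassage (D.walk v z)) →
    (D.IsOverPassage (D.walk v x) ↔ ¬ D.IsOverPassage (D.walk v y))

/-- Every crossing is positive: the direction of the over-strand followed by the direction of the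
under-strand is a positively oriented basis of the plane. -/
def Positive (D : LinkDiagram) : Prop :=
  ∀ v w, D.isOver v w → 0 < ClosedPolygons.det (D.dir v) (D.dir w)

/-- The diagram with over and under exchanged at the crossing of the edges starting at `v`
and `w`, and unchanged elsewhere. -/
def crossingChange (D : LinkDiagram) (v w : Fin D.n) : LinkDiagram where
  toClosedPolygons := D.toClosedPolygons
  regular := D.regular
  isOver := fun a b => (s(a, b) = s(v, w) ∧ D.isOver b a) ∨ (s(a, b) ≠ s(v, w) ∧ D.isOver a b)
  crosses_of_isOver := by
    rintro a b (⟨-, h⟩ | ⟨-, h⟩)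
    · exact (D.crosses_of_isOver _ _ h).symm
    · exact D.crosses_of_isOver _ _ h
  isOver_iff := by
    intro a b h
    have h1 := D.isOver_iff a b h
    rw [Sym2.eq_swap (a := b) (b := a)]
    tauto

/-- One crossing change makes the diagram alternating. -/
def AlmostAlternating (D : LinkDiagram) : Prop :=
  ∃ v w, D.Crosses v w ∧ (D.crossingChange v w).Alternating

end LinkDiagram

namespace PolygonalLink

/-- `K'` arises from `K` by an elementary move across a triangle: an edge `AB` of `K` is replaced
by the two edges `AC` and `CB`, where the triangle `ABC` meets `K` in `AB` only. Degenerate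
triangles are allowed, so subdividing an edge is an elementary move. The injection `ι` matches
the old vertices with vertices of `K'`, and `c` is the label of the new vertex `C`. -/
def TriangleMove (K K' : PolygonalLink) : Prop :=
  K'.n = K.n + 1 ∧
  ∃ (ι : Fin K.n ↪ Fin K'.n) (c : Fin K'.n) (a : Fin K.n),
    (∀ u, ι u ≠ c) ∧
    (∀ u, K'.pos (ι u) = K.pos u) ∧
    K'.next (ι a) = c ∧ K'.next c = ι (K.next a) ∧
    (∀ u, u ≠ a → K'.next (ι u) = ι (K.next u)) ∧
    convexHull ℝ {K.pos a, K.pos (K.next a), K'.pos c} ∩ K.carrier =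
      segment ℝ (K.pos a) (K.pos (K.next a))

/-- Equivalence (combinatorial isotopy) of oriented links: the equivalence relation generated by
the elementary triangle moves. -/
def Equivalent : PolygonalLink → PolygonalLink → Prop :=
  Relation.EqvGen TriangleMove

/-- The vertical projection of a link to the plane. -/
def shadow (K : PolygonalLink) : ClosedPolygons Plane where
  n := K.n
  next := K.next
  pos := fun v => (K.pos v).1

theorem shadow_point (K : PolygonalLink) (p : Fin K.n × ℝ) :
    K.shadow.point p = (K.point p).1 := by
  simp only [shadow, ClosedPolygons.point, AffineMap.lineMap_apply_module']
  rfl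

/-- The diagram of a link with regular projection: at a crossing the strand with the larger height
is the over-strand. -/
def diagram (K : PolygonalLink) (h : K.shadow.IsRegular) : LinkDiagram where
  toClosedPolygons := K.shadow
  regular := h
  isOver := fun v w => v ≠ w ∧ ∃ s ∈ Set.Ico (0 : ℝ) 1, ∃ t ∈ Set.Ico (0 : ℝ) 1,
    K.shadow.point (v, s) = K.shadow.point (w, t) ∧ (K.point (w, t)).2 < (K.point (v, s)).2
  crosses_of_isOver := by
    rintro v w ⟨hne, s, hs, t, ht, e, -⟩
    exact ⟨hne, s, hs, t, ht, e⟩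
  isOver_iff := by
    rintro v w ⟨hne, s, hs, t, ht, e⟩
    constructor
    · rintro ⟨-, s1, hs1, t1, ht1, e1, l1⟩ ⟨-, t2, ht2, s2, hs2, e2, l2⟩
      obtain ⟨rfl, rfl⟩ := h.unique hs1 ht1 hne e1 e2.symm
      exact absurd l1 l2.asymm
    · intro hn
      refine ⟨hne, s, hs, t, ht, e, ?_⟩
      by_contra hle
      rcases (not_lt.1 hle).lt_or_eq with hlt | heq
      · exact hn ⟨hne.symm, t, ht, s, hs, e.symm, hlt⟩
      · refine hne (congrArg Prod.fst (K.embedded (x₁ := (v, s)) (x₂ := (w, t)) hs ht ?_))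
        have e3 := e
        erw [shadow_point, shadow_point] at e3
        exact Prod.ext e3 heq

/-- `D` is a diagram of the link `L`. -/
def HasDiagram (L : PolygonalLink) (D : LinkDiagram) : Prop :=
  ∃ K : PolygonalLink, L.Equivalent K ∧ ∃ h : K.shadow.IsRegular, K.diagram h = D

/-- A link is alternating if it has an alternating diagram. -/
def Alternating (L : PolygonalLink) : Prop :=
  ∃ D, L.HasDiagram D ∧ D.Alternating

/-- A link is positive if it has a positive diagram. -/
def Positive (L : PolygonalLink) : Prop :=
  ∃ D, L.HasDiagram D ∧ D.Positive

/-- A link is almost alternating if it has an almost alternating diagram and no alternating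
diagram. -/
def AlmostAlternating (L : PolygonalLink) : Prop :=
  (∃ D, L.HasDiagram D ∧ D.AlmostAlternating) ∧ ¬ ∃ D, L.HasDiagram D ∧ D.Alternating

end PolygonalLink

/-!
Let `D` be a positive diagram that becomes alternating when the crossing of `a` over `b` is changed.
The point is that this crossing is nugatory, so that changing it does not change the link.

Subdivide the edges so that every crossing is the midpoint of two edges, and label a vertex by
whether the next passage after it in the changed diagram is an under-passage. The label switches at
every crossing and only there. As all crossings of `D` are positive, the label also tells which
strand of a crossing comes first in the orientation of the plane, with the opposite rule at the
special crossing. Hence the Seifert circle of `D` through `a` enters every other crossing on the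
strand with the same label and leaves it by turning right, so all the strands that it meets there
lie on its left; at the special crossing it turns the other way. The winding number of the circle, a
simple closed polygon, is therefore equal to one value at all other ends of strands at the circle,
and to another value at the two ends at the special crossing. So the part of the diagram that leaves
the circle through the special crossing is separated from the rest:
`ClosedPolygons.exists_separation`.

Lift this part above everything else, turn it once about the vertical axis through the crossing, and
shear it vertically during the turn. Both parts stay embedded, the two edges that join them never
meet, and at the end all edges have their old projections, while the order of the heights at the
special crossing, and at no other one, is reversed: `exists_equivalent_crossing_changed`. A path of
embedded vertex positions is a combinatorial isotopy, because moving one vertex a little can be done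
by inserting a vertex and removing another one: `equivalent_of_isPreconnected`. The result is a
diagram of the same link whose label follows the alternating rule at all crossings, so it is
alternating: `PolygonalLink.diagram_alternating_of_label`.

The second claim of the theorem is immediate from the first one, since an almost alternating link is
not alternating.
-/

open Set AffineMap Topology

/-! ### Inserting a vertex into a polygonal link -/

/-- Polygons in space with the given cyclic structure and vertex positions are simple and
disjoint. Fixing `n` and `next` makes the vertex positions a point of the finite-dimensional space
`Fin n → Space`. -/
def IsEmbedded {n : ℕ} (next : Equiv.Perm (Fin n)) (pos : Fin n → Space) : Prop :=
  InjOn (ClosedPolygons.mk n next pos).point (ClosedPolygons.mk n next pos).params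

/-- The polygonal link with the given vertex positions. -/
def PolygonalLink.ofPos {n : ℕ} {next : Equiv.Perm (Fin n)} {pos : Fin n → Space}
    (h : IsEmbedded next pos) : PolygonalLink :=
  ⟨⟨n, next, pos⟩, h⟩

theorem isEmbedded_iff {n : ℕ} {next : Equiv.Perm (Fin n)} {pos : Fin n → Space} :
    IsEmbedded next pos ↔ ∀ u w, ∀ s ∈ Ico (0 : ℝ) 1, ∀ t ∈ Ico (0 : ℝ) 1,
      lineMap (pos u) (pos (next u)) s = lineMap (pos w) (pos (next w)) t → u = w ∧ s = t := by
  constructor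
  · intro h u w s hs t ht e
    exact Prod.ext_iff.1 (h (show (u, s) ∈ _ from hs) (show (w, t) ∈ _ from ht) e)
  · rintro h ⟨u, s⟩ hs ⟨w, t⟩ ht e
    exact Prod.ext_iff.2 (h u w s hs t ht e)

theorem IsEmbedded.pos_injective {n : ℕ} {next : Equiv.Perm (Fin n)} {pos : Fin n → Space}
    (h : IsEmbedded next pos) : Function.Injective pos := by
  intro u w e
  exact (isEmbedded_iff.1 h u w 0 (by simp) 0 (by simp) (by simpa using e)).1

theorem IsEmbedded.next_ne {n : ℕ} {next : Equiv.Perm (Fin n)} {pos : Fin n → Space}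
    (h : IsEmbedded next pos) (v : Fin n) : next v ≠ v := by
  intro e
  have := (isEmbedded_iff.1 h v v 0 (by simp) (1 / 2) (by norm_num) (by simp [e])).2
  norm_num at this

theorem mem_triangle {E : Type*} [AddCommGroup E] [Module ℝ E] {A B C X : E} :
    X ∈ convexHull ℝ {A, B, C} ↔
      ∃ r ∈ Icc (0 : ℝ) 1, ∃ s ∈ Icc (0 : ℝ) 1, lineMap A (lineMap B C r) s = X := by
  rw [convexHull_insert (by simp), convexHull_pair]
  simp [segment_eq_image_lineMap]

theorem mem_segment_lineMap {E : Type*} [AddCommGroup E] [Module ℝ E] (A B : E) {s : ℝ}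
    (hs : s ∈ Icc (0 : ℝ) 1) : lineMap A B s ∈ segment ℝ A B := by
  rw [segment_eq_image_lineMap]
  exact ⟨s, hs, rfl⟩

theorem Ico_subset_unit {s : ℝ} (hs : s ∈ Ico (0 : ℝ) 1) : s ∈ Icc (0 : ℝ) 1 := ⟨hs.1, hs.2.le⟩

/-- The cyclic structure after a new last vertex has been put on the edge that starts at `a`. -/
def insertNext {n : ℕ} (next : Equiv.Perm (Fin n)) (a : Fin n) : Equiv.Perm (Fin (n + 1)) :=
  (finSuccEquivLast.symm.permCongr next.optionCongr) * Equiv.swap a.castSucc (Fin.last n)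

section insertNext

variable {n : ℕ} (next : Equiv.Perm (Fin n)) (a : Fin n)

theorem insertNext_self : insertNext next a a.castSucc = Fin.last n := by
  simp [insertNext, Equiv.permCongr_apply]

theorem insertNext_last : insertNext next a (Fin.last n) = (next a).castSucc := by
  simp [insertNext, Equiv.permCongr_apply]

theorem insertNext_of_ne {u : Fin n} (h : u ≠ a) :
    insertNext next a u.castSucc = (next u).castSucc := by
  rw [insertNext, Equiv.Perm.mul_apply, Equiv.swap_apply_of_ne_of_ne]
  · simp [Equiv.permCongr_apply]
  · simpa using h
  · exact (Fin.castSucc_lt_last u).ne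

end insertNext

theorem sameRay_of_lineMap_eq {E : Type*} [AddCommGroup E] [Module ℝ E] {A B C : E} {s t : ℝ}
    (hs : s < 1) (ht : 0 ≤ t) (e : lineMap A C s = (lineMap C B t : E)) :
    SameRay ℝ (A - C) (B - C) := by
  have e' : (1 - s) • (A - C) = t • (B - C) := by
    simp only [lineMap_apply_module] at e
    have : (1 - s) • (A - C) - t • (B - C) = ((1 - s) • A + s • C) - ((1 - t) • C + t • B) := by
      module
    rw [← sub_eq_zero, this, e, sub_self]
  rcases ht.eq_or_lt with rfl | ht
  · rw [zero_smul, smul_eq_zero] at e'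
    left
    exact e'.resolve_left (by linarith)
  · exact Or.inr (Or.inr ⟨1 - s, t, by linarith, ht, e'⟩)

theorem IsEmbedded.insert {n : ℕ} {next : Equiv.Perm (Fin n)} {pos : Fin n → Space}
    (h : IsEmbedded next pos) {a : Fin n} {C : Space}
    (hT : convexHull ℝ {pos a, pos (next a), C} ∩ (ClosedPolygons.mk n next pos).carrier =
      segment ℝ (pos a) (pos (next a)))
    (hC : ¬ SameRay ℝ (pos a - C) (pos (next a) - C)) :
    IsEmbedded (insertNext next a) (Fin.snoc pos C : Fin (n + 1) → Space) := by
  have h' := isEmbedded_iff.1 h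
  -- The triangle meets the other half-open edges at most in its vertex `pos (next a)`.
  have key : ∀ u, u ≠ a → ∀ s ∈ Ico (0 : ℝ) 1,
      lineMap (pos u) (pos (next u)) s ∈ convexHull ℝ {pos a, pos (next a), C} →
      lineMap (pos u) (pos (next u)) s = pos (next a) := by
    intro u hu s hs hX
    have : lineMap (pos u) (pos (next u)) s ∈ segment ℝ (pos a) (pos (next a)) := by
      rw [← hT]
      exact ⟨hX, (u, s), hs, rfl⟩
    rw [segment_eq_image_lineMap] at this
    obtain ⟨r, hr, e⟩ := this
    rcases hr.2.eq_or_lt with rfl | hr1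
    · simpa using e.symm
    · exact absurd (h' _ _ r ⟨hr.1, hr1⟩ s hs e).1.symm hu
  have m1 : ∀ s ∈ Ico (0 : ℝ) 1, lineMap (pos a) C s ∈ convexHull ℝ {pos a, pos (next a), C} :=
    fun s hs => mem_triangle.2 ⟨1, by simp, s, Ico_subset_unit hs, by simp⟩
  have m2 : ∀ s ∈ Ico (0 : ℝ) 1,
      lineMap C (pos (next a)) s ∈ convexHull ℝ {pos a, pos (next a), C} := by
    refine fun s hs => mem_triangle.2 ⟨1 - s, ⟨by linarith [hs.2], by linarith [hs.1]⟩, 1,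
      by simp, ?_⟩
    rw [lineMap_apply_one, lineMap_apply_one_sub]
  have n1 : ∀ s ∈ Ico (0 : ℝ) 1, lineMap (pos a) C s ≠ pos (next a) := by
    intro s hs e
    apply hC
    have : pos (next a) = lineMap C (pos (next a)) (1 : ℝ) := by simp
    rw [this] at e
    exact sameRay_of_lineMap_eq hs.2 zero_le_one e
  have hCB : C ≠ pos (next a) := by
    rintro rfl
    simp at hC
  have hCA : pos a ≠ C := by
    rintro rfl
    simp at hC
  have n2 : ∀ s ∈ Ico (0 : ℝ) 1, lineMap C (pos (next a)) s ≠ pos (next a) := by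
    intro s hs e
    have : lineMap C (pos (next a)) s = lineMap C (pos (next a)) (1 : ℝ) := by simpa using e
    exact hs.2.ne (lineMap_injective ℝ hCB this)
  have o12 : ∀ s ∈ Ico (0 : ℝ) 1, ∀ t ∈ Ico (0 : ℝ) 1,
      lineMap (pos a) C s ≠ lineMap C (pos (next a)) t :=
    fun s hs t ht e => hC (sameRay_of_lineMap_eq hs.2 ht.1 e)
  have o1 : ∀ u, u ≠ a → ∀ s ∈ Ico (0 : ℝ) 1, ∀ t ∈ Ico (0 : ℝ) 1,
      lineMap (pos a) C s ≠ lineMap (pos u) (pos (next u)) t :=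
    fun u hu s hs t ht e => n1 s hs (e ▸ key u hu t ht (e ▸ m1 s hs))
  have o2 : ∀ u, u ≠ a → ∀ s ∈ Ico (0 : ℝ) 1, ∀ t ∈ Ico (0 : ℝ) 1,
      lineMap C (pos (next a)) s ≠ lineMap (pos u) (pos (next u)) t :=
    fun u hu s hs t ht e => n2 s hs (e ▸ key u hu t ht (e ▸ m2 s hs))
  rw [isEmbedded_iff]
  intro u w
  induction u using Fin.lastCases with
  | last =>
    induction w using Fin.lastCases with
    | last =>
      intro s hs t ht e
      rw [insertNext_last, Fin.snoc_castSucc, Fin.snoc_last] at e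
      exact ⟨rfl, lineMap_injective ℝ hCB e⟩
    | cast w =>
      intro s hs t ht e
      by_cases hw : w = a
      · subst hw
        rw [insertNext_last, insertNext_self, Fin.snoc_castSucc, Fin.snoc_last,
          Fin.snoc_castSucc] at e
        exact absurd e.symm (o12 t ht s hs)
      · rw [insertNext_last, insertNext_of_ne _ _ hw, Fin.snoc_castSucc, Fin.snoc_last,
          Fin.snoc_castSucc, Fin.snoc_castSucc] at e
        exact absurd e (o2 w hw s hs t ht)
  | cast u =>
    induction w using Fin.lastCases with
    | last =>
      intro s hs t ht e
      by_cases hw : u = a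
      · subst hw
        rw [insertNext_last, insertNext_self, Fin.snoc_castSucc, Fin.snoc_last,
          Fin.snoc_castSucc] at e
        exact absurd e (o12 s hs t ht)
      · rw [insertNext_last, insertNext_of_ne _ _ hw, Fin.snoc_castSucc, Fin.snoc_last,
          Fin.snoc_castSucc, Fin.snoc_castSucc] at e
        exact absurd e.symm (o2 u hw t ht s hs)
    | cast w =>
      intro s hs t ht e
      by_cases hu : u = a
      · subst hu
        by_cases hw : w = u
        · subst hw
          rw [insertNext_self, Fin.snoc_castSucc, Fin.snoc_last] at e
          exact ⟨rfl, lineMap_injective ℝ hCA e⟩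
        · rw [insertNext_self, insertNext_of_ne _ _ hw, Fin.snoc_castSucc, Fin.snoc_last,
            Fin.snoc_castSucc, Fin.snoc_castSucc] at e
          exact absurd e (o1 w hw s hs t ht)
      · by_cases hw : w = a
        · subst hw
          rw [insertNext_self, insertNext_of_ne _ _ hu, Fin.snoc_castSucc, Fin.snoc_last,
            Fin.snoc_castSucc, Fin.snoc_castSucc] at e
          exact absurd e.symm (o1 u hu t ht s hs)
        · rw [insertNext_of_ne _ _ hu, insertNext_of_ne _ _ hw] at e
          simp only [Fin.snoc_castSucc] at e
          obtain ⟨rfl, h2⟩ := h' u w s hs t ht e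
          exact ⟨rfl, h2⟩

open PolygonalLink in
theorem triangleMove_ofPos {n : ℕ} {next : Equiv.Perm (Fin n)} {pos : Fin n → Space}
    (h : IsEmbedded next pos) {next' : Equiv.Perm (Fin (n + 1))} {pos' : Fin (n + 1) → Space}
    (h' : IsEmbedded next' pos') (ι : Fin n ↪ Fin (n + 1)) (c : Fin (n + 1)) (a : Fin n)
    (h1 : ∀ u, ι u ≠ c) (h2 : ∀ u, pos' (ι u) = pos u) (h3 : next' (ι a) = c)
    (h4 : next' c = ι (next a)) (h5 : ∀ u, u ≠ a → next' (ι u) = ι (next u))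
    (h6 : convexHull ℝ {pos a, pos (next a), pos' c} ∩ (ClosedPolygons.mk n next pos).carrier =
      segment ℝ (pos a) (pos (next a))) :
    TriangleMove (ofPos h) (ofPos h') :=
  ⟨rfl, ι, c, a, h1, h2, h3, h4, h5, h6⟩

open PolygonalLink in
theorem triangleMove_insert {n : ℕ} {next : Equiv.Perm (Fin n)} {pos : Fin n → Space}
    (h : IsEmbedded next pos) {a : Fin n} {C : Space}
    (hT : convexHull ℝ {pos a, pos (next a), C} ∩ (ClosedPolygons.mk n next pos).carrier =
      segment ℝ (pos a) (pos (next a)))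
    (h' : IsEmbedded (insertNext next a) (Fin.snoc pos C : Fin (n + 1) → Space)) :
    TriangleMove (ofPos h) (ofPos h') := by
  refine triangleMove_ofPos h h' Fin.castSuccEmb (Fin.last n) a ?_ ?_ ?_ ?_ ?_ ?_
  · exact fun u => (Fin.castSucc_lt_last u).ne
  · exact fun u => Fin.snoc_castSucc (α := fun _ => Space) C pos u
  · exact insertNext_self next a
  · exact insertNext_last next a
  · exact fun u hu => insertNext_of_ne next a hu
  · rw [Fin.snoc_last, hT]

/-! ### Moving the vertices of a polygonal link -/

open PolygonalLink in
/-- Moving one vertex along a segment, through embedded polygons, is the composition of a triangle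
move and the inverse of a triangle move, provided that the segment leaves the plane of the two
edges at that vertex. -/
theorem equivalent_of_update {n : ℕ} {next : Equiv.Perm (Fin n)} {pos : Fin n → Space}
    (h : IsEmbedded next pos) (a : Fin n) (P : Space)
    (hQ : ∀ r ∈ Icc (0 : ℝ) 1,
      IsEmbedded next (Function.update pos (next a) (lineMap (pos (next a)) P r)))
    (hP : P - pos (next a) ∉
      Submodule.span ℝ {pos a - pos (next a), pos (next (next a)) - pos (next a)})
    (h' : IsEmbedded next (Function.update pos (next a) P)) :
    Equivalent (ofPos h) (ofPos h') := by
  have hva : next a ≠ a := h.next_ne a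
  have hvv : next (next a) ≠ next a := h.next_ne _
  set v := next a with hv
  have hin := isEmbedded_iff.1 h
  -- A relation between the three directions at the vertex cannot involve the new one.
  have gen : ∀ x y z : ℝ, x • (P - pos v) = y • (pos a - pos v) + z • (pos (next v) - pos v) →
      x = 0 := by
    intro x y z e
    by_contra hx
    apply hP
    rw [Submodule.mem_span_pair]
    refine ⟨x⁻¹ * y, x⁻¹ * z, ?_⟩
    rw [mul_smul, mul_smul, ← smul_add, ← e, smul_smul, inv_mul_cancel₀ hx, one_smul]
  have indep : ∀ y z : ℝ, 0 ≤ y → 0 ≤ z → y • (pos a - pos v) = z • (pos (next v) - pos v) →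
      y = 0 := by
    intro y z hy hz e
    by_contra hy0
    have hy' : 0 < y := lt_of_le_of_ne hy (Ne.symm hy0)
    have hd : 0 < y + z := by linarith
    have := hin a v (1 - y / (y + z)) ⟨by
        rw [sub_nonneg, div_le_one hd]; linarith, by
        have : 0 < y / (y + z) := by positivity
        linarith⟩ (z / (y + z)) ⟨by positivity, by rw [div_lt_one hd]; linarith⟩ ?_
    · exact hva this.1.symm
    · rw [← hv, lineMap_apply_one_sub, lineMap_apply_module', lineMap_apply_module', div_eq_inv_mul,
        div_eq_inv_mul, mul_smul, mul_smul, e]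
  have key1 : convexHull ℝ {pos a, pos v, P} ∩ (ClosedPolygons.mk n next pos).carrier =
      segment ℝ (pos a) (pos v) := by
    apply Subset.antisymm
    · rintro X ⟨hX, ⟨w, t⟩, ht, e⟩
      obtain ⟨r, hr, s, hs, e'⟩ := mem_triangle.1 hX
      change lineMap (pos w) (pos (next w)) t = X at e
      change t ∈ Ico (0 : ℝ) 1 at ht
      by_cases hwa : w = a
      · subst hwa
        rw [← e]
        exact mem_segment_lineMap _ _ (Ico_subset_unit ht)
      by_cases hwv : w = v
      · subst hwv
        have e2 : (s * r) • (P - pos (next a)) = (-(1 - s)) • (pos a - pos (next a)) +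
            t • (pos (next (next a)) - pos (next a)) := by
          rw [← e] at e'
          simp only [lineMap_apply_module] at e'
          rw [← sub_eq_zero] at e' ⊢
          rw [← e', ← hv]
          module
        rcases mul_eq_zero.1 (gen _ _ _ e2) with h0 | h0
        · rw [← e', h0, lineMap_apply_zero]
          exact left_mem_segment _ _ _
        · rw [← e', h0, lineMap_apply_zero]
          exact mem_segment_lineMap _ _ hs
      · exfalso
        have hnw : next w ≠ v := fun e => hwa (next.injective e)
        have hQr := isEmbedded_iff.1 (hQ r hr)
        rcases hs.2.eq_or_lt with rfl | hs1
        · refine hwv (hQr w v t ht 0 (by simp) ?_).1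
          rw [Function.update_of_ne hwv, Function.update_of_ne hnw, e, ← e']
          simp
        · refine hwa (hQr w a t ht s ⟨hs.1, hs1⟩ ?_).1
          rw [Function.update_of_ne hwv, Function.update_of_ne hnw, e, ← e',
            Function.update_of_ne hva.symm, ← hv, Function.update_self]
    · intro X hX
      refine ⟨segment_subset_convexHull (by simp) (by simp) hX, ?_⟩
      rw [segment_eq_image_lineMap] at hX
      obtain ⟨s, hs, rfl⟩ := hX
      rcases hs.2.eq_or_lt with rfl | hs1
      · exact ⟨(v, 0), by simp [ClosedPolygons.params], by simp [ClosedPolygons.point]⟩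
      · exact ⟨(a, s), ⟨hs.1, hs1⟩, rfl⟩
  have key2 : convexHull ℝ {P, pos (next v), pos v} ∩
      (ClosedPolygons.mk n next (Function.update pos v P)).carrier =
      segment ℝ P (pos (next v)) := by
    have hset : ({P, pos (next v), pos v} : Set Space) = {pos (next v), pos v, P} := by
      ext
      simp only [mem_insert_iff, mem_singleton_iff]
      tauto
    apply Subset.antisymm
    · rintro X ⟨hX, ⟨w, t⟩, ht, e⟩
      rw [hset] at hX
      obtain ⟨r, hr, s, hs, e'⟩ := mem_triangle.1 hX
      change lineMap (Function.update pos v P w) (Function.update pos v P (next w)) t = X at e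
      change t ∈ Ico (0 : ℝ) 1 at ht
      by_cases hwv : w = v
      · rw [← e, hwv, Function.update_self, Function.update_of_ne hvv]
        exact mem_segment_lineMap _ _ (Ico_subset_unit ht)
      by_cases hwa : w = a
      · rw [hwa, ← hv, Function.update_self, Function.update_of_ne hva.symm] at e
        have e2 : (s * r - t) • (P - pos v) = (1 - t) • (pos a - pos v) +
            (-(1 - s)) • (pos (next v) - pos v) := by
          rw [← e] at e'
          simp only [lineMap_apply_module] at e'
          rw [← sub_eq_zero] at e' ⊢
          rw [← e']
          module
        have h0 := gen _ _ _ e2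
        rw [h0, zero_smul] at e2
        have h1 := indep (1 - t) (1 - s) (by linarith [ht.2]) (by linarith [hs.2]) (by
          rw [← sub_eq_zero, e2]; module)
        linarith [ht.2]
      · have hnw : next w ≠ v := fun e => hwa (next.injective e)
        have hQr := isEmbedded_iff.1 (hQ r hr)
        rw [Function.update_of_ne hwv, Function.update_of_ne hnw] at e
        rcases hs.1.eq_or_lt with hs0 | hs0
        · rw [← e', ← hs0, lineMap_apply_zero]
          exact right_mem_segment _ _ _
        · exfalso
          refine hwv (hQr w v t ht (1 - s) ⟨by linarith [hs.2], by linarith⟩ ?_).1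
          rw [Function.update_of_ne hwv, Function.update_of_ne hnw, e, ← e',
            Function.update_of_ne hvv, Function.update_self, lineMap_apply_one_sub]
    · intro X hX
      refine ⟨segment_subset_convexHull (by simp) (by simp) hX, ?_⟩
      rw [segment_eq_image_lineMap] at hX
      obtain ⟨s, hs, rfl⟩ := hX
      rcases hs.2.eq_or_lt with rfl | hs1
      · refine ⟨(next v, 0), by simp [ClosedPolygons.params], ?_⟩
        simp [ClosedPolygons.point, Function.update_of_ne hvv]
      · refine ⟨(v, s), ⟨hs.1, hs1⟩, ?_⟩
        simp [ClosedPolygons.point, Function.update_of_ne hvv]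
  have hray : ¬ SameRay ℝ (pos a - P) (pos v - P) := by
    rintro (h0 | h0 | ⟨r₁, r₂, hr₁, hr₂, e⟩)
    · refine one_ne_zero (gen 1 1 0 ?_)
      rw [sub_eq_zero.1 h0]
      module
    · refine one_ne_zero (gen 1 0 0 ?_)
      rw [sub_eq_zero.1 h0]
      module
    · have e2 : (r₁ - r₂) • (P - pos v) = r₁ • (pos a - pos v) + (0 : ℝ) • (pos (next v) - pos v) := by
        rw [← sub_eq_zero] at e ⊢
        rw [← neg_eq_zero, ← e]
        module
      have h0 := gen _ _ _ e2
      rw [h0] at e2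
      exact hr₁.ne' (indep r₁ 0 hr₁.le le_rfl (by simpa using e2.symm))
  have hins : IsEmbedded (insertNext next a) (Fin.snoc pos P : Fin (n + 1) → Space) :=
    h.insert key1 hray
  refine (Relation.EqvGen.rel _ _ (triangleMove_insert h key1 hins)).trans _ _ _
    (Relation.EqvGen.symm _ _ (Relation.EqvGen.rel _ _ ?_))
  have hcl : ∀ u : Fin n, u.castSucc ≠ Fin.last n := fun u => (Fin.castSucc_lt_last u).ne
  have hι : ∀ u, u ≠ v → Equiv.swap v.castSucc (Fin.last n) u.castSucc = u.castSucc := fun u hu =>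
    Equiv.swap_apply_of_ne_of_ne (by simpa using hu) (hcl u)
  refine triangleMove_ofPos h' hins
    (Fin.castSuccEmb.trans (Equiv.swap v.castSucc (Fin.last n)).toEmbedding) v.castSucc v
    ?_ ?_ ?_ ?_ ?_ ?_
  · intro u e
    change Equiv.swap v.castSucc (Fin.last n) u.castSucc = v.castSucc at e
    have e2 := e.trans (Equiv.swap_apply_right v.castSucc (Fin.last n)).symm
    exact hcl u ((Equiv.swap _ _).injective e2)
  · intro u
    change (Fin.snoc pos P : Fin (n + 1) → Space)
      (Equiv.swap v.castSucc (Fin.last n) u.castSucc) = Function.update pos v P u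
    by_cases hu : u = v
    · subst hu
      rw [Equiv.swap_apply_left, Fin.snoc_last, Function.update_self]
    · rw [hι u hu, Fin.snoc_castSucc, Function.update_of_ne hu]
  · change insertNext next a (Equiv.swap v.castSucc (Fin.last n) v.castSucc) = _
    rw [Equiv.swap_apply_left, insertNext_last]
  · change insertNext next a v.castSucc = Equiv.swap v.castSucc (Fin.last n) (next v).castSucc
    rw [insertNext_of_ne _ _ hva, hι _ hvv]
  · intro u hu
    change insertNext next a (Equiv.swap v.castSucc (Fin.last n) u.castSucc) =
      Equiv.swap v.castSucc (Fin.last n) (next u).castSucc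
    rw [hι u hu]
    by_cases hua : u = a
    · rw [hua, insertNext_self, ← hv, Equiv.swap_apply_left]
    · rw [insertNext_of_ne _ _ hua, hι _ fun e => hua (next.injective e)]
  · change convexHull ℝ {Function.update pos v P v, Function.update pos v P (next v),
      (Fin.snoc pos P : Fin (n + 1) → Space) v.castSucc} ∩
      (ClosedPolygons.mk n next (Function.update pos v P)).carrier =
      segment ℝ (Function.update pos v P v) (Function.update pos v P (next v))
    rw [Function.update_self, Function.update_of_ne hvv, Fin.snoc_castSucc, key2]

/-- Embeddedness in terms of the closed edges: no edge turns back on the preceding one, and edges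
without a common vertex are disjoint. All these conditions are visibly open. -/
theorem isEmbedded_iff_closed {n : ℕ} {next : Equiv.Perm (Fin n)} {pos : Fin n → Space} :
    IsEmbedded next pos ↔
      (∀ v, ¬ SameRay ℝ (pos v - pos (next v)) (pos (next (next v)) - pos (next v))) ∧
      ∀ v w, w ≠ v → w ≠ next v → v ≠ next w → ∀ s ∈ Icc (0 : ℝ) 1, ∀ t ∈ Icc (0 : ℝ) 1,
        lineMap (pos v) (pos (next v)) s ≠ lineMap (pos w) (pos (next w)) t := by
  constructor
  · intro h
    have h' := isEmbedded_iff.1 h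
    refine ⟨?_, ?_⟩
    · rintro v (h0 | h0 | ⟨r₁, r₂, hr₁, hr₂, e⟩)
      · exact h.next_ne v (h.pos_injective (sub_eq_zero.1 h0)).symm
      · exact h.next_ne _ (h.pos_injective (sub_eq_zero.1 h0))
      · have hd : 0 < r₁ + r₂ := by linarith
        refine h.next_ne v (h' v (next v) (1 - r₁ / (r₁ + r₂)) ⟨by
          rw [sub_nonneg, div_le_one hd]; linarith, by
          have : 0 < r₁ / (r₁ + r₂) := by positivity
          linarith⟩ (r₂ / (r₁ + r₂)) ⟨by positivity, by rw [div_lt_one hd]; linarith⟩ ?_).1.symm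
        rw [lineMap_apply_one_sub, lineMap_apply_module', lineMap_apply_module', div_eq_inv_mul,
          div_eq_inv_mul, mul_smul, mul_smul, e]
    · intro v w h1 h2 h3 s hs t ht e
      rcases hs.2.eq_or_lt with hs1 | hs1 <;> rcases ht.2.eq_or_lt with ht1 | ht1
      · rw [hs1, ht1, lineMap_apply_one, lineMap_apply_one] at e
        exact h1 (next.injective (h.pos_injective e)).symm
      · refine h2 (h' (next v) w 0 (by simp) t ⟨ht.1, ht1⟩ ?_).1.symm
        rw [← e, hs1, lineMap_apply_one, lineMap_apply_zero]
      · refine h3 (h' v (next w) s ⟨hs.1, hs1⟩ 0 (by simp) ?_).1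
        rw [e, ht1, lineMap_apply_one, lineMap_apply_zero]
      · exact h1 (h' v w s ⟨hs.1, hs1⟩ t ⟨ht.1, ht1⟩ e).1.symm
  · rintro ⟨h1, h2⟩
    have hne : ∀ v, pos v ≠ pos (next v) := fun v e => h1 v (by rw [e, sub_self]; exact .zero_left _)
    have hadj : ∀ v, ∀ s ∈ Ico (0 : ℝ) 1, ∀ t ∈ Ico (0 : ℝ) 1,
        lineMap (pos v) (pos (next v)) s ≠ lineMap (pos (next v)) (pos (next (next v))) t :=
      fun v s hs t ht e => h1 v (sameRay_of_lineMap_eq hs.2 ht.1 e)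
    rw [isEmbedded_iff]
    intro v w s hs t ht e
    by_cases hw : w = v
    · subst hw
      exact ⟨rfl, lineMap_injective ℝ (hne w) e⟩
    · exfalso
      by_cases hw1 : w = next v
      · subst hw1
        exact hadj v s hs t ht e
      · by_cases hw2 : v = next w
        · subst hw2
          exact hadj w t ht s hs e.symm
        · exact h2 v w hw hw1 hw2 s (Ico_subset_unit hs) t (Ico_subset_unit ht) e

theorem isOpen_isEmbedded {n : ℕ} (next : Equiv.Perm (Fin n)) :
    IsOpen {pos : Fin n → Space | IsEmbedded next pos} := by
  have : {pos : Fin n → Space | IsEmbedded next pos} =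
      (⋂ v, {pos | ¬ SameRay ℝ (pos v - pos (next v)) (pos (next (next v)) - pos (next v))}) ∩
      ⋂ v, ⋂ w, {pos | w ≠ v → w ≠ next v → v ≠ next w →
        ∀ x ∈ Icc (0 : ℝ) 1 ×ˢ Icc (0 : ℝ) 1,
        lineMap (pos v) (pos (next v)) x.1 ≠ lineMap (pos w) (pos (next w)) x.2} := by
    ext pos
    simp only [mem_ofPred_eq, isEmbedded_iff_closed, mem_inter_iff, mem_iInter, mem_prod,
      Prod.forall, and_imp]
    refine and_congr Iff.rfl ⟨fun h v w h1 h2 h3 s t hs ht => h v w h1 h2 h3 s hs t ht,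
      fun h v w h1 h2 h3 s hs t ht => h v w h1 h2 h3 s t hs ht⟩
  rw [this]
  refine IsOpen.inter (isOpen_iInter_of_finite fun v => ?_)
    (isOpen_iInter_of_finite fun v => isOpen_iInter_of_finite fun w => ?_)
  · simp only [sameRay_iff_norm_smul_eq]
    exact (isClosed_eq (by fun_prop) (by fun_prop)).isOpen_compl
  · by_cases h1 : w ≠ v
    swap
    · simp [h1]
    by_cases h2 : w ≠ next v
    swap
    · simp [h2]
    by_cases h3 : v ≠ next w
    swap
    · simp [not_not.1 h3]
    simp only [h1, h2, h3, not_false_eq_true, ne_eq, true_imp_iff]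
    rw [isOpen_iff_eventually]
    intro pos hpos
    refine (isCompact_Icc.prod isCompact_Icc).eventually_forall_of_forall_eventually ?_
    intro x hx
    have hc : ∀ u, Continuous fun z : (Fin n → Space) × (ℝ × ℝ) =>
        (lineMap (z.1 u) (z.1 (next u)) : ℝ → Space) z.2.1 := by
      intro u
      simp only [lineMap_apply_module]
      fun_prop
    have hc' : ∀ u, Continuous fun z : (Fin n → Space) × (ℝ × ℝ) =>
        (lineMap (z.1 u) (z.1 (next u)) : ℝ → Space) z.2.2 := by
      intro u
      simp only [lineMap_apply_module]
      fun_prop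
    exact (isClosed_eq (hc v) (hc' w)).isOpen_compl.mem_nhds (hpos x hx)

theorem dense_sub_notMem_span_pair (x y z : Space) :
    Dense {P : Space | P - x ∉ Submodule.span ℝ {y, z}} ∧
      IsOpen {P : Space | P - x ∉ Submodule.span ℝ {y, z}} := by
  have hW : Submodule.span ℝ {y, z} ≠ ⊤ := by
    intro e
    have h1 : Module.finrank ℝ (Submodule.span ℝ {y, z}) ≤ 2 := by
      classical
      refine (finrank_span_le_card ({y, z} : Set Space)).trans ?_
      rw [toFinset_insert, toFinset_singleton]
      exact Finset.card_le_two
    rw [e, finrank_top] at h1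
    simp [Space, Plane] at h1
  have hcl : IsClosed {P : Space | P - x ∈ Submodule.span ℝ {y, z}} :=
    (Submodule.closed_of_finiteDimensional _).preimage (continuous_id.sub continuous_const)
  refine ⟨?_, hcl.isOpen_compl⟩
  have : {P : Space | P - x ∉ Submodule.span ℝ {y, z}} =
      (Homeomorph.subRight x) ⁻¹' (Submodule.span ℝ {y, z} : Set Space)ᶜ := rfl
  rw [this]
  refine Dense.preimage ?_ (Homeomorph.subRight x).isOpenMap
  rw [← interior_eq_empty_iff_dense_compl]
  by_contra hne
  exact hW (Submodule.eq_top_of_nonempty_interior' _ (nonempty_iff_ne_empty.2 hne))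

theorem PolygonalLink.ofPos_congr {n : ℕ} {next : Equiv.Perm (Fin n)} {pos pos' : Fin n → Space}
    (e : pos = pos') (h : IsEmbedded next pos) (h' : IsEmbedded next pos') : ofPos h = ofPos h' := by
  subst e
  rfl

theorem PolygonalLink.Equivalent.symm {K K' : PolygonalLink} (h : K.Equivalent K') :
    K'.Equivalent K :=
  Relation.EqvGen.symm _ _ h

theorem PolygonalLink.Equivalent.trans {K K' K'' : PolygonalLink} (h : K.Equivalent K')
    (h' : K'.Equivalent K'') : K.Equivalent K'' :=
  Relation.EqvGen.trans _ _ _ h h'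

theorem update_lineMap {n : ℕ} (pos : Fin n → Space) (v : Fin n) (P Q : Space) (r : ℝ) :
    Function.update pos v (lineMap P Q r) =
      lineMap (Function.update pos v P) (Function.update pos v Q) r := by
  ext1 u
  by_cases hu : u = v
  · subst hu
    simp [lineMap_apply_module]
  · simp [lineMap_apply_module, hu, ← add_smul]

open PolygonalLink in
/-- Inside a convex open set of embedded positions, changing one vertex does not change the link.
The vertex is moved via a third point in general position. -/
theorem equivalent_of_update_mem {n : ℕ} {next : Equiv.Perm (Fin n)} {U : Set (Fin n → Space)}
    (hU : IsOpen U) (hconv : Convex ℝ U) (hE : ∀ pos ∈ U, IsEmbedded next pos)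
    {pos : Fin n → Space} (hpos : pos ∈ U) (v : Fin n) {P : Space}
    (hP : Function.update pos v P ∈ U) :
    Equivalent (ofPos (hE _ hpos)) (ofPos (hE _ hP)) := by
  obtain ⟨a, rfl⟩ := next.surjective v
  set v := next a with hv
  obtain ⟨d1, o1⟩ := dense_sub_notMem_span_pair (pos v) (pos a - pos v)
    (pos (next v) - pos v)
  obtain ⟨d2, o2⟩ := dense_sub_notMem_span_pair P (pos a - P) (pos (next v) - P)
  have hV : IsOpen {Q : Space | Function.update pos v Q ∈ U} :=
    hU.preimage (continuous_const.update v continuous_id)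
  obtain ⟨Q, hQV, hQ1, hQ2⟩ := (d1.inter_of_isOpen_left d2 o1).inter_open_nonempty _ hV
    ⟨P, hP⟩
  have hav : a ≠ v := ((hE _ hpos).next_ne a).symm
  have hnv : next v ≠ v := (hE _ hpos).next_ne v
  have e1 : Equivalent (ofPos (hE _ hpos)) (ofPos (hE _ hQV)) := by
    refine equivalent_of_update (hE _ hpos) a Q (fun r hr => hE _ ?_) hQ1 (hE _ hQV)
    rw [update_lineMap, Function.update_eq_self]
    exact hconv.lineMap_mem hpos hQV hr
  have e2 : Function.update (Function.update pos v P) v Q = Function.update pos v Q := by simp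
  have hQ' : IsEmbedded next (Function.update (Function.update pos v P) v Q) := by
    rw [e2]; exact hE _ hQV
  have e3 : Equivalent (ofPos (hE _ hP)) (ofPos hQ') := by
    refine equivalent_of_update (hE _ hP) a Q (fun r hr => hE _ ?_) ?_ hQ'
    · rw [← hv, Function.update_self, Function.update_idem, update_lineMap]
      exact hconv.lineMap_mem hP hQV hr
    · rw [← hv, Function.update_self, Function.update_of_ne hav, Function.update_of_ne hnv]
      exact hQ2
  rw [ofPos_congr e2 hQ' (hE _ hQV)] at e3
  exact e1.trans e3.symm

open PolygonalLink in
theorem equivalent_of_mem {n : ℕ} {next : Equiv.Perm (Fin n)} {U : Set (Fin n → Space)}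
    (hU : IsOpen U) (hconv : Convex ℝ U) (hE : ∀ pos ∈ U, IsEmbedded next pos)
    (hbox : ∀ x ∈ U, ∀ y ∈ U, ∀ s : Finset (Fin n), s.piecewise y x ∈ U)
    {x y : Fin n → Space} (hx : x ∈ U) (hy : y ∈ U) :
    Equivalent (ofPos (hE _ hx)) (ofPos (hE _ hy)) := by
  have key : ∀ s : Finset (Fin n),
      Equivalent (ofPos (hE _ hx)) (ofPos (hE _ (hbox x hx y hy s))) := by
    intro s
    induction s using Finset.induction_on with
    | empty =>
      rw [ofPos_congr (Finset.piecewise_empty y x) _ (hE _ hx)]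
      exact Relation.EqvGen.refl _
    | insert v s hv ih =>
      refine ih.trans ?_
      have hup := s.piecewise_insert y x v
      have hm := hbox x hx y hy (insert v s)
      rw [hup] at hm
      rw [ofPos_congr hup _ (hE _ hm)]
      exact equivalent_of_update_mem hU hconv hE (hbox x hx y hy s) v hm
  have := key Finset.univ
  rwa [ofPos_congr (Finset.piecewise_univ y x) _ (hE _ hy)] at this

open PolygonalLink in
/-- An isotopy of the vertices through embedded polygons is an equivalence. -/
theorem equivalent_of_isPreconnected {n : ℕ} {next : Equiv.Perm (Fin n)}
    {s : Set (Fin n → Space)} (hs : IsPreconnected s) (hE : ∀ pos ∈ s, IsEmbedded next pos)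
    {x y : Fin n → Space} (hx : x ∈ s) (hy : y ∈ s) :
    Equivalent (ofPos (hE _ hx)) (ofPos (hE _ hy)) := by
  suffices H : ∀ (h1 : IsEmbedded next x) (h2 : IsEmbedded next y),
      Equivalent (ofPos h1) (ofPos h2) from H _ _
  refine hs.induction₂ (fun x y => ∀ (h1 : IsEmbedded next x) (h2 : IsEmbedded next y),
      Equivalent (ofPos h1) (ofPos h2)) ?_ ?_ ?_ hx hy
  · intro x hx
    obtain ⟨ε, hε, hball⟩ := Metric.isOpen_iff.1 (isOpen_isEmbedded next) x (hE x hx)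
    refine mem_nhdsWithin_of_mem_nhds (Filter.mem_of_superset (Metric.ball_mem_nhds x hε) ?_)
    intro y hy h1 h2
    refine equivalent_of_mem Metric.isOpen_ball (convex_ball x ε) hball ?_
      (Metric.mem_ball_self hε) hy
    intro z hz w hw t
    rw [mem_ball_iff_norm, pi_norm_lt_iff hε] at hz hw ⊢
    intro u
    by_cases hu : u ∈ t
    · simpa [hu] using hw u
    · simpa [hu] using hz u
  · intro x y z hx hy hz h1 h2 h3 h4
    exact (h1 h3 (hE _ hy)).trans (h2 _ h4)
  · intro x y hx hy h h1 h2
    exact (h h2 h1).symm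

/-! ### The winding number of a simple closed polygon -/

theorem eqOn_of_exp_const {X : Type*} [TopologicalSpace X] {s : Set X} (hs : IsPreconnected s)
    {g : X → ℝ} (hg : ContinuousOn g s) {w : ℂ} (h : ∀ x ∈ s, Complex.exp (g x * Complex.I) = w)
    {x y : X} (hx : x ∈ s) (hy : y ∈ s) : g x = g y := by
  have hc : (g '' s).Countable := by
    refine (countable_range fun n : ℤ => g x + n * (2 * Real.pi)).mono ?_
    rintro _ ⟨z, hz, rfl⟩
    obtain ⟨n, hn⟩ := Complex.exp_eq_exp_iff_exists_int.1 ((h z hz).trans (h x hx).symm)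
    refine ⟨n, ?_⟩
    have h2 : (g z : ℂ) = g x + n * (2 * Real.pi) := by
      refine mul_right_cancel₀ Complex.I_ne_zero ?_
      rw [hn]
      ring
    exact_mod_cast h2.symm
  exact hc.isTotallyDisconnected _ Subset.rfl (hs.image g hg) (mem_image_of_mem g hx)
    (mem_image_of_mem g hy)

theorem continuousOn_arg_div {f g : ℝ → ℂ} {s : Set ℝ} (hf : Continuous f) (hg : Continuous g)
    (h : ∀ r ∈ s, f r / g r ∈ Complex.slitPlane) :
    ContinuousOn (fun r => Complex.arg (f r / g r)) s := by
  intro r hr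
  have hg0 : g r ≠ 0 := by
    intro h0
    have := h r hr
    rw [h0, div_zero] at this
    exact Complex.slitPlane_ne_zero this rfl
  exact (ContinuousAt.comp (f := fun r => f r / g r) (Complex.continuousAt_arg (h r hr))
    (hf.continuousAt.div hg.continuousAt hg0)).continuousWithinAt

theorem exists_of_notMem_slitPlane {z : ℂ} (h : z ∉ Complex.slitPlane) :
    ∃ r : ℝ, 0 ≤ r ∧ z = -r := by
  rw [Complex.mem_slitPlane_iff] at h
  push Not at h
  refine ⟨-z.re, by linarith [h.1], ?_⟩
  apply Complex.ext <;> simp [h.2]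

theorem div_mem_slitPlane {a b p : ℂ} (h : ∀ s ∈ Icc (0 : ℝ) 1, lineMap a b s ≠ p) :
    (b - p) / (a - p) ∈ Complex.slitPlane := by
  by_contra hn
  obtain ⟨r, hr, e⟩ := exists_of_notMem_slitPlane hn
  have ha : a - p ≠ 0 := by
    intro h0
    exact h 0 (by simp) (by simpa using sub_eq_zero.1 h0)
  rw [div_eq_iff ha] at e
  have hr1 : (0 : ℝ) < 1 + r := by linarith
  refine h (1 / (1 + r)) ⟨by positivity, by rw [div_le_one hr1]; linarith⟩ ?_
  rw [lineMap_apply_module']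
  have hc : ((1 + r : ℝ) : ℂ) ≠ 0 := by exact_mod_cast hr1.ne'
  simp only [Complex.real_smul]
  push_cast at hc ⊢
  field_simp
  linear_combination e

theorem exp_arg_mul_I {z : ℂ} (hz : z ≠ 0) : Complex.exp (z.arg * Complex.I) = z / ‖z‖ := by
  rw [eq_div_iff (by simpa using hz), mul_comm]
  exact Complex.norm_mul_exp_arg_mul_I z

theorem arg_div_congr {a b : ℂ} (r : ℝ) (hr : 0 < r) (e : a = r * b) :
    Complex.arg a = Complex.arg b := by
  rw [e, Complex.arg_real_mul b hr]

section Winding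

variable {I : Type*} (S : Equiv.Perm I) (q : I → ℂ)

/-- The closed polygons with edges from `q i` to `q (S i)` are simple and disjoint. -/
def IsSimplePolygon : Prop :=
  ∀ i j, ∀ s ∈ Ico (0 : ℝ) 1, ∀ t ∈ Ico (0 : ℝ) 1,
    lineMap (q i) (q (S i)) s = lineMap (q j) (q (S j)) t → i = j ∧ s = t

/-- The angle under which the edge from `q i` to `q (S i)` is seen from `p`. -/
noncomputable def edgeAngle (p : ℂ) (i : I) : ℝ := Complex.arg ((q (S i) - p) / (q i - p))

/-- The winding number of the polygon around `p`, multiplied by `2π`. -/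
noncomputable def winding [Fintype I] (p : ℂ) : ℝ := ∑ i, edgeAngle S q p i

/-- The turning angle of the polygon at the vertex `i`. -/
noncomputable def turnAngle (i : I) : ℝ := Complex.arg ((q (S i) - q i) / (q i - q (S⁻¹ i)))

/-- The mean of the values of `winding` on the two sides of the polygon near the vertex `i`. -/
noncomputable def vertexWinding [Fintype I] [DecidableEq I] (i : I) : ℝ :=
  ∑ j ∈ {i, S⁻¹ i}ᶜ, edgeAngle S q (q i) j + turnAngle S q i

variable {S q}

theorem exp_sum_edgeAngle [Fintype I] {p : ℂ} (h : ∀ i, q i ≠ p) :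
    Complex.exp ((winding S q p : ℝ) * Complex.I) = 1 := by
  have hne : ∀ i, q i - p ≠ 0 := fun i => sub_ne_zero.2 (h i)
  have h1 : ∀ i, Complex.exp ((edgeAngle S q p i : ℝ) * Complex.I) =
      ((q (S i) - p) / ‖q (S i) - p‖) / ((q i - p) / ‖q i - p‖) := by
    intro i
    rw [edgeAngle, exp_arg_mul_I (div_ne_zero (hne _) (hne _)), norm_div]
    push_cast
    have := hne i
    have := norm_ne_zero_iff.2 (hne i)
    have := norm_ne_zero_iff.2 (hne (S i))
    field_simp
  have h2 : ∏ i, ((q (S i) - p) / (‖q (S i) - p‖ : ℂ)) = ∏ i, ((q i - p) / (‖q i - p‖ : ℂ)) :=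
    Equiv.prod_comp S fun i => (q i - p) / (‖q i - p‖ : ℂ)
  rw [winding]
  push_cast
  rw [Finset.sum_mul, Complex.exp_sum, Finset.prod_congr rfl fun i _ => h1 i,
    Finset.prod_div_distrib, h2, div_self]
  exact Finset.prod_ne_zero_iff.2 fun i _ => div_ne_zero (hne i)
    (by simpa using norm_ne_zero_iff.2 (hne i))

theorem winding_eq [Fintype I] {x y : ℂ}
    (h : ∀ r ∈ Icc (0 : ℝ) 1, ∀ i, ∀ s ∈ Icc (0 : ℝ) 1,
      lineMap (q i) (q (S i)) s ≠ (lineMap x y r : ℂ)) :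
    winding S q x = winding S q y := by
  have hc : ContinuousOn (fun r : ℝ => winding S q (lineMap x y r)) (Icc 0 1) := by
    refine continuousOn_finsetSum _ fun i _ => ?_
    refine continuousOn_arg_div ?_ ?_ fun r hr => div_mem_slitPlane (h r hr i)
    · exact continuous_const.sub lineMap_continuous
    · exact continuous_const.sub lineMap_continuous
  have := eqOn_of_exp_const isPreconnected_Icc hc (w := 1)
    (fun r hr => exp_sum_edgeAngle fun i => by simpa using h r hr i 0 (by simp))
    (left_mem_Icc.2 zero_le_one) (right_mem_Icc.2 zero_le_one)
  simpa using this

namespace IsSimplePolygon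

theorem injective (h : IsSimplePolygon S q) : Function.Injective q := fun i j e =>
  (h i j 0 (by simp) 0 (by simp) (by simpa using e)).1

theorem map_ne (h : IsSimplePolygon S q) (i : I) : S i ≠ i := by
  intro e
  have := (h i i 0 (by simp) (1 / 2) (by norm_num) (by simp [e])).2
  norm_num at this

theorem map_map_ne (h : IsSimplePolygon S q) (i : I) : S (S i) ≠ i := by
  intro e
  refine h.map_ne i (h i (S i) (1 / 2) (by norm_num) (1 / 2) (by norm_num) ?_).1.symm
  rw [e, lineMap_apply_module, lineMap_apply_module, add_comm]
  norm_num

theorem inv_ne (h : IsSimplePolygon S q) (i : I) : S⁻¹ i ≠ i := fun e => h.map_ne i (by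
  nth_rw 1 [← e]; simp)

theorem inv_ne_map (h : IsSimplePolygon S q) (i : I) : S⁻¹ i ≠ S i := fun e => h.map_map_ne i (by
  rw [← e]; simp)

theorem vertex_notMem (h : IsSimplePolygon S q) {i j : I} (h1 : j ≠ i) (h2 : S j ≠ i) :
    ∀ s ∈ Icc (0 : ℝ) 1, lineMap (q j) (q (S j)) s ≠ q i := by
  intro s hs e
  rcases hs.2.eq_or_lt with rfl | hs1
  · exact h2 (h.injective (by simpa using e))
  · exact h1 (h j i s ⟨hs.1, hs1⟩ 0 (by simp) (by simpa using e)).1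

theorem interior_notMem (h : IsSimplePolygon S q) {i j : I} (h1 : j ≠ i) {r : ℝ} (hr : r ∈ Ioo (0 : ℝ) 1) :
    ∀ s ∈ Icc (0 : ℝ) 1, lineMap (q j) (q (S j)) s ≠ lineMap (q i) (q (S i)) r := by
  intro s hs e
  rcases hs.2.eq_or_lt with rfl | hs1
  · have := (h i (S j) r ⟨hr.1.le, hr.2⟩ 0 (by simp) (by simpa using e.symm)).2
    exact hr.1.ne' this
  · exact h1 (h j i s ⟨hs.1, hs1⟩ r ⟨hr.1.le, hr.2⟩ e).1

/-- Seen from a point of the edge `i`, the next edge does not turn back. -/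
theorem next_slit (h : IsSimplePolygon S q) (i : I) {r : ℝ} (hr : r ∈ Icc (0 : ℝ) 1) :
    (q (S (S i)) - lineMap (q i) (q (S i)) r) / (q (S i) - q i) ∈ Complex.slitPlane := by
  by_contra hn
  obtain ⟨l, hl, e⟩ := exists_of_notMem_slitPlane hn
  have hd : q (S i) - q i ≠ 0 := sub_ne_zero.2 fun e => h.map_ne i (h.injective e)
  rw [div_eq_iff hd, lineMap_apply_module', Complex.real_smul] at e
  rcases le_or_gt 0 (r - l) with h0 | h0
  · refine h.vertex_notMem (i := S (S i)) (j := i) (h.map_map_ne i).symm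
      (h.map_ne (S i)).symm (r - l) ⟨h0, by linarith [hr.2]⟩ ?_
    rw [lineMap_apply_module', Complex.real_smul]
    push_cast
    linear_combination -e
  · have hp : 0 < 1 - (r - l) := by linarith
    refine h.vertex_notMem (i := i) (j := S i) (h.map_ne i) (h.map_map_ne i)
      (1 / (1 - (r - l))) ⟨by positivity, by rw [div_le_one hp]; linarith⟩ ?_
    have hp' : ((1 - (r - l) : ℝ) : ℂ) ≠ 0 := by exact_mod_cast hp.ne'
    rw [lineMap_apply_module', Complex.real_smul]
    push_cast at hp' ⊢
    field_simp
    linear_combination e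

/-- Seen from a point of the edge `i`, the preceding edge does not come from ahead. -/
theorem prev_slit (h : IsSimplePolygon S q) (i : I) {r : ℝ} (hr : r ∈ Icc (0 : ℝ) 1) :
    (q (S i) - q i) / (lineMap (q i) (q (S i)) r - q (S⁻¹ i)) ∈ Complex.slitPlane := by
  have hS : S (S⁻¹ i) = i := by simp
  suffices hs : (lineMap (q i) (q (S i)) r - q (S⁻¹ i)) / (q (S i) - q i) ∈ Complex.slitPlane by
    rw [Complex.mem_slitPlane_iff_arg] at hs ⊢
    rw [← inv_div]
    refine ⟨?_, inv_ne_zero hs.2⟩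
    rw [Complex.arg_inv, if_neg hs.1]
    linarith [Complex.neg_pi_lt_arg ((lineMap (q i) (q (S i)) r - q (S⁻¹ i)) / (q (S i) - q i))]
  by_contra hn
  obtain ⟨l, hl, e⟩ := exists_of_notMem_slitPlane hn
  have hd : q (S i) - q i ≠ 0 := sub_ne_zero.2 fun e => h.map_ne i (h.injective e)
  rw [div_eq_iff hd, lineMap_apply_module', Complex.real_smul] at e
  rcases le_or_gt (r + l) 1 with h0 | h0
  · refine h.vertex_notMem (i := S⁻¹ i) (j := i) (h.inv_ne i).symm
      (h.inv_ne_map i).symm (r + l) ⟨by linarith [hr.1], h0⟩ ?_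
    rw [lineMap_apply_module', Complex.real_smul]
    push_cast
    linear_combination e
  · have hp : 0 < r + l := by linarith
    refine h.vertex_notMem (i := S i) (j := S⁻¹ i) (h.inv_ne_map i) (by
        rw [hS]; exact (h.map_ne i).symm)
      (1 - 1 / (r + l)) ⟨by rw [sub_nonneg, div_le_one hp]; linarith, by
        have : 0 < 1 / (r + l) := by positivity
        linarith⟩ ?_
    have hp' : ((r + l : ℝ) : ℂ) ≠ 0 := by exact_mod_cast hp.ne'
    rw [hS, lineMap_apply_one_sub, lineMap_apply_module', Complex.real_smul]
    push_cast at hp' ⊢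
    field_simp
    linear_combination -e

theorem vertexWinding_map [Fintype I] [DecidableEq I] (h : IsSimplePolygon S q) (i : I) : vertexWinding S q (S i) = vertexWinding S q i := by
  have hS : S (S⁻¹ i) = i := by simp
  have hd : q (S i) - q i ≠ 0 := sub_ne_zero.2 fun e => h.map_ne i (h.injective e)
  have hS' : S⁻¹ (S i) = i := by simp
  set d := q (S i) - q i with hd'
  let G : ℝ → ℝ := fun r => ∑ j ∈ {i, S⁻¹ i, S i}ᶜ, edgeAngle S q (lineMap (q i) (q (S i)) r) j +
    Complex.arg ((q (S (S i)) - lineMap (q i) (q (S i)) r) / d) +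
    Complex.arg (d / (lineMap (q i) (q (S i)) r - q (S⁻¹ i)))
  have hGc : ContinuousOn G (Icc 0 1) := by
    refine ContinuousOn.add (ContinuousOn.add (continuousOn_finsetSum _ fun j hj => ?_) ?_) ?_
    · simp only [Finset.mem_compl, Finset.mem_insert, Finset.mem_singleton, not_or] at hj
      refine continuousOn_arg_div (continuous_const.sub lineMap_continuous)
        (continuous_const.sub lineMap_continuous) fun r hr => div_mem_slitPlane ?_
      rcases hr.1.eq_or_lt with rfl | hr0
      · rw [lineMap_apply_zero]
        refine h.vertex_notMem hj.1 fun e => hj.2.1 ?_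
        rw [← e]; simp
      rcases hr.2.eq_or_lt with rfl | hr1
      · rw [lineMap_apply_one]
        exact h.vertex_notMem hj.2.2 fun e => hj.1 (S.injective e)
      · exact h.interior_notMem hj.1 ⟨hr0, hr1⟩
    · exact continuousOn_arg_div (continuous_const.sub lineMap_continuous) continuous_const
        fun r hr => h.next_slit i hr
    · exact continuousOn_arg_div continuous_const (lineMap_continuous.sub continuous_const)
        fun r hr => h.prev_slit i hr
  have hsplit : ∀ f : I → ℝ, ∑ j ∈ {i, S⁻¹ i, S i}ᶜ, f j + f (S i) + f (S⁻¹ i) + f i = ∑ j, f j := by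
    intro f
    rw [← Finset.sum_compl_add_sum {i, S⁻¹ i, S i}, Finset.sum_insert, Finset.sum_pair
      (h.inv_ne_map i)]
    · ring
    · simpa using ⟨(h.inv_ne i).symm, (h.map_ne i).symm⟩
  have hGe : ∀ r ∈ Ioo (0 : ℝ) 1, Complex.exp (G r * Complex.I) = -1 := by
    intro r hr
    have hp : ∀ j, q j ≠ lineMap (q i) (q (S i)) r := by
      intro j e
      exact hr.1.ne' (h i j r ⟨hr.1.le, hr.2⟩ 0 (by simp) (by simpa using e.symm)).2
    have h1 : q (S i) - lineMap (q i) (q (S i)) r = ((1 - r : ℝ) : ℂ) * d := by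
      rw [lineMap_apply_module', Complex.real_smul]
      push_cast
      ring
    have h2 : q i - lineMap (q i) (q (S i)) r = -((r : ℝ) : ℂ) * d := by
      rw [lineMap_apply_module', Complex.real_smul]
      ring
    have hr0 : (r : ℂ) ≠ 0 := by exact_mod_cast hr.1.ne'
    have hr1 : ((1 - r : ℝ) : ℂ) ≠ 0 := by exact_mod_cast (sub_pos.2 hr.2).ne'
    have e1 : Complex.arg ((q (S (S i)) - lineMap (q i) (q (S i)) r) / d) =
        edgeAngle S q (lineMap (q i) (q (S i)) r) (S i) := by
      rw [edgeAngle, h1]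
      refine arg_div_congr (1 - r) (sub_pos.2 hr.2) ?_
      field_simp
    have e2 : Complex.arg (d / (lineMap (q i) (q (S i)) r - q (S⁻¹ i))) =
        edgeAngle S q (lineMap (q i) (q (S i)) r) (S⁻¹ i) := by
      rw [edgeAngle, hS, h2]
      have := sub_ne_zero.2 (hp (S⁻¹ i)).symm
      have h3 := sub_ne_zero.2 (hp (S⁻¹ i))
      refine (arg_div_congr r hr.1 ?_).symm
      rw [← neg_sub (lineMap (q i) (q (S i)) r), neg_mul, neg_div_neg_eq]
      ring
    have e3 : edgeAngle S q (lineMap (q i) (q (S i)) r) i = Real.pi := by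
      rw [edgeAngle, h1, h2, ← Complex.arg_neg_one]
      refine arg_div_congr ((1 - r) / r) (div_pos (sub_pos.2 hr.2) hr.1) ?_
      push_cast
      field_simp
    have hG : G r = winding S q (lineMap (q i) (q (S i)) r) - Real.pi := by
      rw [winding, ← hsplit, e3]
      simp only [G, e1, e2]
      ring
    rw [hG]
    push_cast
    rw [sub_mul, Complex.exp_sub, exp_sum_edgeAngle hp, Complex.exp_pi_mul_I]
    norm_num
  have hG01 : G 0 = G 1 := by
    have hcl : Icc (0 : ℝ) 1 ⊆ closure (Ioo 0 1) := by rw [closure_Ioo zero_ne_one]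
    have hE : EqOn G (fun _ => G (1 / 2)) (Icc 0 1) :=
      EqOn.of_subset_closure (fun r hr => eqOn_of_exp_const isPreconnected_Ioo
        (hGc.mono Ioo_subset_Icc_self) hGe hr (by norm_num)) hGc continuousOn_const
        Ioo_subset_Icc_self hcl
    rw [hE (left_mem_Icc.2 zero_le_one), hE (right_mem_Icc.2 zero_le_one)]
  have hG0 : G 0 = vertexWinding S q i := by
    have : ({i, S⁻¹ i}ᶜ : Finset I) = insert (S i) {i, S⁻¹ i, S i}ᶜ := by
      ext j
      simp only [Finset.mem_compl, Finset.mem_insert, Finset.mem_singleton]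
      have := h.map_ne i
      have := h.inv_ne_map i
      grind
    simp only [G, vertexWinding, this, lineMap_apply_zero]
    rw [Finset.sum_insert (by simp), edgeAngle, turnAngle]
    ring
  have hG1 : G 1 = vertexWinding S q (S i) := by
    have : ({S i, S⁻¹ (S i)}ᶜ : Finset I) = insert (S⁻¹ i) {i, S⁻¹ i, S i}ᶜ := by
      ext j
      simp only [Finset.mem_compl, Finset.mem_insert, Finset.mem_singleton, hS']
      have := h.inv_ne i
      have := h.inv_ne_map i
      grind
    simp only [G, vertexWinding, this, lineMap_apply_one]
    rw [Finset.sum_insert (by simp), edgeAngle, turnAngle, hS, hS', hd',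
      ← neg_sub (q (S i)) (q i), ← neg_sub (q (S i)) (q (S⁻¹ i)), neg_div_neg_eq]
    ring
  rw [← hG1, ← hG01, hG0]

theorem sum_compl_pair [Fintype I] [DecidableEq I] (i : I) (hne : i ≠ S⁻¹ i) (f : I → ℝ) :
    ∑ j ∈ {i, S⁻¹ i}ᶜ, f j + f i + f (S⁻¹ i) = ∑ j, f j := by
  rw [← Finset.sum_compl_add_sum {i, S⁻¹ i}, Finset.sum_pair hne]
  ring

/-- The winding number along a segment that starts at the vertex `i`, where `A` is the sum of the
angles of the two edges at `i`. -/
theorem winding_of_segment [Fintype I] [DecidableEq I] (h : IsSimplePolygon S q) (i : I) (x : ℂ)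
    (hoff : ∀ r ∈ Ioc (0 : ℝ) 1, ∀ j, ∀ s ∈ Icc (0 : ℝ) 1,
      lineMap (q j) (q (S j)) s ≠ (lineMap (q i) x r : ℂ))
    {A : ℝ → ℝ} (hA : ContinuousOn A (Icc 0 1))
    (hAe : ∀ r ∈ Ioc (0 : ℝ) 1, A r = edgeAngle S q (lineMap (q i) x r) i +
      edgeAngle S q (lineMap (q i) x r) (S⁻¹ i)) :
    winding S q x = vertexWinding S q i + (A 0 - turnAngle S q i) := by
  let G : ℝ → ℝ := fun r => ∑ j ∈ {i, S⁻¹ i}ᶜ, edgeAngle S q (lineMap (q i) x r) j + A r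
  have hGc : ContinuousOn G (Icc 0 1) := by
    refine ContinuousOn.add (continuousOn_finsetSum _ fun j hj => ?_) hA
    simp only [Finset.mem_compl, Finset.mem_insert, Finset.mem_singleton, not_or] at hj
    refine continuousOn_arg_div (continuous_const.sub lineMap_continuous)
      (continuous_const.sub lineMap_continuous) fun r hr => div_mem_slitPlane ?_
    rcases hr.1.eq_or_lt with rfl | hr0
    · rw [lineMap_apply_zero]
      refine h.vertex_notMem hj.1 fun e => hj.2 ?_
      rw [← e]; simp
    · exact hoff r ⟨hr0, hr.2⟩ j
  have hGW : ∀ r ∈ Ioc (0 : ℝ) 1, G r = winding S q (lineMap (q i) x r) := by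
    intro r hr
    simp only [G]
    rw [hAe r hr, winding, ← sum_compl_pair i (h.inv_ne i).symm]
    ring
  have hcl : Icc (0 : ℝ) 1 ⊆ closure (Ioc 0 1) := by rw [closure_Ioc zero_ne_one]
  have hE : EqOn G (fun _ => G 1) (Icc 0 1) := by
    refine EqOn.of_subset_closure (fun r hr => eqOn_of_exp_const isPreconnected_Ioc
      (hGc.mono Ioc_subset_Icc_self) (w := 1) (fun r hr => ?_) hr (by norm_num)) hGc
      continuousOn_const Ioc_subset_Icc_self hcl
    rw [hGW r hr]
    exact exp_sum_edgeAngle fun j => by simpa using hoff r hr j 0 (by simp)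
  have h1 := hGW 1 (by norm_num)
  rw [lineMap_apply_one] at h1
  rw [← h1, ← show G 0 = G 1 from hE (left_mem_Icc.2 zero_le_one)]
  simp only [G, vertexWinding, lineMap_apply_zero]
  ring

/-- Going straight on at the vertex `i` one leaves the polygon on the side away from the turn. -/
theorem winding_straight_on [Fintype I] [DecidableEq I] (h : IsSimplePolygon S q) (i : I)
    (hturn : ((q (S i) - q i) / (q i - q (S⁻¹ i))).im ≠ 0)
    (hoff : ∀ r ∈ Ioc (0 : ℝ) 1, ∀ j, ∀ s ∈ Icc (0 : ℝ) 1,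
      lineMap (q j) (q (S j)) s ≠ (lineMap (q i) (2 * q i - q (S⁻¹ i)) r : ℂ)) :
    winding S q (2 * q i - q (S⁻¹ i)) = vertexWinding S q i +
      (Complex.arg (-((q (S i) - q i) / (q i - q (S⁻¹ i)))) - turnAngle S q i) := by
  have hS : S (S⁻¹ i) = i := by simp
  set m := q i - q (S⁻¹ i) with hm
  have hm0 : m ≠ 0 := by
    intro h0
    simp [h0] at hturn
  have hp : ∀ r : ℝ, (lineMap (q i) (2 * q i - q (S⁻¹ i)) r : ℂ) = q i + r * m := by
    intro r
    rw [lineMap_apply_module', Complex.real_smul]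
    ring
  have hz : ∀ r : ℝ, 0 < r → (q (S i) - (q i + r * m)) / (q i - (q i + r * m)) =
      ((r⁻¹ : ℝ) : ℂ) * ((q (S i) - (q i + r * m)) / -m) := by
    intro r hr
    have : (r : ℂ) ≠ 0 := by exact_mod_cast hr.ne'
    push_cast
    field_simp
    ring
  have := h.winding_of_segment i _ hoff
    (A := fun r => Complex.arg ((q (S i) - (q i + r * m)) / -m)) ?_ ?_
  · rw [this]
    congr 3
    simp [div_neg]
  · refine continuousOn_arg_div (by fun_prop) continuous_const fun r hr => ?_
    rcases hr.1.eq_or_lt with rfl | hr0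
    · rw [Complex.mem_slitPlane_iff]
      right
      simpa [div_neg] using hturn
    · have := div_mem_slitPlane (hoff r ⟨hr0, hr.2⟩ i)
      rw [hp, hz r hr0, Complex.mem_slitPlane_iff, Complex.re_ofReal_mul,
        Complex.im_ofReal_mul] at this
      rw [Complex.mem_slitPlane_iff]
      have hri : 0 < r⁻¹ := by positivity
      exact this.imp (fun h => (mul_pos_iff_of_pos_left hri).1 h) fun h => right_ne_zero_of_mul h
  · intro r hr
    have e0 : edgeAngle S q (q i + r * m) (S⁻¹ i) = 0 := by
      rw [edgeAngle, hS, ← Complex.arg_one]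
      refine arg_div_congr (r / (1 + r)) (div_pos hr.1 (by linarith [hr.1])) ?_
      have h1 : ((1 + r : ℝ) : ℂ) ≠ 0 := by exact_mod_cast (by linarith [hr.1] : (1 + r) ≠ 0)
      have h2 : q (S⁻¹ i) - (q i + r * m) = -(1 + r) * m := by rw [hm]; ring
      rw [h2]
      push_cast at h1 ⊢
      field_simp
      ring
    rw [hp, e0, add_zero, edgeAngle]
    exact (arg_div_congr r⁻¹ (inv_pos.2 hr.1) (hz r hr.1)).symm

/-- Coming straight into the outgoing edge at the vertex `i` one arrives from the side away from
the turn. -/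
theorem winding_straight_in [Fintype I] [DecidableEq I] (h : IsSimplePolygon S q) (i : I)
    (hturn : ((q (S i) - q i) / (q i - q (S⁻¹ i))).im ≠ 0)
    (hoff : ∀ r ∈ Ioc (0 : ℝ) 1, ∀ j, ∀ s ∈ Icc (0 : ℝ) 1,
      lineMap (q j) (q (S j)) s ≠ (lineMap (q i) (2 * q i - q (S i)) r : ℂ)) :
    winding S q (2 * q i - q (S i)) = vertexWinding S q i +
      (Complex.arg (-((q (S i) - q i) / (q i - q (S⁻¹ i)))) - turnAngle S q i) := by
  have hS : S (S⁻¹ i) = i := by simp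
  set o := q (S i) - q i with ho
  have ho0 : o ≠ 0 := by
    intro h0
    simp [h0] at hturn
  have hp : ∀ r : ℝ, (lineMap (q i) (2 * q i - q (S i)) r : ℂ) = q i - r * o := by
    intro r
    rw [lineMap_apply_module', Complex.real_smul]
    ring
  have hz : ∀ r : ℝ, (q i - (q i - r * o)) / (q (S⁻¹ i) - (q i - r * o)) =
      (r : ℂ) * (o / (q (S⁻¹ i) - (q i - r * o))) := by
    intro r
    ring
  have := h.winding_of_segment i _ hoff
    (A := fun r => Complex.arg (o / (q (S⁻¹ i) - (q i - r * o)))) ?_ ?_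
  · rw [this]
    congr 3
    rw [← neg_sub (q (S⁻¹ i)) (q i), div_neg, neg_neg]
    simp
  · refine continuousOn_arg_div continuous_const (by fun_prop) fun r hr => ?_
    rcases hr.1.eq_or_lt with rfl | hr0
    · rw [Complex.mem_slitPlane_iff]
      right
      rw [← neg_sub (q (S⁻¹ i)) (q i), div_neg] at hturn
      simpa using hturn
    · have := div_mem_slitPlane (hoff r ⟨hr0, hr.2⟩ (S⁻¹ i))
      rw [hp, hS, hz r, Complex.mem_slitPlane_iff, Complex.re_ofReal_mul,
        Complex.im_ofReal_mul] at this
      rw [Complex.mem_slitPlane_iff]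
      exact this.imp (fun h => (mul_pos_iff_of_pos_left hr0).1 h) fun h => right_ne_zero_of_mul h
  · intro r hr
    have e0 : edgeAngle S q (q i - r * o) i = 0 := by
      rw [edgeAngle, ← Complex.arg_one]
      refine arg_div_congr ((1 + r) / r) (div_pos (by linarith [hr.1]) hr.1) ?_
      have h1 : (r : ℂ) ≠ 0 := by exact_mod_cast hr.1.ne'
      have h2 : q (S i) - (q i - r * o) = (1 + r) * o := by rw [ho]; ring
      rw [h2]
      push_cast
      field_simp
      ring
    rw [hp, e0, zero_add, edgeAngle, hS]
    exact (arg_div_congr r hr.1 (hz r)).symm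

end IsSimplePolygon

end Winding

/-! ### Separating a diagram along a Seifert circle -/

namespace ClosedPolygons

/-- The edges that start at `u` and `w` have the same midpoint. -/
def MidCross (P : ClosedPolygons Plane) (u w : Fin P.n) : Prop :=
  u ≠ w ∧ P.point (u, 1 / 2) = P.point (w, 1 / 2)

/-- Every multiple point is the midpoint of the edges through it. In particular every edge runs
through at most one crossing. -/
def Midpointed (P : ClosedPolygons Plane) : Prop :=
  ∀ p ∈ P.params, ∀ q ∈ P.params, p ≠ q → P.point p = P.point q → p.2 = 1 / 2

theorem half_mem_params (P : ClosedPolygons Plane) (u : Fin P.n) : (u, (1 / 2 : ℝ)) ∈ P.params :=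
  show (1 / 2 : ℝ) ∈ Ico (0 : ℝ) 1 by norm_num

variable {P : ClosedPolygons Plane}

theorem MidCross.symm {u w : Fin P.n} (h : P.MidCross u w) : P.MidCross w u :=
  ⟨h.1.symm, h.2.symm⟩

theorem IsRegular.midCross_unique (hP : P.IsRegular) {u w w' : Fin P.n} (h : P.MidCross u w)
    (h' : P.MidCross u w') : w = w' := by
  rcases hP.no_triple _ (P.half_mem_params w) _ (P.half_mem_params u) _ (P.half_mem_params w')
    h.2.symm h'.2 with e | e | e
  · exact absurd (congrArg Prod.fst e).symm h.1
  · exact absurd (congrArg Prod.fst e) h'.1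
  · exact congrArg Prod.fst e

open Classical in
/-- The other edge through the midpoint of the edge that starts at `u`, or `u` itself if there is
none. -/
noncomputable def partnerFun (P : ClosedPolygons Plane) (u : Fin P.n) : Fin P.n :=
  if h : ∃ w, P.MidCross u w then h.choose else u

theorem partnerFun_eq (hP : P.IsRegular) {u w : Fin P.n} (h : P.MidCross u w) :
    P.partnerFun u = w := by
  have hex : ∃ w, P.MidCross u w := ⟨w, h⟩
  rw [partnerFun, dif_pos hex]
  exact hP.midCross_unique hex.choose_spec h

theorem midCross_partnerFun {u : Fin P.n} (h : P.partnerFun u ≠ u) :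
    P.MidCross u (P.partnerFun u) := by
  rw [partnerFun] at h ⊢
  split_ifs at h ⊢ with hex
  · exact hex.choose_spec
  · exact absurd rfl h

theorem partnerFun_involutive (hP : P.IsRegular) : Function.Involutive P.partnerFun := by
  intro u
  by_cases h : P.partnerFun u = u
  · rw [h, h]
  · exact partnerFun_eq hP (midCross_partnerFun h).symm

/-- The permutation of the edges that exchanges the two edges at every crossing. -/
noncomputable def partner (hP : P.IsRegular) : Equiv.Perm (Fin P.n) :=
  (partnerFun_involutive hP).toPerm

theorem partner_partner (hP : P.IsRegular) (u : Fin P.n) : partner hP (partner hP u) = u :=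
  partnerFun_involutive hP u

theorem partner_eq (hP : P.IsRegular) {u w : Fin P.n} (h : P.MidCross u w) : partner hP u = w :=
  partnerFun_eq hP h

theorem midCross_partner (hP : P.IsRegular) {u : Fin P.n} (h : partner hP u ≠ u) :
    P.MidCross u (partner hP u) :=
  midCross_partnerFun h

theorem point_half_partner (hP : P.IsRegular) (u : Fin P.n) :
    P.point (partner hP u, 1 / 2) = P.point (u, 1 / 2) := by
  by_cases h : partner hP u = u
  · rw [h]
  · exact (midCross_partner hP h).2.symm

/-- The oriented smoothing of all crossings: follow an edge up to its midpoint, turn into the other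
edge there, and follow it to its end. The cycles are the Seifert circles. -/
noncomputable def seifert (hP : P.IsRegular) : Equiv.Perm (Fin P.n) := P.next * partner hP

theorem seifert_apply (hP : P.IsRegular) (u : Fin P.n) :
    seifert hP u = P.next (partner hP u) := rfl

theorem next_eq_seifert (hP : P.IsRegular) (u : Fin P.n) :
    P.next u = seifert hP (partner hP u) := by
  rw [seifert_apply, partner_partner]

end ClosedPolygons

/-- The plane as the complex plane. -/
noncomputable def planeToComplex (x : Plane) : ℂ := ⟨x.1, x.2⟩

theorem planeToComplex_injective : Function.Injective planeToComplex := by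
  intro x y e
  rw [planeToComplex, planeToComplex, Complex.mk.injEq] at e
  exact Prod.ext e.1 e.2

theorem planeToComplex_lineMap (x y : Plane) (s : ℝ) :
    planeToComplex (lineMap x y s) = lineMap (planeToComplex x) (planeToComplex y) s := by
  apply Complex.ext <;> simp [planeToComplex, lineMap_apply_module]

theorem im_div_planeToComplex (x y : Plane) :
    (planeToComplex y / planeToComplex x).im =
      ClosedPolygons.det x y / Complex.normSq (planeToComplex x) := by
  rw [Complex.div_im, ClosedPolygons.det]
  simp only [planeToComplex]
  ring

namespace ClosedPolygons

variable {P : ClosedPolygons Plane} (hP : P.IsRegular) (a : Fin P.n)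

/-- The vertices on the Seifert circle through the vertex `a`. -/
abbrev SeifertCycle : Type := {e : Fin P.n // (seifert hP).SameCycle a e}

/-- The cyclic structure of the Seifert circle as a polygon: the vertex `Sum.inl e` of the link is
followed by the midpoint `Sum.inr e` of its edge, which is followed by the next vertex on the
Seifert circle. -/
noncomputable def circleNext : Equiv.Perm (SeifertCycle hP a ⊕ SeifertCycle hP a) :=
  (Equiv.sumComm _ _).trans (Equiv.sumCongr
    ((seifert hP).subtypePerm fun _ => Equiv.Perm.sameCycle_apply_right) (Equiv.refl _))

/-- The vertices of the Seifert circle as a polygon. -/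
noncomputable def circlePos : SeifertCycle hP a ⊕ SeifertCycle hP a → ℂ
  | .inl e => planeToComplex (P.pos e.1)
  | .inr e => planeToComplex (P.point (e.1, 1 / 2))

/-- The points of the Seifert circle as points of the diagram. -/
noncomputable def circleParam : SeifertCycle hP a ⊕ SeifertCycle hP a → ℝ → Fin P.n × ℝ
  | .inl e, s => (e.1, s / 2)
  | .inr e, s => (partner hP e.1, 1 / 2 + s / 2)

variable {hP a}

theorem circleNext_inl (e : SeifertCycle hP a) : circleNext hP a (.inl e) = .inr e := rfl

theorem circleNext_inr (e : SeifertCycle hP a) :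
    circleNext hP a (.inr e) =
      .inl ⟨seifert hP e.1, Equiv.Perm.sameCycle_apply_right.2 e.2⟩ := rfl

theorem circleNext_inv_inr (e : SeifertCycle hP a) : (circleNext hP a)⁻¹ (.inr e) = .inl e := by
  rw [Equiv.Perm.inv_eq_iff_eq, circleNext_inl]

theorem lineMap_circlePos (i : SeifertCycle hP a ⊕ SeifertCycle hP a) (s : ℝ) :
    lineMap (circlePos hP a i) (circlePos hP a (circleNext hP a i)) s =
      planeToComplex (P.point (circleParam hP a i s)) := by
  rcases i with e | e
  · rw [circleNext_inl]
    simp only [circlePos, circleParam]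
    rw [← planeToComplex_lineMap]
    congr 1
    simp only [point, lineMap_apply_module']
    module
  · rw [circleNext_inr]
    simp only [circlePos, circleParam]
    rw [← planeToComplex_lineMap, ← point_half_partner hP, seifert_apply]
    congr 1
    simp only [point, lineMap_apply_module']
    module

theorem circleParam_mem (i : SeifertCycle hP a ⊕ SeifertCycle hP a) {s : ℝ}
    (hs : s ∈ Ico (0 : ℝ) 1) : circleParam hP a i s ∈ P.params := by
  rcases i with e | e
  · exact show s / 2 ∈ Ico (0 : ℝ) 1 from ⟨by linarith [hs.1], by linarith [hs.2]⟩
  · exact show 1 / 2 + s / 2 ∈ Ico (0 : ℝ) 1 from ⟨by linarith [hs.1], by linarith [hs.2]⟩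

/-- A point of the diagram on the Seifert circle lies on the first half of an edge of the circle,
or on the second half of an edge whose partner is in the circle. -/
theorem mem_of_on_circle (hmid : P.Midpointed) {u : Fin P.n} {r : ℝ} (hr : r ∈ Ico (0 : ℝ) 1)
    {i : SeifertCycle hP a ⊕ SeifertCycle hP a} {s : ℝ} (hs : s ∈ Icc (0 : ℝ) 1)
    (e : lineMap (circlePos hP a i) (circlePos hP a (circleNext hP a i)) s =
      planeToComplex (P.point (u, r))) :
    ((seifert hP).SameCycle a u ∧ r ≤ 1 / 2) ∨
      ((seifert hP).SameCycle a (partner hP u) ∧ 1 / 2 ≤ r) := by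
  obtain ⟨j, t, ht, e⟩ : ∃ j, ∃ t ∈ Ico (0 : ℝ) 1,
      P.point (circleParam hP a j t) = P.point (u, r) := by
    rcases hs.2.eq_or_lt with rfl | hs1
    · refine ⟨circleNext hP a i, 0, by simp, planeToComplex_injective ?_⟩
      rw [← e, ← lineMap_circlePos]
      simp
    · exact ⟨i, s, ⟨hs.1, hs1⟩, planeToComplex_injective (by rw [← e, ← lineMap_circlePos])⟩
  by_cases hp : circleParam hP a j t = (u, r)
  · rcases j with c | c
    · obtain ⟨h1, h2⟩ := Prod.ext_iff.1 hp
      simp only [circleParam] at h1 h2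
      exact Or.inl ⟨h1 ▸ c.2, by linarith [ht.2]⟩
    · obtain ⟨h1, h2⟩ := Prod.ext_iff.1 hp
      simp only [circleParam] at h1 h2
      refine Or.inr ⟨?_, by linarith [ht.1]⟩
      rw [← h1, partner_partner]
      exact c.2
  · have h1 := hmid _ (circleParam_mem j ht) (u, r) hr hp e
    have h2 := hmid (u, r) hr _ (circleParam_mem j ht) (Ne.symm hp) e.symm
    rcases j with c | c
    · simp only [circleParam] at h1
      linarith [ht.2]
    · simp only [circleParam] at h1 h2 hp e
      subst h2
      rw [h1] at e hp
      have hc : P.MidCross (partner hP c.1) u := ⟨fun h => hp (by rw [h]), e⟩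
      have := partner_eq hP hc
      rw [partner_partner] at this
      exact Or.inl ⟨this ▸ c.2, le_rfl⟩

theorem isSimplePolygon_circle (hmid : P.Midpointed)
    (hC : ∀ e, (seifert hP).SameCycle a e → (seifert hP).SameCycle a (partner hP e) →
      partner hP e = e) :
    IsSimplePolygon (circleNext hP a) (circlePos hP a) := by
  intro i j s hs t ht e
  rw [lineMap_circlePos, lineMap_circlePos] at e
  have e := planeToComplex_injective e
  by_cases hp : circleParam hP a i s = circleParam hP a j t
  · rcases i with c | c <;> rcases j with d | d <;> simp only [circleParam] at hp <;>
      obtain ⟨h1, h2⟩ := Prod.ext_iff.1 hp <;> simp only at h1 h2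
    · exact ⟨by rw [Subtype.ext h1], by linarith⟩
    · linarith [hs.2, ht.1]
    · linarith [hs.1, ht.2]
    · exact ⟨by rw [Subtype.ext ((partner hP).injective h1)], by linarith⟩
  · exfalso
    have h1 := hmid _ (circleParam_mem i hs) _ (circleParam_mem j ht) hp e
    have h2 := hmid _ (circleParam_mem j ht) _ (circleParam_mem i hs) (Ne.symm hp) e.symm
    rcases i with c | c
    · simp only [circleParam] at h1
      linarith [hs.2]
    rcases j with d | d
    · simp only [circleParam] at h2
      linarith [ht.2]
    simp only [circleParam] at h1 h2 hp e
    rw [h1, h2] at e hp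
    have hc : P.MidCross (partner hP c.1) (partner hP d.1) := ⟨fun h => hp (by rw [h]), e⟩
    have h3 := partner_eq hP hc
    rw [partner_partner] at h3
    have h4 := hC d.1 d.2 (h3 ▸ c.2)
    exact hc.1 (congrArg (partner hP) (h3.trans h4))

/-- The winding number of the Seifert circle through `a`, multiplied by `2π`. -/
noncomputable def circleWinding (hP : P.IsRegular) (a : Fin P.n) (x : Plane) : ℝ := by
  classical exact winding (circleNext hP a) (circlePos hP a) (planeToComplex x)

/-- The winding number is the same at all points of an edge that is disjoint from the Seifert
circle. -/
theorem circleWinding_edge (hmid : P.Midpointed) {u : Fin P.n}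
    (hu : ¬ (seifert hP).SameCycle a u) (hu' : ¬ (seifert hP).SameCycle a (partner hP u))
    {r : ℝ} (hr : r ∈ Icc (0 : ℝ) 1) :
    circleWinding hP a (P.pos u) = circleWinding hP a (P.point (u, r)) := by
  refine winding_eq fun s hs i t ht e => ?_
  have hs' : lineMap (planeToComplex (P.pos u)) (planeToComplex (P.point (u, r))) s =
      planeToComplex (P.point (u, s * r)) := by
    rw [← planeToComplex_lineMap]
    simp only [point, lineMap_apply_module']
    congr 1
    module
  rw [hs'] at e
  have h0 : 0 ≤ s * r := mul_nonneg hs.1 hr.1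
  have h1 : s * r ≤ 1 := mul_le_one₀ hs.2 hr.1 hr.2
  rcases h1.eq_or_lt with h1 | h1
  · have : P.point (u, s * r) = P.point (P.next u, 0) := by simp [point, h1]
    rw [this] at e
    rcases mem_of_on_circle hmid (by simp) ht e with h | h
    · rw [next_eq_seifert hP, Equiv.Perm.sameCycle_apply_right] at h
      exact hu' h.1
    · linarith [h.2]
  · rcases mem_of_on_circle hmid ⟨h0, h1⟩ ht e with h | h
    · exact hu h.1
    · exact hu' h.1

/-- The mean of the values of the winding number on both sides of the Seifert circle. -/
noncomputable def circleMean (hP : P.IsRegular) (a : Fin P.n) : ℝ := by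
  classical exact vertexWinding (circleNext hP a) (circlePos hP a) (.inl ⟨a, .refl _ _⟩)

open Classical in
theorem vertexWinding_eq_circleMean
    (hsimple : IsSimplePolygon (circleNext hP a) (circlePos hP a)) (e : SeifertCycle hP a) :
    vertexWinding (circleNext hP a) (circlePos hP a) (.inr e) = circleMean hP a := by
  have key : ∀ k : ℕ, ∀ h : (seifert hP).SameCycle a ((seifert hP ^ k) a),
      vertexWinding (circleNext hP a) (circlePos hP a) (.inl ⟨_, h⟩) = circleMean hP a := by
    intro k
    induction k with
    | zero =>
      intro h
      rfl
    | succ k ih =>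
      intro h
      have h' : (seifert hP).SameCycle a ((seifert hP ^ k) a) :=
        (Equiv.Perm.SameCycle.refl _ _).pow_right
      rw [← ih h', ← hsimple.vertexWinding_map (.inl ⟨_, h'⟩), circleNext_inl,
        ← hsimple.vertexWinding_map (.inr ⟨_, h'⟩), circleNext_inr]
      congr 2
      apply Subtype.ext
      change (seifert hP ^ (k + 1)) a = seifert hP ((seifert hP ^ k) a)
      rw [pow_succ', Equiv.Perm.mul_apply]
  obtain ⟨k, -, hk⟩ := e.2.exists_pow_eq'
  obtain ⟨e, he⟩ := e
  subst hk
  rw [← key k he, ← hsimple.vertexWinding_map (.inl ⟨_, he⟩), circleNext_inl]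

/-- The two strands that meet the Seifert circle at the midpoint of `e` lie on the same side of it,
which is determined by the sign of the turn. -/
theorem circleWinding_at_crossing (hmid : P.Midpointed)
    (hC : ∀ e, (seifert hP).SameCycle a e → (seifert hP).SameCycle a (partner hP e) →
      partner hP e = e) {e : Fin P.n} (he : (seifert hP).SameCycle a e)
    (hne : partner hP e ≠ e) {x : Plane} (hx : x = P.pos (P.next e) ∨ x = P.pos (partner hP e)) :
    (det (P.dir e) (P.dir (partner hP e)) < 0 → circleWinding hP a x = circleMean hP a + Real.pi) ∧
    (0 < det (P.dir e) (P.dir (partner hP e)) →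
      circleWinding hP a x = circleMean hP a - Real.pi) := by
  classical
  have hsimple := isSimplePolygon_circle hmid hC
  have hpe : ¬ (seifert hP).SameCycle a (partner hP e) := fun h => hne (hC e he h)
  let i : SeifertCycle hP a ⊕ SeifertCycle hP a := .inr ⟨e, he⟩
  have hm : circlePos hP a i - circlePos hP a ((circleNext hP a)⁻¹ i) =
      ((1 / 2 : ℝ) : ℂ) * planeToComplex (P.dir e) := by
    simp only [i]
    rw [circleNext_inv_inr]
    apply Complex.ext <;>
      simp [circlePos, planeToComplex, point, dir, lineMap_apply_module']
  have ho : circlePos hP a (circleNext hP a i) - circlePos hP a i =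
      ((1 / 2 : ℝ) : ℂ) * planeToComplex (P.dir (partner hP e)) := by
    simp only [i]
    rw [circleNext_inr]
    simp only [circlePos]
    rw [← point_half_partner hP e, seifert_apply]
    apply Complex.ext <;>
      simp [planeToComplex, point, dir, lineMap_apply_module'] <;> ring
  have hratio : (circlePos hP a (circleNext hP a i) - circlePos hP a i) /
      (circlePos hP a i - circlePos hP a ((circleNext hP a)⁻¹ i)) =
      planeToComplex (P.dir (partner hP e)) / planeToComplex (P.dir e) := by
    rw [hm, ho, mul_div_mul_left]
    norm_num
  have hdet : det (P.dir e) (P.dir (partner hP e)) ≠ 0 := by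
    obtain ⟨h1, h2⟩ := midCross_partner hP hne
    exact hP.transverse _ (P.half_mem_params e) _ (P.half_mem_params _)
      (fun h => h1 (congrArg Prod.fst h)) h2
  have hdir : 0 < Complex.normSq (planeToComplex (P.dir e)) := by
    rw [Complex.normSq_pos]
    intro h0
    apply hdet
    rw [planeToComplex, Complex.ext_iff] at h0
    simp only [Complex.zero_re, Complex.zero_im] at h0
    simp [det, h0.1, h0.2]
  have him := im_div_planeToComplex (P.dir e) (P.dir (partner hP e))
  have hturn : ((circlePos hP a (circleNext hP a i) - circlePos hP a i) /
      (circlePos hP a i - circlePos hP a ((circleNext hP a)⁻¹ i))).im ≠ 0 := by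
    rw [hratio, him]
    exact div_ne_zero hdet hdir.ne'
  have key : circleWinding hP a x = circleMean hP a +
      (Complex.arg (-(planeToComplex (P.dir (partner hP e)) / planeToComplex (P.dir e))) -
        Complex.arg (planeToComplex (P.dir (partner hP e)) / planeToComplex (P.dir e))) := by
    rw [← vertexWinding_eq_circleMean hsimple ⟨e, he⟩]
    have hT : turnAngle (circleNext hP a) (circlePos hP a) i =
      Complex.arg (planeToComplex (P.dir (partner hP e)) / planeToComplex (P.dir e)) := by
      rw [turnAngle, hratio]
    rw [← hT, ← hratio]
    rcases hx with rfl | rfl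
    · have hx : planeToComplex (P.pos (P.next e)) =
          2 * circlePos hP a i - circlePos hP a ((circleNext hP a)⁻¹ i) := by
        simp only [i]
        rw [circleNext_inv_inr]
        apply Complex.ext <;>
          simp [circlePos, planeToComplex, point, lineMap_apply_module'] <;> ring
      have hl : ∀ r : ℝ, lineMap (circlePos hP a i) (planeToComplex (P.pos (P.next e))) r =
          planeToComplex (P.point (e, 1 / 2 + r / 2)) := by
        intro r
        simp only [i, circlePos]
        rw [← planeToComplex_lineMap]
        simp only [point, lineMap_apply_module']
        congr 1
        module
      rw [circleWinding, hx]
      refine hsimple.winding_straight_on i hturn fun r hr j s hs e' => ?_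
      rw [← hx, hl] at e'
      rcases hr.2.eq_or_lt with rfl | hr1
      · have h1 : P.point (e, 1 / 2 + 1 / 2) = P.point (P.next e, 0) := by
          norm_num [point]
        rw [h1] at e'
        rcases mem_of_on_circle hmid (by simp) hs e' with h | h
        · rw [next_eq_seifert hP, Equiv.Perm.sameCycle_apply_right] at h
          exact hpe h.1
        · linarith [h.2]
      · rcases mem_of_on_circle hmid ⟨by linarith [hr.1], by linarith⟩ hs e' with h | h
        · linarith [h.2, hr.1]
        · exact hpe h.1
    · have hx : planeToComplex (P.pos (partner hP e)) =
          2 * circlePos hP a i - circlePos hP a (circleNext hP a i) := by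
        simp only [i]
        rw [circleNext_inr]
        simp only [circlePos]
        rw [← point_half_partner hP e, seifert_apply]
        apply Complex.ext <;>
          simp [planeToComplex, point, lineMap_apply_module'] <;> ring
      have hl : ∀ r : ℝ, lineMap (circlePos hP a i) (planeToComplex (P.pos (partner hP e))) r =
          planeToComplex (P.point (partner hP e, 1 / 2 - r / 2)) := by
        intro r
        simp only [i, circlePos]
        rw [← planeToComplex_lineMap, ← point_half_partner hP e]
        simp only [point, lineMap_apply_module']
        congr 1
        module
      rw [circleWinding, hx]
      refine hsimple.winding_straight_in i hturn fun r hr j s hs e' => ?_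
      rw [← hx, hl] at e'
      rcases mem_of_on_circle hmid ⟨by linarith [hr.2], by linarith [hr.1]⟩ hs e' with h | h
      · exact hpe h.1
      · linarith [h.2, hr.1]
  refine ⟨fun hneg => ?_, fun hpos => ?_⟩
  · rw [key, Complex.arg_neg_eq_arg_add_pi_of_im_neg]
    · ring
    · rw [him]
      exact div_neg_of_neg_of_pos hneg hdir
  · rw [key, Complex.arg_neg_eq_arg_sub_pi_of_im_pos]
    · ring
    · rw [him]
      exact div_pos hpos hdir

/-- Let every crossing be the midpoint of its two edges, and let the vertices carry labels such that
the label `¬ ℓ u`, `ℓ (P.next u)` belongs to the edges whose direction comes first in the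
orientation of the plane, and vice versa, except at the crossing of `a` and `b`, where it is the
other way round. Then the diagram falls into two parts that meet in this crossing only.

The Seifert circle through `a` enters every crossing but this one through the strand with label
`ℓ`, and turns right. Hence all other strands lie on its left, except for those at the crossing of
`a` and `b`. -/
theorem exists_separation (hP : P.IsRegular) (hmid : P.Midpointed) {a b : Fin P.n}
    (hab : P.MidCross a b) (hdet : 0 < det (P.dir a) (P.dir b)) {ℓ : Fin P.n → Prop}
    (h0 : ∀ u, (∀ w, ¬ P.MidCross u w) → (ℓ (P.next u) ↔ ℓ u))
    (h1 : ∀ u w, P.MidCross u w → u ≠ a → u ≠ b → 0 < det (P.dir u) (P.dir w) →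
      ¬ ℓ u ∧ ℓ (P.next u) ∧ ℓ w ∧ ¬ ℓ (P.next w))
    (h2 : ℓ a ∧ ¬ ℓ (P.next a) ∧ ¬ ℓ b ∧ ℓ (P.next b)) :
    ∃ R : Set (Fin P.n), a ∉ R ∧ P.next a ∈ R ∧ b ∈ R ∧ P.next b ∉ R ∧
      (∀ u, u ≠ a → u ≠ b → (u ∈ R ↔ P.next u ∈ R)) ∧
      ∀ u w, P.MidCross u w → u ≠ a → u ≠ b → (u ∈ R ↔ w ∈ R) := by
  have hba : partner hP b = a := partner_eq hP hab.symm
  have hab' : partner hP a = b := partner_eq hP hab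
  have hdet_swap : ∀ x y : Plane, det x y = -det y x := fun x y => by
    simp only [det]
    ring
  have hdet_ne : ∀ u w, P.MidCross u w → det (P.dir u) (P.dir w) ≠ 0 := fun u w h =>
    hP.transverse _ (P.half_mem_params u) _ (P.half_mem_params _)
      (fun h' => h.1 (congrArg Prod.fst h')) h.2
  have hnone : ∀ u, partner hP u = u → ∀ w, ¬ P.MidCross u w := fun u hu w h =>
    h.1 (hu.symm.trans (partner_eq hP h))
  -- At a crossing with label `ℓ u` the edge `u` goes second in the orientation of the plane.
  have hturn : ∀ u, u ≠ a → u ≠ b → partner hP u ≠ u → ℓ u →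
      det (P.dir u) (P.dir (partner hP u)) < 0 ∧ ℓ (P.next (partner hP u)) ∧
        ¬ ℓ (partner hP u) := by
    intro u hua hub hu hl
    have hc := midCross_partner hP hu
    rcases (hdet_ne _ _ hc).lt_or_gt with h | h
    · have hwa : partner hP u ≠ a := fun e => hub (by rw [← hab', ← e, partner_partner])
      have hwb : partner hP u ≠ b := fun e => hua (by rw [← hba, ← e, partner_partner])
      have := h1 _ _ hc.symm hwa hwb (by rw [hdet_swap]; linarith)
      exact ⟨h, this.2.1, this.1⟩
    · exact absurd hl (h1 _ _ hc hua hub h).1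
  have hℓC : ∀ e, (seifert hP).SameCycle a e → ℓ e := by
    have hstep : ∀ e, ℓ e → ℓ (seifert hP e) := by
      intro e he
      rw [seifert_apply]
      by_cases hea : e = a
      · rw [hea, hab']
        exact h2.2.2.2
      by_cases heb : e = b
      · exact absurd (heb ▸ he) h2.2.2.1
      by_cases hpe : partner hP e = e
      · rw [hpe]
        exact (h0 e (hnone e hpe)).2 he
      · exact (hturn e hea heb hpe he).2.1
    intro e he
    obtain ⟨k, -, rfl⟩ := he.exists_pow_eq'
    clear he
    induction k with
    | zero => exact h2.1
    | succ k ih =>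
      rw [pow_succ', Equiv.Perm.mul_apply]
      exact hstep _ ih
  have hC : ∀ e, (seifert hP).SameCycle a e → (seifert hP).SameCycle a (partner hP e) →
      partner hP e = e := by
    intro e he he'
    by_contra hne
    by_cases hea : e = a
    · rw [hea, hab'] at he'
      exact h2.2.2.1 (hℓC b he')
    by_cases heb : e = b
    · exact h2.2.2.1 (hℓC b (heb ▸ he))
    exact (hturn e hea heb hne (hℓC e he)).2.2 (hℓC _ he')
  have haC : (seifert hP).SameCycle a a := .refl _ _
  have hnextC : ∀ u, (seifert hP).SameCycle a (P.next u) ↔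
      (seifert hP).SameCycle a (partner hP u) := fun u => by
    rw [next_eq_seifert hP, Equiv.Perm.sameCycle_apply_right]
  have hbC : ¬ (seifert hP).SameCycle a b := fun h => h2.2.2.1 (hℓC b h)
  -- The strands at the other crossings of the circle.
  have hleft : ∀ e, (seifert hP).SameCycle a e → e ≠ a → partner hP e ≠ e →
      circleWinding hP a (P.pos (P.next e)) = circleMean hP a + Real.pi ∧
      circleWinding hP a (P.pos (partner hP e)) = circleMean hP a + Real.pi := by
    intro e he hea hne
    have heb : e ≠ b := fun h => hbC (h ▸ he)
    have hneg := (hturn e hea heb hne (hℓC e he)).1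
    exact ⟨(circleWinding_at_crossing hmid hC he hne (Or.inl rfl)).1 hneg,
      (circleWinding_at_crossing hmid hC he hne (Or.inr rfl)).1 hneg⟩
  have hpi := Real.pi_pos
  have hleft_ne : ∀ x : ℝ, x = circleMean hP a + Real.pi → ¬ x = circleMean hP a - Real.pi :=
    fun x h h' => by linarith
  have hspecial : ∀ x, (x = P.pos (P.next a) ∨ x = P.pos b) →
      circleWinding hP a x = circleMean hP a - Real.pi := by
    intro x hx
    have := (circleWinding_at_crossing hmid hC haC (by rw [hab']; exact hab.1.symm) (x := x)
      (by rwa [hab'])).2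
    rw [hab'] at this
    exact this hdet
  refine ⟨{u | ¬ (seifert hP).SameCycle a u ∧
    circleWinding hP a (P.pos u) = circleMean hP a - Real.pi}, ?_, ?_, ?_, ?_, ?_, ?_⟩
  · exact fun h => h.1 haC
  · exact ⟨by rw [hnextC, hab']; exact hbC, hspecial _ (Or.inl rfl)⟩
  · exact ⟨hbC, hspecial _ (Or.inr rfl)⟩
  · exact fun h => h.1 (by rw [hnextC, hba])
  · intro u hua hub
    by_cases hu : (seifert hP).SameCycle a u
    · refine iff_of_false (fun h => h.1 hu) fun h => ?_
      by_cases hpu : partner hP u = u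
      · exact h.1 (by rwa [hnextC, hpu])
      · exact hleft_ne _ (hleft u hu hua hpu).1 h.2
    by_cases hu' : (seifert hP).SameCycle a (partner hP u)
    · refine iff_of_false (fun h => ?_) fun h => h.1 ((hnextC u).2 hu')
      have hpa : partner hP u ≠ a := fun e => hub (by rw [← hab', ← e, partner_partner])
      have hpu : partner hP (partner hP u) ≠ partner hP u := by
        rw [partner_partner]
        exact fun e => hu (e ▸ hu')
      have := (hleft _ hu' hpa hpu).2
      rw [partner_partner] at this
      exact hleft_ne _ this h.2
    · have := circleWinding_edge hmid hu hu' (r := 1) (by simp)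
      have h3 : P.point (u, 1) = P.pos (P.next u) := by simp [point]
      rw [h3] at this
      simp only [mem_ofPred_eq, this, hu, hnextC, hu']
  · intro u w hc hua hub
    have hw : partner hP u = w := partner_eq hP hc
    have hu' : partner hP w = u := partner_eq hP hc.symm
    have hwa : w ≠ a := fun e => hub (by rw [← hab', ← e, hu'])
    by_cases huC : (seifert hP).SameCycle a u
    · refine iff_of_false (fun h => h.1 huC) fun h => ?_
      have := (hleft u huC hua (by rw [hw]; exact hc.1.symm)).2
      rw [hw] at this
      exact hleft_ne _ this h.2
    by_cases hwC : (seifert hP).SameCycle a w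
    · refine iff_of_false (fun h => ?_) fun h => h.1 hwC
      have := (hleft w hwC hwa (by rw [hu']; exact hc.1)).2
      rw [hu'] at this
      exact hleft_ne _ this h.2
    · have e1 := circleWinding_edge hmid huC (by rwa [hw]) (r := 1 / 2) (by norm_num)
      have e2 := circleWinding_edge hmid hwC (by rwa [hu']) (r := 1 / 2) (by norm_num)
      simp only [mem_ofPred_eq, e1, e2, hc.2, huC, hwC]

end ClosedPolygons

/-! ### A full twist of one part of a link -/

/-- Two parts of a family of polygons in `ℂ × ℝ` that are joined by two edges only, in coordinates
in which these two edges project to the diameters `[-1, 1]` and `[-I, I]` of the unit disc, while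
all other edges project to the outside of the open disc. The vertex `v` is at `(Q v, z v)`, the part
in question consists of the vertices in `R`, the edge that starts at `a` enters it and the edge that
starts at `b` leaves it. -/
structure TwoStrandSplitting {n : ℕ} (next : Equiv.Perm (Fin n)) (Q : Fin n → ℂ) (z : Fin n → ℝ)
    (R : Set (Fin n)) (a b : Fin n) : Prop where
  start_enter : a ∉ R
  end_enter : next a ∈ R
  start_leave : b ∈ R
  end_leave : next b ∉ R
  mem_iff : ∀ u, u ≠ a → u ≠ b → (u ∈ R ↔ next u ∈ R)
  pos_a : Q a = -1
  pos_next_a : Q (next a) = 1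
  pos_b : Q b = -Complex.I
  pos_next_b : Q (next b) = Complex.I
  outside : ∀ u, u ≠ a → u ≠ b → ∀ s ∈ Ico (0 : ℝ) 1, 1 ≤ ‖lineMap (Q u) (Q (next u)) s‖
  vertex_simple : ∀ v u, ∀ s ∈ Ico (0 : ℝ) 1, lineMap (Q u) (Q (next u)) s = Q v → u = v ∧ s = 0
  embedded : ∀ u v, ∀ s ∈ Ico (0 : ℝ) 1, ∀ t ∈ Ico (0 : ℝ) 1,
    lineMap (Q u) (Q (next u)) s = lineMap (Q v) (Q (next v)) t →
    lineMap (z u) (z (next u)) s = lineMap (z v) (z (next v)) t → u = v ∧ s = t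

/-- The affine map of `ℂ × ℝ` that acts on the part to be twisted: a rotation of the plane
followed by a vertical shear, and a vertical translation. -/
noncomputable def twist (w : ℂ) (H τ : ℝ) (Q : ℂ) (z : ℝ) : ℂ × ℝ :=
  (w * Q, z + H + τ * (Q.re + Q.im))

open Classical in
/-- The vertices after the part `R` has been twisted. -/
noncomputable def twistPos {n : ℕ} (Q : Fin n → ℂ) (z : Fin n → ℝ) (R : Set (Fin n)) (w : ℂ)
    (H τ : ℝ) (u : Fin n) : ℂ × ℝ :=
  if u ∈ R then twist w H τ (Q u) (z u) else (Q u, z u)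

theorem lineMap_twist (w : ℂ) (H τ : ℝ) (Q Q' : ℂ) (z z' s : ℝ) :
    lineMap (twist w H τ Q z) (twist w H τ Q' z') s =
      twist w H τ (lineMap Q Q' s) (lineMap z z' s) := by
  simp only [twist, lineMap_apply_module]
  apply Prod.ext
  · simp
    ring
  · simp
    ring

theorem lineMap_mk {E F : Type*} [AddCommGroup E] [Module ℝ E] [AddCommGroup F] [Module ℝ F]
    (x y : E × F) (s : ℝ) : lineMap x y s = (lineMap x.1 y.1 s, lineMap x.2 y.2 s) := by
  simp [lineMap_apply_module, Prod.ext_iff]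

theorem lineMap_mem_Ioo {x y s : ℝ} (hxy : x < y) (hs : s ∈ Ioo (0 : ℝ) 1) :
    x < lineMap x y s ∧ lineMap x y s < y := by
  rw [lineMap_apply_module', smul_eq_mul]
  constructor <;> nlinarith [hs.1, hs.2]

theorem lineMap_le_of_le {x y s c : ℝ} (hx : x ≤ c) (hy : y ≤ c) (hs : s ∈ Icc (0 : ℝ) 1) :
    lineMap x y s ≤ c := by
  rw [lineMap_apply_module', smul_eq_mul]
  nlinarith [hs.1, hs.2, mul_nonneg hs.1 (sub_nonneg.2 hy),
    mul_nonneg (sub_nonneg.2 hs.2) (sub_nonneg.2 hx)]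

theorem lt_lineMap_of_lt {x y s c : ℝ} (hx : c < x) (hy : c < y) (hs : s ∈ Icc (0 : ℝ) 1) :
    c < lineMap x y s := by
  rw [lineMap_apply_module', smul_eq_mul]
  rcases hs.2.eq_or_lt with rfl | hs1
  · linarith
  · nlinarith [mul_nonneg hs.1 (sub_pos.2 hy).le, mul_pos (sub_pos.2 hs1) (sub_pos.2 hx)]

namespace TwoStrandSplitting

variable {n : ℕ} {next : Equiv.Perm (Fin n)} {Q : Fin n → ℂ} {z : Fin n → ℝ} {R : Set (Fin n)}
  {a b : Fin n}

/-- The twisted polygons stay embedded as long as the twisted part is above the rest and the two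
connecting edges do not meet. -/
theorem embedded_twistPos (F : TwoStrandSplitting next Q z R a b) {w : ℂ} (hw : ‖w‖ = 1)
    {H τ c : ℝ} (hL : ∀ u, u ∉ R → z u ≤ c) (hR : ∀ u ∈ R, c < (twist w H τ (Q u) (z u)).2)
    (hcoll : ∀ s ∈ Ioo (0 : ℝ) 1, w * (s + (1 - s) * Complex.I) = (1 - s) + s * Complex.I →
      (1 - s) * z a + s * (z (next a) + H + τ) ≠ (1 - s) * (z b + H - τ) + s * z (next b))
    (u v : Fin n) (s : ℝ) (hs : s ∈ Ico (0 : ℝ) 1) (t : ℝ) (ht : t ∈ Ico (0 : ℝ) 1)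
    (e : lineMap (twistPos Q z R w H τ u) (twistPos Q z R w H τ (next u)) s =
      lineMap (twistPos Q z R w H τ v) (twistPos Q z R w H τ (next v)) t) : u = v ∧ s = t := by
  have hw0 : w ≠ 0 := by
    rintro rfl
    simp at hw
  have hLz : ∀ u, u ∉ R → twistPos Q z R w H τ u = (Q u, z u) := fun u hu => if_neg hu
  have hRz : ∀ u ∈ R, twistPos Q z R w H τ u = twist w H τ (Q u) (z u) := fun u hu => if_pos hu
  have hnorm : ∀ u, ∀ s ∈ Ico (0 : ℝ) 1, (u ≠ a ∧ u ≠ b ∨ s = 0) →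
      1 ≤ ‖lineMap (Q u) (Q (next u)) s‖ := by
    rintro u s hs (⟨h1, h2⟩ | rfl)
    · exact F.outside u h1 h2 s hs
    · rw [lineMap_apply_zero]
      by_cases h1 : u = a
      · rw [h1, F.pos_a]; simp
      by_cases h2 : u = b
      · rw [h2, F.pos_b]; simp
      simpa using F.outside u h1 h2 0 (by simp)
  -- Every point is a point of the fixed part, a point of the twisted part, or an inner point of
  -- one of the two connecting edges.
  have trich : ∀ u, ∀ s ∈ Ico (0 : ℝ) 1,
      (lineMap (twistPos Q z R w H τ u) (twistPos Q z R w H τ (next u)) s =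
          (lineMap (Q u) (Q (next u)) s, lineMap (z u) (z (next u)) s) ∧
        lineMap (z u) (z (next u)) s ≤ c ∧ 1 ≤ ‖lineMap (Q u) (Q (next u)) s‖) ∨
      (lineMap (twistPos Q z R w H τ u) (twistPos Q z R w H τ (next u)) s =
          twist w H τ (lineMap (Q u) (Q (next u)) s) (lineMap (z u) (z (next u)) s) ∧
        c < (twist w H τ (lineMap (Q u) (Q (next u)) s) (lineMap (z u) (z (next u)) s)).2 ∧
        1 ≤ ‖lineMap (Q u) (Q (next u)) s‖) ∨
      (∃ x ∉ R, ∃ y ∈ R, ∃ r ∈ Ioo (0 : ℝ) 1, ‖Q x‖ = 1 ∧ ‖Q y‖ = 1 ∧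
        (u = a ∧ x = a ∧ y = next a ∧ r = s ∨ u = b ∧ x = next b ∧ y = b ∧ r = 1 - s) ∧
        lineMap (twistPos Q z R w H τ u) (twistPos Q z R w H τ (next u)) s =
          lineMap (Q x, z x) (twist w H τ (Q y) (z y)) r) := by
    intro u s hs
    rcases hs.1.eq_or_lt with rfl | hs0
    · simp only [lineMap_apply_zero]
      have := hnorm u 0 hs (Or.inr rfl)
      rw [lineMap_apply_zero] at this
      by_cases hu : u ∈ R
      · exact Or.inr (Or.inl ⟨hRz u hu, hR u hu, this⟩)
      · exact Or.inl ⟨hLz u hu, hL u hu, this⟩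
    by_cases hua : u = a
    · subst hua
      exact Or.inr (Or.inr ⟨u, F.start_enter, next u, F.end_enter, s, ⟨hs0, hs.2⟩,
        by simp [F.pos_a], by simp [F.pos_next_a], Or.inl ⟨rfl, rfl, rfl, rfl⟩,
        by rw [hLz _ F.start_enter, hRz _ F.end_enter]⟩)
    by_cases hub : u = b
    · subst hub
      exact Or.inr (Or.inr ⟨next u, F.end_leave, u, F.start_leave, 1 - s,
        ⟨by linarith [hs.2], by linarith⟩,
        by simp [F.pos_next_b], by simp [F.pos_b], Or.inr ⟨rfl, rfl, rfl, rfl⟩,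
        by rw [hLz _ F.end_leave, hRz _ F.start_leave, lineMap_apply_one_sub]⟩)
    have := hnorm u s hs (Or.inl ⟨hua, hub⟩)
    by_cases hu : u ∈ R
    · have hu' := (F.mem_iff u hua hub).1 hu
      refine Or.inr (Or.inl ⟨?_, ?_, this⟩)
      · rw [hRz u hu, hRz _ hu', lineMap_twist]
      · rw [← lineMap_twist, lineMap_mk]
        exact lt_lineMap_of_lt (hR u hu) (hR _ hu') (Ico_subset_unit hs)
    · have hu' : next u ∉ R := fun h => hu ((F.mem_iff u hua hub).2 h)
      refine Or.inl ⟨?_, ?_, this⟩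
      · rw [hLz u hu, hLz _ hu', lineMap_mk]
      · exact lineMap_le_of_le (hL u hu) (hL _ hu') (Ico_subset_unit hs)
  -- An inner point of a connecting edge on the unit circle lies on a vertical edge.
  have hvert : ∀ x y : Fin n, ‖Q x‖ = 1 → ‖Q y‖ = 1 → ∀ r ∈ Ioo (0 : ℝ) 1,
      1 ≤ ‖lineMap (Q x) (w * Q y) r‖ → Q x = w * Q y := by
    intro x y hx hy r hr h
    by_contra hne
    have := norm_combo_lt_of_ne (r := 1) hx.le (by rw [norm_mul, hw, hy, one_mul]) hne
      (sub_pos.2 hr.2) hr.1 (sub_add_cancel _ _)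
    rw [lineMap_apply_module] at h
    linarith
  have hML : ∀ v, ∀ t ∈ Ico (0 : ℝ) 1, ∀ x ∉ R, ∀ y ∈ R, ∀ r ∈ Ioo (0 : ℝ) 1, ‖Q x‖ = 1 →
      ‖Q y‖ = 1 → 1 ≤ ‖lineMap (Q v) (Q (next v)) t‖ →
      lineMap (Q x, z x) (twist w H τ (Q y) (z y)) r ≠
        (lineMap (Q v) (Q (next v)) t, lineMap (z v) (z (next v)) t) := by
    intro v t ht x hx y hy r hr hx1 hy1 hv e
    rw [lineMap_mk, Prod.mk.injEq] at e
    obtain ⟨e1, e2⟩ := e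
    have hxy := hvert x y hx1 hy1 r hr (by rw [← e1] at hv; exact hv)
    have e3 : lineMap (Q x) (w * Q y) r = lineMap (Q v) (Q (next v)) t := e1
    rw [← hxy, lineMap_same_apply] at e3
    obtain ⟨rfl, rfl⟩ := F.vertex_simple x v t ht e3.symm
    rw [lineMap_apply_zero] at e2
    exact (lineMap_mem_Ioo ((hL v hx).trans_lt (hR y hy)) hr).1.ne' e2
  have hMR : ∀ v, ∀ t ∈ Ico (0 : ℝ) 1, ∀ x ∉ R, ∀ y ∈ R, ∀ r ∈ Ioo (0 : ℝ) 1, ‖Q x‖ = 1 →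
      ‖Q y‖ = 1 → 1 ≤ ‖lineMap (Q v) (Q (next v)) t‖ →
      lineMap (Q x, z x) (twist w H τ (Q y) (z y)) r ≠
        twist w H τ (lineMap (Q v) (Q (next v)) t) (lineMap (z v) (z (next v)) t) := by
    intro v t ht x hx y hy r hr hx1 hy1 hv e
    rw [lineMap_mk, Prod.ext_iff] at e
    obtain ⟨e1, e2⟩ := e
    have e3 : lineMap (Q x) (w * Q y) r = w * lineMap (Q v) (Q (next v)) t := e1
    have hxy := hvert x y hx1 hy1 r hr (by rw [e3, norm_mul, hw, one_mul]; exact hv)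
    rw [hxy, lineMap_same_apply] at e3
    obtain ⟨rfl, rfl⟩ := F.vertex_simple y v t ht (mul_left_cancel₀ hw0 e3).symm
    rw [lineMap_apply_zero, lineMap_apply_zero] at e2
    exact (lineMap_mem_Ioo ((hL x hx).trans_lt (hR v hy)) hr).2.ne e2
  have hab : ∀ s ∈ Ioo (0 : ℝ) 1, ∀ t ∈ Ioo (0 : ℝ) 1,
      lineMap (Q a, z a) (twist w H τ (Q (next a)) (z (next a))) s ≠
        lineMap (Q (next b), z (next b)) (twist w H τ (Q b) (z b)) t := by
    intro s hs t ht e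
    rw [lineMap_mk, lineMap_mk, Prod.mk.injEq] at e
    obtain ⟨e1, e2⟩ := e
    simp only [twist, F.pos_a, F.pos_next_a, F.pos_b, F.pos_next_b, lineMap_apply_module,
      smul_eq_mul, Complex.real_smul] at e1 e2
    have e3 : w * (s + t * Complex.I) = (1 - s) + (1 - t) * Complex.I := by
      push_cast at e1
      linear_combination e1
    have hn := congrArg Complex.normSq e3
    have h4 : Complex.normSq w = 1 := by rw [Complex.normSq_eq_norm_sq, hw, one_pow]
    have h5 : Complex.normSq (s + t * Complex.I) = s * s + t * t := by
      simp [Complex.normSq_apply]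
    have h6 : Complex.normSq ((1 - s) + (1 - t) * Complex.I) =
        (1 - s) * (1 - s) + (1 - t) * (1 - t) := by
      simp [Complex.normSq_apply]
    rw [map_mul, h4, h5, h6] at hn
    obtain rfl : t = 1 - s := by linarith
    refine hcoll s hs ?_ ?_
    · push_cast at e3
      linear_combination e3
    · simp only [Complex.one_re, Complex.one_im, Complex.neg_re, Complex.neg_im, Complex.I_re,
        Complex.I_im] at e2
      linear_combination e2
  have hMM : ∀ x ∉ R, ∀ y ∈ R, ∀ r ∈ Ioo (0 : ℝ) 1, ∀ r' ∈ Ioo (0 : ℝ) 1,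
      lineMap (Q x, z x) (twist w H τ (Q y) (z y)) r =
        lineMap (Q x, z x) (twist w H τ (Q y) (z y)) r' → r = r' := by
    intro x hx y hy r hr r' hr' e
    refine lineMap_injective ℝ ?_ e
    intro h
    exact ((hL x hx).trans_lt (hR y hy)).ne (congrArg Prod.snd h)
  rcases trich u s hs with ⟨e1, h1, h1'⟩ | ⟨e1, h1, h1'⟩ | ⟨x, hx, y, hy, r, hr, hx1, hy1, hc, e1⟩ <;>
  rcases trich v t ht with ⟨e2, h2, h2'⟩ | ⟨e2, h2, h2'⟩ |
    ⟨x', hx', y', hy', r', hr', hx1', hy1', hc', e2⟩ <;> rw [e1, e2] at e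
  · rw [Prod.mk.injEq] at e
    exact F.embedded u v s hs t ht e.1 e.2
  · have := congrArg Prod.snd e
    simp only at this
    linarith
  · exact absurd e.symm (hML u s hs x' hx' y' hy' r' hr' hx1' hy1' h1')
  · have := congrArg Prod.snd e
    simp only at this
    linarith
  · rw [Prod.ext_iff] at e
    obtain ⟨e3, e4⟩ := e
    simp only [twist] at e3 e4
    have e5 := mul_left_cancel₀ hw0 e3
    rw [e5] at e4
    exact F.embedded u v s hs t ht e5 (by linarith)
  · exact absurd e.symm (hMR u s hs x' hx' y' hy' r' hr' hx1' hy1' h1')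
  · exact absurd e (hML v t ht x hx y hy r hr hx1 hy1 h2')
  · exact absurd e (hMR v t ht x hx y hy r hr hx1 hy1 h2')
  · rcases hc with ⟨rfl, rfl, rfl, rfl⟩ | ⟨rfl, rfl, rfl, rfl⟩ <;>
      rcases hc' with ⟨rfl, rfl, rfl, rfl⟩ | ⟨rfl, rfl, rfl, rfl⟩
    · exact ⟨rfl, hMM _ hx _ hy _ hr _ hr' e⟩
    · exact absurd e (hab _ hr _ hr')
    · exact absurd e.symm (hab _ hr' _ hr)
    · exact ⟨rfl, by linarith [hMM _ hx _ hy _ hr _ hr' e]⟩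

/-- During a full turn the connecting edges stay disjoint if the difference of their heights at the
crossing is changed from `g` to `-g` at constant speed: in the first half of the turn the edges
could only meet if the second one were higher, and in the second half only if it were lower. -/
theorem no_collision {α β γ δ g t : ℝ} (ht : t ∈ Icc (0 : ℝ) (2 * Real.pi)) (hg : 0 < g)
    (hsum : α + β - γ - δ = g * (1 - t / Real.pi)) (hαγ : α + δ < β + γ) {s : ℝ}
    (hs : s ∈ Ioo (0 : ℝ) 1)
    (e : Complex.exp (t * Complex.I) * (s + (1 - s) * Complex.I) = (1 - s) + s * Complex.I) :
    (1 - s) * α + s * β ≠ (1 - s) * γ + s * δ := by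
  intro hh
  have hpi := Real.pi_pos
  have hs' := sub_pos.2 hs.2
  have hs0 := hs.1
  rw [Complex.exp_mul_I, ← Complex.ofReal_cos, ← Complex.ofReal_sin, Complex.ext_iff] at e
  simp only [Complex.add_re, Complex.mul_re, Complex.ofReal_re, Complex.ofReal_im, Complex.I_re,
    Complex.I_im, Complex.add_im, Complex.mul_im, Complex.sub_re, Complex.sub_im, Complex.one_re,
    Complex.one_im] at e
  obtain ⟨e1, e2⟩ := e
  ring_nf at e1 e2
  have hN : 0 < s ^ 2 + (1 - s) ^ 2 := by positivity
  have hsin : Real.sin t * (s ^ 2 + (1 - s) ^ 2) = 2 * s - 1 := by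
    linear_combination s * e2 - (1 - s) * e1
  have hcos : Real.cos t * (s ^ 2 + (1 - s) ^ 2) = 2 * s * (1 - s) := by
    linear_combination s * e1 + (1 - s) * e2
  have hlin : (2 * s - 1) * (β + γ - α - δ) = -(g * (1 - t / Real.pi)) := by
    rw [← hsum]
    linear_combination 2 * hh
  rcases lt_trichotomy t Real.pi with h | h | h
  · have h1 : 0 < 1 - t / Real.pi := by
      rw [sub_pos, div_lt_one hpi]
      exact h
    have h2 : 0 ≤ Real.sin t := Real.sin_nonneg_of_nonneg_of_le_pi ht.1 h.le
    have h3 : 0 < g * (1 - t / Real.pi) := mul_pos hg h1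
    have h4 : 0 ≤ 2 * s - 1 := hsin ▸ mul_nonneg h2 hN.le
    nlinarith [mul_nonneg h4 (by linarith : (0 : ℝ) ≤ β + γ - α - δ)]
  · rw [h, Real.cos_pi] at hcos
    nlinarith [mul_pos hs0 hs']
  · have h1 : 1 - t / Real.pi < 0 := by
      rw [sub_neg, one_lt_div hpi]
      exact h
    have h2 : Real.sin t ≤ 0 := by
      have := Real.sin_nonneg_of_nonneg_of_le_pi (x := t - Real.pi) (by linarith)
        (by linarith [ht.2])
      rw [Real.sin_sub_pi] at this
      linarith
    have h3 : g * (1 - t / Real.pi) < 0 := mul_neg_of_pos_of_neg hg h1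
    have h4 : 2 * s - 1 ≤ 0 := hsin ▸ mul_nonpos_of_nonpos_of_nonneg h2 hN.le
    nlinarith [mul_nonneg (neg_nonneg.2 h4) (by linarith : (0 : ℝ) ≤ β + γ - α - δ)]

end TwoStrandSplitting

/-- Coordinates of the plane with respect to a positively oriented basis. -/
noncomputable def planeFrame (x y : Plane) (h : 0 < ClosedPolygons.det x y) : Plane ≃ₗ[ℝ] ℂ where
  toFun p := ⟨ClosedPolygons.det p y / ClosedPolygons.det x y,
    ClosedPolygons.det x p / ClosedPolygons.det x y⟩
  map_add' p q := by
    apply Complex.ext <;> simp [ClosedPolygons.det] <;> ring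
  map_smul' r p := by
    apply Complex.ext <;> simp [ClosedPolygons.det] <;> ring
  invFun w := w.re • x + w.im • y
  left_inv p := by
    have h' := h.ne'
    apply Prod.ext
    · simp only [Prod.fst_add, Prod.smul_fst, smul_eq_mul]
      field_simp
      simp only [ClosedPolygons.det]
      ring
    · simp only [Prod.snd_add, Prod.smul_snd, smul_eq_mul]
      field_simp
      simp only [ClosedPolygons.det]
      ring
  right_inv w := by
    have h' := h.ne'
    apply Complex.ext
    · simp only
      rw [div_eq_iff h']
      simp only [ClosedPolygons.det, Prod.fst_add, Prod.smul_fst, smul_eq_mul, Prod.snd_add,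
        Prod.smul_snd]
      ring
    · simp only
      rw [div_eq_iff h']
      simp only [ClosedPolygons.det, Prod.fst_add, Prod.smul_fst, smul_eq_mul, Prod.snd_add,
        Prod.smul_snd]
      ring

theorem planeFrame_left {x y : Plane} (h : 0 < ClosedPolygons.det x y) : planeFrame x y h x = 1 := by
  rw [eq_comm, ← LinearEquiv.symm_apply_eq]
  change (1 : ℝ) • x + (0 : ℝ) • y = x
  simp

theorem planeFrame_right {x y : Plane} (h : 0 < ClosedPolygons.det x y) :
    planeFrame x y h y = Complex.I := by
  rw [eq_comm, ← LinearEquiv.symm_apply_eq]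
  change (Complex.I).re • x + (Complex.I).im • y = y
  simp

theorem LinearEquiv.lineMap_sub {E F : Type*} [AddCommGroup E] [Module ℝ E] [AddCommGroup F]
    [Module ℝ F] (f : E ≃ₗ[ℝ] F) (x y c : E) (s : ℝ) :
    f (lineMap x y s - c) = lineMap (f (x - c)) (f (y - c)) s := by
  simp only [lineMap_apply_module', map_sub, map_add, map_smul]
  module

theorem lineMap_prod_eq_iff {E F : Type*} [AddCommGroup E] [Module ℝ E] [AddCommGroup F]
    [Module ℝ F] {x y x' y' : E × F} {s t : ℝ} :
    lineMap x y s = (lineMap x' y' t : E × F) ↔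
      lineMap x.1 y.1 s = (lineMap x'.1 y'.1 t : E) ∧
        lineMap x.2 y.2 s = (lineMap x'.2 y'.2 t : F) := by
  rw [lineMap_mk x y, lineMap_mk x' y', Prod.mk.injEq]

/-- Heights that differ at every crossing of a plane diagram define embedded polygons. -/
theorem isEmbedded_of_shadow {n : ℕ} {next : Equiv.Perm (Fin n)} {pos : Fin n → Space}
    (hmid : (ClosedPolygons.mk n next fun v => (pos v).1).Midpointed)
    (h : ∀ u w, (ClosedPolygons.mk n next fun v => (pos v).1).MidCross u w →
      (pos u).2 + (pos (next u)).2 ≠ (pos w).2 + (pos (next w)).2) :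
    IsEmbedded next pos := by
  rw [isEmbedded_iff]
  intro u w s hs t ht e
  rw [lineMap_prod_eq_iff] at e
  obtain ⟨e1, e2⟩ := e
  by_contra hne
  have hne' : ((u, s) : Fin n × ℝ) ≠ (w, t) := fun h => hne (Prod.ext_iff.1 h)
  have h1 := hmid (u, s) hs (w, t) ht hne' e1
  have h2 := hmid (w, t) ht (u, s) hs hne'.symm e1.symm
  simp only at h1 h2
  subst h1 h2
  refine h u w ⟨fun e => hne ⟨e, rfl⟩, e1⟩ ?_
  simp only [lineMap_apply_module, smul_eq_mul] at e2
  linarith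

open PolygonalLink in
theorem equivalent_of_path {n : ℕ} {next : Equiv.Perm (Fin n)} {T : ℝ} (hT : 0 ≤ T)
    (γ : ℝ → Fin n → Space) (hγ : Continuous γ)
    (hE : ∀ t ∈ Icc (0 : ℝ) T, IsEmbedded next (γ t)) :
    Equivalent (ofPos (hE 0 ⟨le_rfl, hT⟩)) (ofPos (hE T ⟨hT, le_rfl⟩)) :=
  equivalent_of_isPreconnected (s := γ '' Icc 0 T)
    (isPreconnected_Icc.image γ hγ.continuousOn) (by rintro _ ⟨t, ht, rfl⟩; exact hE t ht)
    (mem_image_of_mem γ ⟨le_rfl, hT⟩) (mem_image_of_mem γ ⟨hT, le_rfl⟩)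

open PolygonalLink in
/-- Let a diagram fall into two parts that meet in the crossing of `a` and `b` only, where `a` is
over `b`. Lifting one part above the other one and giving it a full turn changes this crossing
and no other. -/
theorem exists_equivalent_crossing_changed (K : PolygonalLink) (hP : K.shadow.IsRegular)
    (hmid : K.shadow.Midpointed) {a b : Fin K.n} (hab : K.shadow.MidCross a b)
    (hdet : 0 < ClosedPolygons.det (K.shadow.dir a) (K.shadow.dir b))
    (hover : (K.pos b).2 + (K.pos (K.next b)).2 < (K.pos a).2 + (K.pos (K.next a)).2)
    (hout : ∀ u, u ≠ a → u ≠ b → ∀ s ∈ Ico (0 : ℝ) 1, 1 / 2 ≤ ‖planeFrame _ _ hdet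
      (K.shadow.point (u, s) - K.shadow.point (a, 1 / 2))‖)
    {R : Set (Fin K.n)} (haR : a ∉ R) (haR' : K.next a ∈ R) (hbR : b ∈ R) (hbR' : K.next b ∉ R)
    (hR : ∀ u, u ≠ a → u ≠ b → (u ∈ R ↔ K.next u ∈ R))
    (hcross : ∀ u w : Fin K.n, K.shadow.MidCross u w → u ≠ a → u ≠ b → (u ∈ R ↔ w ∈ R)) :
    ∃ pos : Fin K.n → Space, ∃ h : IsEmbedded K.next pos, K.Equivalent (ofPos h) ∧
      (∀ u, (pos u).1 = (K.pos u).1) ∧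
      (∀ u w : Fin K.n, K.shadow.MidCross u w → u ≠ a → u ≠ b →
        ((pos u).2 + (pos (K.next u)).2 < (pos w).2 + (pos (K.next w)).2 ↔
          (K.pos u).2 + (K.pos (K.next u)).2 < (K.pos w).2 + (K.pos (K.next w)).2)) ∧
      (pos a).2 + (pos (K.next a)).2 < (pos b).2 + (pos (K.next b)).2 := by
  classical
  set c := K.shadow.point (a, 1 / 2) with hc
  let f : Plane ≃ₗ[ℝ] ℂ := (planeFrame _ _ hdet).trans (LinearEquiv.smulOfNeZero ℝ ℂ 2 two_ne_zero)
  have hf : ∀ x, f x = (2 : ℝ) • planeFrame _ _ hdet x := fun x => rfl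
  let Q : Fin K.n → ℂ := fun v => f ((K.pos v).1 - c)
  let z : Fin K.n → ℝ := fun v => (K.pos v).2
  have hpos : ∀ v, (f.symm (Q v) + c, z v) = K.pos v := fun v => by simp [Q, z]
  have hQl : ∀ u s, lineMap (Q u) (Q (K.next u)) s = f (K.shadow.point (u, s) - c) := fun u s => by
    simp only [Q]
    rw [← LinearEquiv.lineMap_sub]
    rfl
  have h_emb := isEmbedded_iff.1 (show IsEmbedded K.next K.pos from K.embedded)
  have e_a : (K.pos a).1 - c = -((1 / 2 : ℝ) • K.shadow.dir a) := by
    rw [hc]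
    simp only [ClosedPolygons.point, ClosedPolygons.dir, lineMap_apply_module', shadow]
    module
  have e_na : (K.pos (K.next a)).1 - c = (1 / 2 : ℝ) • K.shadow.dir a := by
    rw [hc]
    simp only [ClosedPolygons.point, ClosedPolygons.dir, lineMap_apply_module', shadow]
    module
  have e_b : (K.pos b).1 - c = -((1 / 2 : ℝ) • K.shadow.dir b) := by
    rw [hc, hab.2]
    simp only [ClosedPolygons.point, ClosedPolygons.dir, lineMap_apply_module', shadow]
    module
  have e_nb : (K.pos (K.next b)).1 - c = (1 / 2 : ℝ) • K.shadow.dir b := by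
    rw [hc, hab.2]
    simp only [ClosedPolygons.point, ClosedPolygons.dir, lineMap_apply_module', shadow]
    module
  have F : TwoStrandSplitting K.next Q z R a b := by
    refine ⟨haR, haR', hbR, hbR', hR, ?_, ?_, ?_, ?_, ?_, ?_, ?_⟩
    · simp only [Q]
      rw [e_a, map_neg, hf, map_smul, planeFrame_left, smul_smul]
      norm_num
    · simp only [Q]
      rw [e_na, hf, map_smul, planeFrame_left, smul_smul]
      norm_num
    · simp only [Q]
      rw [e_b, map_neg, hf, map_smul, planeFrame_right, smul_smul]
      norm_num
    · simp only [Q]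
      rw [e_nb, hf, map_smul, planeFrame_right, smul_smul]
      norm_num
    · intro u hua hub s hs
      rw [hQl, hf, norm_smul]
      have := hout u hua hub s hs
      rw [show ‖(2 : ℝ)‖ = 2 by norm_num]
      linarith
    · intro v u s hs e
      rw [hQl] at e
      have h1 : K.shadow.point (u, s) = K.shadow.pos v := sub_left_injective (f.injective e)
      have := hP.vertex_simple v (u, s) hs h1
      exact Prod.ext_iff.1 this
    · intro u v s hs t ht e1 e2
      rw [hQl, hQl] at e1
      refine h_emb u v s hs t ht ?_
      rw [lineMap_prod_eq_iff]
      exact ⟨sub_left_injective (f.injective e1), e2⟩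
  -- The doubled difference of heights at the special crossing.
  set g := z a + z (K.next a) - z b - z (K.next b) with hg
  have hg0 : 0 < g := by
    simp only [hg, z]
    linarith
  obtain ⟨m, hm⟩ : ∃ m, ∀ u, z u ≤ m := by
    obtain ⟨m, hm⟩ := (Set.finite_range z).bddAbove
    exact ⟨m, fun u => hm ⟨u, rfl⟩⟩
  obtain ⟨m', hm'⟩ : ∃ m', ∀ u, m - z u + g * |(Q u).re + (Q u).im| ≤ m' := by
    obtain ⟨m', hm'⟩ := (Set.finite_range fun u => m - z u + g * |(Q u).re + (Q u).im|).bddAbove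
    exact ⟨m', fun u => hm' ⟨u, rfl⟩⟩
  set H := m' + 1
  have hpi := Real.pi_pos
  -- The shear that changes the height difference from `g` to `-g` in a full turn.
  let τ : ℝ → ℝ := fun t => -(g * t / (2 * Real.pi))
  have hτ : ∀ t ∈ Icc (0 : ℝ) (2 * Real.pi), ∀ u, m < z u + H + τ t * ((Q u).re + (Q u).im) := by
    intro t ht u
    have h1 : |τ t| ≤ g := by
      simp only [τ]
      rw [abs_neg, abs_of_nonneg (by have := ht.1; positivity), div_le_iff₀ (by positivity)]
      exact mul_le_mul_of_nonneg_left ht.2 hg0.le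
    have h2 : |τ t * ((Q u).re + (Q u).im)| ≤ g * |(Q u).re + (Q u).im| := by
      rw [abs_mul]
      exact mul_le_mul_of_nonneg_right h1 (abs_nonneg _)
    have h3 := neg_le_of_abs_le h2
    have h4 := hm' u
    simp only [H]
    linarith
  let Ψ : ℂ × ℝ → Space := fun p => (f.symm p.1 + c, p.2)
  have hΨ : ∀ (p q : ℂ × ℝ) (s : ℝ), lineMap (Ψ p) (Ψ q) s = Ψ (lineMap p q s) := by
    intro p q s
    rw [lineMap_mk (Ψ p), lineMap_mk p q]
    refine Prod.ext ?_ rfl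
    simp only [Ψ, lineMap_apply_module', map_add, map_smul, map_sub]
    module
  have hΨi : Function.Injective Ψ := by
    rintro ⟨p, p'⟩ ⟨q, q'⟩ e
    simp only [Ψ, Prod.mk.injEq, add_left_inj] at e
    exact Prod.ext (f.symm.injective e.1) e.2
  have hΨc : Continuous Ψ := by
    have : Continuous f.symm := f.symm.toLinearMap.continuous_of_finiteDimensional
    fun_prop
  -- First isotopy: the part `R` is lifted.
  let γ₁ : ℝ → Fin K.n → Space := fun r u =>
    ((K.pos u).1, (K.pos u).2 + if u ∈ R then r * H else 0)
  have hγ₁ : Continuous γ₁ := by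
    refine continuous_pi fun u => ?_
    by_cases hu : u ∈ R
    · simp only [γ₁, hu, if_true]
      fun_prop
    · simp only [γ₁, hu, if_false]
      fun_prop
  have hh : ∀ u w : Fin K.n, K.shadow.MidCross u w →
      (K.pos u).2 + (K.pos (K.next u)).2 ≠ (K.pos w).2 + (K.pos (K.next w)).2 := by
    intro u w h e
    refine h.1 (h_emb u w (1 / 2) (by norm_num) (1 / 2) (by norm_num) ?_).1
    rw [lineMap_prod_eq_iff]
    refine ⟨h.2, ?_⟩
    simp only [lineMap_apply_module, smul_eq_mul]
    linarith
  have hpair : ∀ w, K.shadow.MidCross a w → w = b := fun w h => hP.midCross_unique h hab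
  have hpair' : ∀ w, K.shadow.MidCross b w → w = a := fun w h => hP.midCross_unique h hab.symm
  have hcross' : ∀ u w : Fin K.n, K.shadow.MidCross u w → u ≠ a → u ≠ b → w ≠ a ∧ w ≠ b :=
    fun u w h hua hub => ⟨by rintro rfl; exact hub (hpair _ h.symm),
      by rintro rfl; exact hua (hpair' _ h.symm)⟩
  have hE₁ : ∀ r ∈ Icc (0 : ℝ) 1, IsEmbedded K.next (γ₁ r) := by
    intro r _
    refine isEmbedded_of_shadow hmid fun (u w : Fin K.n) (huw : K.shadow.MidCross u w) => ?_
    have h0 := hh u w huw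
    simp only [γ₁]
    by_cases hua : u = a
    · obtain rfl : w = b := hpair w (hua ▸ huw)
      subst hua
      simp only [haR, haR', hbR, hbR', if_true, if_false]
      intro e
      exact h0 (by linarith)
    by_cases hub : u = b
    · obtain rfl : w = a := hpair' w (hub ▸ huw)
      subst hub
      simp only [haR, haR', hbR, hbR', if_true, if_false]
      intro e
      exact h0 (by linarith)
    · obtain ⟨hwa, hwb⟩ := hcross' u w huw hua hub
      have h1 := hR u hua hub
      have h2 := hR w hwa hwb
      have h3 := hcross u w huw hua hub
      have h4 : K.next w ∈ R ↔ u ∈ R := (h3.trans h2).symm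
      simp only [← h1, ← h3, h4]
      intro e
      exact h0 (by linarith)
  -- Second isotopy: the part `R` is turned around.
  let γ₂ : ℝ → Fin K.n → Space := fun t u =>
    Ψ (twistPos Q z R (Complex.exp (t * Complex.I)) H (τ t) u)
  have hγ₂ : Continuous γ₂ := by
    refine continuous_pi fun u => hΨc.comp ?_
    by_cases hu : u ∈ R
    · simp only [twistPos, hu, if_true, twist, τ]
      fun_prop
    · simp only [twistPos, hu, if_false]
      fun_prop
  have hE₂ : ∀ t ∈ Icc (0 : ℝ) (2 * Real.pi), IsEmbedded K.next (γ₂ t) := by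
    intro t ht
    rw [isEmbedded_iff]
    intro u v s hs r hr e
    simp only [γ₂] at e
    rw [hΨ, hΨ] at e
    refine F.embedded_twistPos (by rw [Complex.norm_exp_ofReal_mul_I]) (c := m)
      (fun u _ => hm u) (fun u _ => hτ t ht u) (fun s hs e => ?_) u v s hs r hr (hΨi e)
    refine TwoStrandSplitting.no_collision ht hg0 ?_ ?_ hs e
    · simp only [τ, hg]
      field_simp
      ring
    · have h1 := hτ t ht (K.next a)
      have h2 := hτ t ht b
      have h3 := hm a
      have h4 := hm (K.next b)
      rw [F.pos_next_a] at h1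
      rw [F.pos_b] at h2
      simp only [Complex.one_re, Complex.one_im, Complex.neg_re, Complex.neg_im, Complex.I_re,
        Complex.I_im] at h1 h2
      linarith
  have eq0 : γ₁ 0 = K.pos := by
    funext u
    simp [γ₁]
  have eq1 : γ₁ 1 = γ₂ 0 := by
    funext u
    simp only [γ₁, γ₂, Ψ, twistPos, twist, τ]
    by_cases hu : u ∈ R
    · simp [hu, Q, z]
    · simp [hu, Q, z]
  have hcontrib : ∀ u, (γ₂ (2 * Real.pi) u).2 =
      z u + if u ∈ R then H - g * ((Q u).re + (Q u).im) else 0 := by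
    intro u
    simp only [γ₂, Ψ, twistPos, twist, τ]
    by_cases hu : u ∈ R
    · simp only [hu, if_true]
      field_simp
      ring
    · simp [hu]
  refine ⟨γ₂ (2 * Real.pi), hE₂ _ ⟨by positivity, le_rfl⟩, ?_, ?_, ?_, ?_⟩
  · have E1 := equivalent_of_path zero_le_one γ₁ hγ₁ hE₁
    have E2 := equivalent_of_path (by positivity) γ₂ hγ₂ hE₂
    rw [ofPos_congr eq0 _ K.embedded] at E1
    rw [ofPos_congr eq1 _ (hE₂ 0 ⟨le_rfl, by positivity⟩)] at E1
    exact Equivalent.trans E1 E2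
  · intro u
    have h1 : Complex.exp (((2 * Real.pi : ℝ) : ℂ) * Complex.I) = 1 := by
      push_cast
      exact Complex.exp_two_pi_mul_I
    simp only [γ₂, Ψ, twistPos, h1]
    by_cases hu : u ∈ R
    · simp [hu, Q, twist]
    · simp [hu, Q]
  · intro u w huw hua hub
    simp only [hcontrib]
    obtain ⟨hwa, hwb⟩ := hcross' u w huw hua hub
    have h1 := hR u hua hub
    have h2 := hR w hwa hwb
    have h3 := hcross u w huw hua hub
    have h4 : K.next w ∈ R ↔ u ∈ R := (h3.trans h2).symm
    -- Both edges are sheared by the same amount at their common midpoint.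
    have hsum : Q u + Q (K.next u) = Q w + Q (K.next w) := by
      have := (hQl u (1 / 2)).trans ((congrArg (fun x => f (x - c)) huw.2).trans
        (hQl w (1 / 2)).symm)
      simp only [lineMap_apply_module, Complex.real_smul] at this
      push_cast at this
      linear_combination 2 * this
    have hre := congrArg Complex.re hsum
    have him := congrArg Complex.im hsum
    simp only [Complex.add_re, Complex.add_im] at hre him
    simp only [← h1, ← h3, h4]
    by_cases hu : u ∈ R
    · simp only [hu, if_true, z]
      have hl : g * ((Q u).re + (Q u).im) + g * ((Q (K.next u)).re + (Q (K.next u)).im) =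
          g * ((Q w).re + (Q w).im) + g * ((Q (K.next w)).re + (Q (K.next w)).im) := by
        linear_combination g * hre + g * him
      constructor <;> intro h <;> linarith
    · simp only [hu, if_false, z, add_zero]
  · simp only [hcontrib, haR, haR', hbR, hbR', if_true, if_false, F.pos_next_a, F.pos_b]
    simp only [Complex.one_re, Complex.one_im, Complex.neg_re, Complex.neg_im, Complex.I_re,
      Complex.I_im]
    linarith

/-! ### Subdividing the edges of a link -/

namespace PolygonalLink

/-- `K'` arises from `K` by subdividing edges. -/
structure Refines (K' K : PolygonalLink) : Prop where
  carrier_eq : K'.carrier = K.carrier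
  edge : ∀ u', ∃ u α β, 0 ≤ α ∧ α < β ∧ β ≤ 1 ∧ K'.pos u' = K.point (u, α) ∧
    K'.pos (K'.next u') = K.point (u, β)

theorem point_eq (K : PolygonalLink) (u : Fin K.n) (s : ℝ) :
    K.point (u, s) = lineMap (K.pos u) (K.pos (K.next u)) s := rfl

theorem point_sub (K : PolygonalLink) (u : Fin K.n) (α β s : ℝ) :
    lineMap (K.point (u, α)) (K.point (u, β)) s = K.point (u, α + s * (β - α)) := by
  simp only [point_eq, lineMap_apply_module']
  module

theorem point_one (K : PolygonalLink) (u : Fin K.n) : K.point (u, 1) = K.pos (K.next u) := by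
  simp [point_eq]

theorem point_zero (K : PolygonalLink) (u : Fin K.n) : K.point (u, 0) = K.pos u := by
  simp [point_eq]

theorem pos_mem_carrier (K : PolygonalLink) (u : Fin K.n) : K.pos u ∈ K.carrier :=
  ⟨(u, 0), by simp [ClosedPolygons.params], K.point_zero u⟩

theorem point_mem_carrier (K : PolygonalLink) (u : Fin K.n) {s : ℝ} (hs : s ∈ Icc (0 : ℝ) 1) :
    K.point (u, s) ∈ K.carrier := by
  rcases hs.2.eq_or_lt with rfl | hs1
  · rw [point_one]
    exact K.pos_mem_carrier _
  · exact ⟨(u, s), ⟨hs.1, hs1⟩, rfl⟩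

theorem point_inj (K : PolygonalLink) {u w : Fin K.n} {s t : ℝ} (hs : s ∈ Ico (0 : ℝ) 1)
    (ht : t ∈ Ico (0 : ℝ) 1) (e : K.point (u, s) = K.point (w, t)) : u = w ∧ s = t :=
  Prod.ext_iff.1 (K.embedded (show (u, s) ∈ K.params from hs) (show (w, t) ∈ K.params from ht) e)

theorem lineMap_mem_carrier (K : PolygonalLink) {u : Fin K.n} {X Y : Space} {t : ℝ}
    (hX : K.pos u = X) (hY : K.pos (K.next u) = Y) (ht : t ∈ Icc (0 : ℝ) 1) :
    lineMap X Y t ∈ K.carrier := by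
  subst hX hY
  exact K.point_mem_carrier u ht

theorem Refines.refl (K : PolygonalLink) : K.Refines K :=
  ⟨rfl, fun u => ⟨u, 0, 1, le_rfl, zero_lt_one, le_rfl, (K.point_zero u).symm,
    (K.point_one u).symm⟩⟩

theorem Refines.trans {K K' K'' : PolygonalLink} (h : K''.Refines K') (h' : K'.Refines K) :
    K''.Refines K := by
  refine ⟨h.carrier_eq.trans h'.carrier_eq, fun u'' => ?_⟩
  obtain ⟨u', α', β', h1, h2, h3, e1, e2⟩ := h.edge u''
  obtain ⟨u, α, β, h1', h2', h3', e1', e2'⟩ := h'.edge u'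
  have hd : 0 < β - α := by linarith
  have key : ∀ s, K'.point (u', s) = K.point (u, α + s * (β - α)) := fun s => by
    rw [point_eq, e1', e2', point_sub]
  refine ⟨u, α + α' * (β - α), α + β' * (β - α), ?_, ?_, ?_, ?_, ?_⟩
  · positivity
  · nlinarith
  · nlinarith
  · rw [e1, key]
  · rw [e2, key]

/-- Any point of a link can be made a vertex. -/
theorem exists_refines_insert (K : PolygonalLink) {X : Space} (hX : X ∈ K.carrier) :
    ∃ K' : PolygonalLink, K.Equivalent K' ∧ K'.Refines K ∧
      range K'.pos = insert X (range K.pos) := by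
  obtain ⟨⟨a, s⟩, hs, rfl⟩ := hX
  have hs : s ∈ Ico (0 : ℝ) 1 := hs
  rcases hs.1.eq_or_lt with rfl | hs0
  · refine ⟨K, Relation.EqvGen.refl _, .refl K, ?_⟩
    rw [insert_eq_of_mem]
    exact ⟨a, (K.point_zero a).symm⟩
  have hK : IsEmbedded K.next K.pos := K.embedded
  have hne : K.pos (K.next a) - K.pos a ≠ 0 :=
    sub_ne_zero.2 fun e => hK.next_ne a (hK.pos_injective e)
  have hseg : K.point (a, s) ∈ segment ℝ (K.pos a) (K.pos (K.next a)) :=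
    mem_segment_lineMap _ _ (Ico_subset_unit hs)
  have hT : convexHull ℝ {K.pos a, K.pos (K.next a), K.point (a, s)} ∩
      (ClosedPolygons.mk K.n K.next K.pos).carrier = segment ℝ (K.pos a) (K.pos (K.next a)) := by
    apply Subset.antisymm
    · refine inter_subset_left.trans (convexHull_min ?_ (convex_segment _ _))
      rintro Y (rfl | rfl | rfl)
      · exact left_mem_segment _ _ _
      · exact right_mem_segment _ _ _
      · exact hseg
    · intro Y hY
      refine ⟨segment_subset_convexHull (by simp) (by simp) hY, ?_⟩
      rw [segment_eq_image_lineMap] at hY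
      obtain ⟨r, hr, rfl⟩ := hY
      exact K.point_mem_carrier a hr
  have hC : ¬ SameRay ℝ (K.pos a - K.point (a, s)) (K.pos (K.next a) - K.point (a, s)) := by
    have e1 : K.pos a - K.point (a, s) = (-s) • (K.pos (K.next a) - K.pos a) := by
      rw [point_eq, lineMap_apply_module']
      module
    have e2 : K.pos (K.next a) - K.point (a, s) = (1 - s) • (K.pos (K.next a) - K.pos a) := by
      rw [point_eq, lineMap_apply_module']
      module
    rw [e1, e2]
    have hs1 := sub_pos.2 hs.2
    rintro (h | h | ⟨r₁, r₂, hr₁, hr₂, h⟩)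
    · exact (smul_ne_zero (neg_ne_zero.2 hs0.ne') hne) h
    · exact (smul_ne_zero hs1.ne' hne) h
    · rw [smul_smul, smul_smul, ← sub_eq_zero, ← sub_smul, smul_eq_zero] at h
      have := h.resolve_right hne
      nlinarith [mul_pos hr₁ hs0, mul_pos hr₂ hs1]
  have hins := hK.insert hT hC
  have hedge : ∀ u', ∃ u α β, 0 ≤ α ∧ α < β ∧ β ≤ 1 ∧ (ofPos hins).pos u' = K.point (u, α) ∧
      (ofPos hins).pos ((ofPos hins).next u') = K.point (u, β) := by
    intro u'
    change ∃ u α β, 0 ≤ α ∧ α < β ∧ β ≤ 1 ∧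
      (Fin.snoc K.pos (K.point (a, s)) : Fin (K.n + 1) → Space) u' = K.point (u, α) ∧
      (Fin.snoc K.pos (K.point (a, s)) : Fin (K.n + 1) → Space) (insertNext K.next a u') =
        K.point (u, β)
    induction u' using Fin.lastCases with
    | last =>
      refine ⟨a, s, 1, hs.1, hs.2, le_rfl, ?_, ?_⟩
      · rw [Fin.snoc_last]
      · rw [insertNext_last, Fin.snoc_castSucc, point_one]
    | cast u =>
      by_cases hu : u = a
      · subst hu
        refine ⟨u, 0, s, le_rfl, hs0, hs.2.le, ?_, ?_⟩
        · rw [Fin.snoc_castSucc, point_zero]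
        · rw [insertNext_self, Fin.snoc_last]
      · refine ⟨u, 0, 1, le_rfl, zero_lt_one, le_rfl, ?_, ?_⟩
        · rw [Fin.snoc_castSucc, point_zero]
        · rw [insertNext_of_ne _ _ hu, Fin.snoc_castSucc, point_one]
  have hlast : (ofPos hins).pos (Fin.last K.n) = K.point (a, s) :=
    Fin.snoc_last (α := fun _ => Space) _ _
  have hcast : ∀ u : Fin K.n, (ofPos hins).pos u.castSucc = K.pos u :=
    fun u => Fin.snoc_castSucc (α := fun _ => Space) _ _ u
  have hnext : (ofPos hins).pos ((ofPos hins).next a.castSucc) = K.point (a, s) := by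
    change (Fin.snoc K.pos (K.point (a, s)) : Fin (K.n + 1) → Space)
      (insertNext K.next a a.castSucc) = _
    rw [insertNext_self, Fin.snoc_last]
  have hnext' : (ofPos hins).pos ((ofPos hins).next (Fin.last K.n)) = K.pos (K.next a) := by
    change (Fin.snoc K.pos (K.point (a, s)) : Fin (K.n + 1) → Space)
      (insertNext K.next a (Fin.last K.n)) = _
    rw [insertNext_last, Fin.snoc_castSucc]
  have hnext'' : ∀ u, u ≠ a →
      (ofPos hins).pos ((ofPos hins).next u.castSucc) = K.pos (K.next u) := by
    intro u hu
    change (Fin.snoc K.pos (K.point (a, s)) : Fin (K.n + 1) → Space)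
      (insertNext K.next a u.castSucc) = _
    rw [insertNext_of_ne _ _ hu, Fin.snoc_castSucc]
  refine ⟨ofPos hins, Relation.EqvGen.rel _ _ (triangleMove_insert hK hT hins), ⟨?_, hedge⟩, ?_⟩
  · apply Subset.antisymm
    · rintro _ ⟨⟨u', r⟩, hr, rfl⟩
      have hr : r ∈ Ico (0 : ℝ) 1 := hr
      obtain ⟨u, α, β, h1, h2, h3, e1, e2⟩ := hedge u'
      rw [point_eq, e1, e2, point_sub]
      exact K.point_mem_carrier u ⟨by nlinarith [hr.1], by nlinarith [hr.1, hr.2]⟩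
    · rintro _ ⟨⟨u, r⟩, hr, rfl⟩
      have hr : r ∈ Ico (0 : ℝ) 1 := hr
      by_cases hu : u = a
      · rw [hu]
        rcases lt_or_ge r s with h | h
        · have hd : r / s * s = r := div_mul_cancel₀ _ hs0.ne'
          have key : lineMap (K.pos a) (K.point (a, s)) (r / s) = K.point (a, r) := by
            rw [← K.point_zero a, point_sub, sub_zero, hd, zero_add]
          rw [← key]
          exact (ofPos hins).lineMap_mem_carrier (hcast a) hnext
            ⟨div_nonneg hr.1 hs.1, (div_le_one hs0).2 h.le⟩
        · have hs1 : 0 < 1 - s := sub_pos.2 hs.2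
          have hd : (r - s) / (1 - s) * (1 - s) = r - s := div_mul_cancel₀ _ hs1.ne'
          have key : lineMap (K.point (a, s)) (K.pos (K.next a)) ((r - s) / (1 - s)) =
              K.point (a, r) := by
            rw [← K.point_one a, point_sub, hd, add_sub_cancel]
          rw [← key]
          exact (ofPos hins).lineMap_mem_carrier hlast hnext'
            ⟨div_nonneg (by linarith) hs1.le, (div_le_one hs1).2 (by linarith [hr.2])⟩
      · exact (ofPos hins).lineMap_mem_carrier (hcast u) (hnext'' u hu) (Ico_subset_unit hr)
  · apply Subset.antisymm
    · rintro _ ⟨u', rfl⟩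
      change Fin (K.n + 1) at u'
      induction u' using Fin.lastCases with
      | last => exact Or.inl hlast
      | cast u => exact Or.inr ⟨u, (hcast u).symm⟩
    · rintro _ (rfl | ⟨u, rfl⟩)
      · exact ⟨Fin.last K.n, hlast⟩
      · exact ⟨u.castSucc, hcast u⟩

theorem exists_refines_union (K : PolygonalLink) {V : Set Space} (hV : V.Finite)
    (hVK : V ⊆ K.carrier) :
    ∃ K' : PolygonalLink, K.Equivalent K' ∧ K'.Refines K ∧ range K'.pos = V ∪ range K.pos := by
  induction V, hV using Set.Finite.induction_on with
  | empty => exact ⟨K, Relation.EqvGen.refl _, .refl K, by simp⟩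
  | insert _ _ ih =>
    rw [insert_subset_iff] at hVK
    obtain ⟨K', h1, h2, h3⟩ := ih hVK.2
    obtain ⟨K'', h1', h2', h3'⟩ := K'.exists_refines_insert (h2.carrier_eq ▸ hVK.1)
    exact ⟨K'', h1.trans h1', h2'.trans h2, by rw [h3', h3, insert_union]⟩

/-! ### Crossings as points of the link -/

/-- The point `X` of a link with underlying set `A` lies on a crossing. -/
def IsCrossingPoint (A : Set Space) (X : Space) : Prop := ∃ Y ∈ A, Y.1 = X.1 ∧ Y ≠ X

/-- The point `X` lies above a point of `A`. -/
def LiesOver (A : Set Space) (X : Space) : Prop := ∃ Y ∈ A, Y.1 = X.1 ∧ Y.2 < X.2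

/-- The point `X` lies below a point of `A`. -/
def LiesUnder (A : Set Space) (X : Space) : Prop := ∃ Y ∈ A, Y.1 = X.1 ∧ X.2 < Y.2

/-- The strand through `X` is the over-strand after the crossing at the point `c` of the plane has
been changed. -/
def ChangedOver (A : Set Space) (c : Plane) (X : Space) : Prop :=
  X.1 ≠ c ∧ LiesOver A X ∨ X.1 = c ∧ LiesUnder A X

/-- After a change of the crossing at `c` the diagram of `K` is alternating: the points of the link
off the crossings are labelled in such a way that the label is constant between crossings, changes
from false to true at over-passages and from true to false at under-passages. Thus `ℓ X` says that
the next passage after `X` is an under-passage. -/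
structure AlternatingLabel (K : PolygonalLink) (c : Plane) (ℓ : Space → Prop) : Prop where
  const : ∀ u s s', 0 ≤ s → s ≤ s' → s' ≤ 1 →
    (∀ x ∈ Icc s s', ¬ IsCrossingPoint K.carrier (K.point (u, x))) →
    (ℓ (K.point (u, s)) ↔ ℓ (K.point (u, s')))
  switch : ∀ u s r s', 0 ≤ s → s < r → r < s' → s' ≤ 1 →
    (∀ x ∈ Icc s s', IsCrossingPoint K.carrier (K.point (u, x)) → x = r) →
    IsCrossingPoint K.carrier (K.point (u, r)) →
    (ChangedOver K.carrier c (K.point (u, r)) → ¬ ℓ (K.point (u, s)) ∧ ℓ (K.point (u, s'))) ∧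
    (¬ ChangedOver K.carrier c (K.point (u, r)) → ℓ (K.point (u, s)) ∧ ¬ ℓ (K.point (u, s')))

theorem Refines.point {K K' : PolygonalLink} {u' : Fin K'.n} {u : Fin K.n} {α β : ℝ}
    (e1 : K'.pos u' = K.point (u, α)) (e2 : K'.pos (K'.next u') = K.point (u, β)) (s : ℝ) :
    K'.point (u', s) = K.point (u, α + s * (β - α)) := by
  rw [point_eq, e1, e2, point_sub]

theorem Refines.dir {K K' : PolygonalLink} {u' : Fin K'.n} {u : Fin K.n} {α β : ℝ}
    (e1 : K'.pos u' = K.point (u, α)) (e2 : K'.pos (K'.next u') = K.point (u, β)) :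
    K'.shadow.dir u' = (β - α) • K.shadow.dir u := by
  change (K'.pos (K'.next u')).1 - (K'.pos u').1 = (β - α) • ((K.pos (K.next u)).1 - (K.pos u).1)
  rw [e1, e2, ← Prod.fst_sub, ← Prod.fst_sub, ← Prod.smul_fst]
  congr 1
  simp only [point_eq, lineMap_apply_module']
  module

theorem Refines.exists_param {K K' : PolygonalLink} (h : K'.Refines K) {p' : Fin K'.n × ℝ}
    (hp' : p' ∈ K'.params) : ∃ p ∈ K.params, K.point p = K'.point p' ∧
      ∃ k : ℝ, 0 < k ∧ K'.shadow.dir p'.1 = k • K.shadow.dir p.1 := by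
  obtain ⟨u', s⟩ := p'
  have hs : s ∈ Ico (0 : ℝ) 1 := hp'
  obtain ⟨u, α, β, h1, h2, h3, e1, e2⟩ := h.edge u'
  exact ⟨(u, α + s * (β - α)), ⟨by nlinarith [hs.1], by nlinarith [hs.2]⟩,
    (Refines.point e1 e2 s).symm, β - α, sub_pos.2 h2, Refines.dir e1 e2⟩

theorem det_smul_smul (k l : ℝ) (x y : Plane) :
    ClosedPolygons.det (k • x) (l • y) = k * l * ClosedPolygons.det x y := by
  simp only [ClosedPolygons.det, Prod.smul_fst, Prod.smul_snd, smul_eq_mul]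
  ring

theorem isCrossingPoint_iff (K : PolygonalLink) {p : Fin K.n × ℝ} (hp : p ∈ K.params) :
    IsCrossingPoint K.carrier (K.point p) ↔
      ∃ q ∈ K.params, p ≠ q ∧ K.shadow.point p = K.shadow.point q := by
  constructor
  · rintro ⟨_, ⟨q, hq, rfl⟩, e, hne⟩
    refine ⟨q, hq, fun h => hne (by rw [h]), ?_⟩
    rw [shadow_point, shadow_point]
    exact e.symm
  · rintro ⟨q, hq, hne, e⟩
    rw [shadow_point, shadow_point] at e
    exact ⟨_, ⟨q, hq, rfl⟩, e.symm, fun h => hne (K.embedded hp hq h.symm)⟩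

theorem shadow_point_eq_iff (K : PolygonalLink) (p q : Fin K.n × ℝ) :
    K.shadow.point p = K.shadow.point q ↔ (K.point p).1 = (K.point q).1 := by
  rw [shadow_point, shadow_point]

theorem zero_mem_params (K : PolygonalLink) (u : Fin K.n) : (u, (0 : ℝ)) ∈ K.params :=
  ⟨le_rfl, zero_lt_one⟩

theorem Refines.isRegular {K K' : PolygonalLink} (h : K'.Refines K) (hP : K.shadow.IsRegular)
    (hv : ∀ v', ¬ IsCrossingPoint K'.carrier (K'.pos v')) : K'.shadow.IsRegular := by
  have hinj : ∀ p' q', p' ∈ K'.params → q' ∈ K'.params → ∀ p q, K.point p = K'.point p' →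
      K.point q = K'.point q' → p = q → p' = q' := by
    intro p' q' hp' hq' p q e1 e2 e
    exact K'.embedded hp' hq' (by rw [← e1, ← e2, e])
  refine ⟨?_, ?_, ?_⟩
  · intro (v' : Fin K'.n) (p' : Fin K'.n × ℝ) hp' e
    by_contra hne
    apply hv v'
    have e : (K'.point p').1 = (K'.pos v').1 := (K'.shadow_point p').symm.trans e
    refine ⟨K'.point p', ⟨p', hp', rfl⟩, e, fun e' => hne ?_⟩
    exact K'.embedded hp' (K'.zero_mem_params v') (e'.trans (K'.point_zero v').symm)
  · intro (p' : Fin K'.n × ℝ) hp' (q' : Fin K'.n × ℝ) hq' hne e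
    obtain ⟨p, hp, e1, k, hk, d1⟩ := h.exists_param hp'
    obtain ⟨q, hq, e2, l, hl, d2⟩ := h.exists_param hq'
    rw [d1, d2, det_smul_smul]
    refine mul_ne_zero (mul_pos hk hl).ne' (hP.transverse p hp q hq
      (fun h => hne (hinj _ _ hp' hq' _ _ e1 e2 h)) ?_)
    rw [shadow_point_eq_iff, e1, e2, ← shadow_point_eq_iff, e]
  · intro (p' : Fin K'.n × ℝ) hp' (q' : Fin K'.n × ℝ) hq' (r' : Fin K'.n × ℝ) hr' e e'
    obtain ⟨p, hp, e1, -⟩ := h.exists_param hp'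
    obtain ⟨q, hq, e2, -⟩ := h.exists_param hq'
    obtain ⟨r, hr, e3, -⟩ := h.exists_param hr'
    refine (hP.no_triple p hp q hq r hr ?_ ?_).imp (hinj _ _ hp' hq' _ _ e1 e2)
      (Or.imp (hinj _ _ hq' hr' _ _ e2 e3) (hinj _ _ hp' hr' _ _ e1 e3))
    · rw [shadow_point_eq_iff, e1, e2, ← shadow_point_eq_iff, e]
    · rw [shadow_point_eq_iff, e2, e3, ← shadow_point_eq_iff, e']

/-- In general position there are finitely many crossings. -/
theorem _root_.ClosedPolygons.IsRegular.finite_crossings {P : ClosedPolygons Plane}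
    (hP : P.IsRegular) :
    {p | p ∈ P.params ∧ ∃ q ∈ P.params, p ≠ q ∧ P.point p = P.point q}.Finite := by
  have hsub : {p | p ∈ P.params ∧ ∃ q ∈ P.params, p ≠ q ∧ P.point p = P.point q} ⊆
      ⋃ v, ⋃ w, {p | p ∈ P.params ∧ p.1 = v ∧ v ≠ w ∧
        ∃ t, t ∈ Ico (0 : ℝ) 1 ∧ P.point p = P.point (w, t)} := by
    rintro p ⟨hp, q, hq, hne, e⟩
    simp only [mem_iUnion]
    refine ⟨p.1, q.1, hp, rfl, fun h => ?_, q.2, hq, e⟩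
    refine hP.transverse p hp q hq hne e ?_
    rw [h]
    simp [ClosedPolygons.det, mul_comm]
  refine (finite_iUnion fun v => finite_iUnion fun w => ?_).subset hsub
  refine Set.Subsingleton.finite ?_
  rintro ⟨_, s⟩ ⟨hp, rfl, hne, t, ht, e⟩ ⟨_, s'⟩ ⟨hp', rfl, -, t', ht', e'⟩
  exact Prod.ext rfl (hP.unique hp ht hne e e').1

end PolygonalLink

/-! ### Putting the crossings at the midpoints of edges -/

namespace PolygonalLink

variable {K : PolygonalLink}

theorem shadow_point_sub (K : PolygonalLink) (u : Fin K.n) (s t : ℝ) :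
    K.shadow.point (u, s) - K.shadow.point (u, t) = (s - t) • K.shadow.dir u := by
  simp only [ClosedPolygons.point, ClosedPolygons.dir, lineMap_apply_module']
  module

theorem isCrossingPoint_of_ne {p q : Fin K.n × ℝ} (hp : p ∈ K.params) (hq : q ∈ K.params)
    (hne : p ≠ q) (e : K.shadow.point p = K.shadow.point q) :
    IsCrossingPoint K.carrier (K.point p) :=
  (K.isCrossingPoint_iff hp).2 ⟨q, hq, hne, e⟩

theorem not_isCrossingPoint_pos (hP : K.shadow.IsRegular) (v : Fin K.n) :
    ¬ IsCrossingPoint K.carrier (K.pos v) := by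
  rintro ⟨_, ⟨q, hq, rfl⟩, e, hne⟩
  have h : q = (v, 0) := hP.vertex_simple v q hq ((K.shadow_point q).trans e)
  exact hne (by rw [h, K.point_zero])

theorem param_pos_of_isCrossingPoint (hP : K.shadow.IsRegular) {u : Fin K.n} {s : ℝ}
    (hs : s ∈ Ico (0 : ℝ) 1) (h : IsCrossingPoint K.carrier (K.point (u, s))) : 0 < s := by
  refine hs.1.lt_of_ne ?_
  rintro rfl
  rw [K.point_zero] at h
  exact not_isCrossingPoint_pos hP u h

theorem finite_isCrossingPoint (hP : K.shadow.IsRegular) :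
    {p | p ∈ K.params ∧ IsCrossingPoint K.carrier (K.point p)}.Finite := by
  refine hP.finite_crossings.subset ?_
  rintro p ⟨hp, h⟩
  exact ⟨hp, (K.isCrossingPoint_iff hp).1 h⟩

/-- A vertex does not lie in the interior of an edge. -/
theorem Refines.notMem_Ioo {K' : PolygonalLink} {u' v' : Fin K'.n} {u : Fin K.n} {α β y : ℝ}
    (hαβ : α < β) (e1 : K'.pos u' = K.point (u, α)) (e2 : K'.pos (K'.next u') = K.point (u, β))
    (e : K'.pos v' = K.point (u, y)) : y ∉ Ioo α β := by
  intro hy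
  have hd := sub_pos.2 hαβ
  have h1 : 0 < (y - α) / (β - α) := div_pos (sub_pos.2 hy.1) hd
  have h2 : (y - α) / (β - α) < 1 := (div_lt_one hd).2 (sub_lt_sub_right hy.2 _)
  refine h1.ne' (K'.point_inj (u := u') (w := v') ⟨h1.le, h2⟩ ⟨le_rfl, zero_lt_one⟩ ?_).2
  rw [Refines.point e1 e2, K'.point_zero, e, div_mul_cancel₀ _ hd.ne', add_sub_cancel]

/-- Cutting every edge at distance `ε` on both sides of each of its crossings makes each crossing
the midpoint of an edge of length `2 * ε`, lengths being measured in the parameter. -/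
theorem exists_refines_centered (hP : K.shadow.IsRegular) {ε : ℝ} (hε : 0 < ε)
    (h1 : ∀ p ∈ K.params, IsCrossingPoint K.carrier (K.point p) → ε < p.2 ∧ p.2 + ε < 1)
    (h2 : ∀ p ∈ K.params, IsCrossingPoint K.carrier (K.point p) → ∀ q ∈ K.params,
      IsCrossingPoint K.carrier (K.point q) → p.2 ≠ q.2 → 2 * ε < |p.2 - q.2|) :
    ∃ K' : PolygonalLink, K.Equivalent K' ∧ K'.Refines K ∧
      ∀ u' u α β x, 0 ≤ α → α < β → β ≤ 1 → K'.pos u' = K.point (u, α) →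
        K'.pos (K'.next u') = K.point (u, β) → x ∈ Icc α β → x < 1 →
        IsCrossingPoint K.carrier (K.point (u, x)) → α = x - ε ∧ β = x + ε := by
  set C := {p | p ∈ K.params ∧ IsCrossingPoint K.carrier (K.point p)} with hC
  have hCf : C.Finite := finite_isCrossingPoint hP
  have hin : ∀ p ∈ C, p.2 - ε ∈ Ico (0 : ℝ) 1 ∧ p.2 + ε ∈ Ico (0 : ℝ) 1 := by
    rintro p ⟨hp, hcr⟩
    obtain ⟨l, r⟩ := h1 p hp hcr
    exact ⟨⟨by linarith, by linarith⟩, ⟨by linarith, r⟩⟩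
  obtain ⟨K', hK', href, hran⟩ := K.exists_refines_union
    (V := (fun p => K.point (p.1, p.2 - ε)) '' C ∪ (fun p => K.point (p.1, p.2 + ε)) '' C)
    ((hCf.image _).union (hCf.image _)) (by
      rintro _ (⟨p, hp, rfl⟩ | ⟨p, hp, rfl⟩)
      · exact K.point_mem_carrier _ (Ico_subset_unit (hin p hp).1)
      · exact K.point_mem_carrier _ (Ico_subset_unit (hin p hp).2))
  refine ⟨K', hK', href, ?_⟩
  intro u' u α β x hα hαβ hβ e1 e2 hx hx1 hcr
  have hxI : x ∈ Ico (0 : ℝ) 1 := ⟨hα.trans hx.1, hx1⟩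
  have hxC : (u, x) ∈ C := ⟨hxI, hcr⟩
  obtain ⟨l, r⟩ := h1 _ hxC.1 hcr
  have hV : ∀ y, K.point (u, y) ∈ range K'.pos → y ∉ Ioo α β := by
    rintro y ⟨v', hv'⟩
    exact Refines.notMem_Ioo hαβ e1 e2 hv'
  have hleft : x - ε ≤ α := by
    by_contra hlt
    exact hV (x - ε) (by rw [hran]; exact Or.inl (Or.inl ⟨_, hxC, rfl⟩))
      ⟨not_le.1 hlt, by linarith [hx.2]⟩
  have hright : β ≤ x + ε := by
    by_contra hlt
    exact hV (x + ε) (by rw [hran]; exact Or.inl (Or.inr ⟨_, hxC, rfl⟩))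
      ⟨by linarith [hx.1], not_le.1 hlt⟩
  have key : ∀ y v', K'.pos v' = K.point (u, y) → x - ε ≤ y → y ≤ x + ε →
      y = x - ε ∨ y = x + ε := by
    intro y v' hv' hy1 hy2
    have hyI : y ∈ Ico (0 : ℝ) 1 := ⟨by simp only at l; linarith, by simp only at r; linarith⟩
    have hmem : K'.pos v' ∈ range K'.pos := ⟨v', rfl⟩
    have hnear : ∀ p ∈ C, p.1 = u → |p.2 - y| ≤ ε → p.2 = x := by
      rintro p ⟨hp, hpc⟩ - hd
      by_contra hne
      have := h2 p hp hpc _ hxC.1 hcr hne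
      have h3 := abs_sub_le p.2 y x
      have h4 : |y - x| ≤ ε := abs_le.2 ⟨by linarith, by linarith⟩
      simp only at this
      linarith
    rw [hran, hv'] at hmem
    obtain (⟨p, hp, e⟩ | ⟨p, hp, e⟩) | ⟨w, e⟩ := hmem
    · obtain ⟨e3, e4⟩ := K.point_inj (hin p hp).1 hyI e
      have := hnear p hp e3 (by rw [← e4, sub_sub_cancel, abs_of_pos hε])
      exact Or.inl (by rw [← e4, this])
    · obtain ⟨e3, e4⟩ := K.point_inj (hin p hp).2 hyI e
      have := hnear p hp e3 (by rw [← e4, sub_add_cancel_left, abs_neg, abs_of_pos hε])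
      exact Or.inr (by rw [← e4, this])
    · rw [← K.point_zero w] at e
      have := (K.point_inj ⟨le_rfl, zero_lt_one⟩ hyI e).2
      simp only at l
      linarith
  constructor
  · refine (key α u' e1 hleft (by linarith)).resolve_right fun h => ?_
    linarith [hx.1]
  · refine (key β _ e2 (by linarith) hright).resolve_left fun h => ?_
    linarith [hx.2]

theorem planeFrame_smul {x y : Plane} {k : ℝ} (hk : 0 < k) (h : 0 < ClosedPolygons.det x y)
    (h' : 0 < ClosedPolygons.det (k • x) (k • y)) (p : Plane) :
    planeFrame (k • x) (k • y) h' p = k⁻¹ • planeFrame x y h p := by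
  have hk' := hk.ne'
  have h1 : ClosedPolygons.det (k • x) (k • y) = k * k * ClosedPolygons.det x y :=
    det_smul_smul k k x y
  have h2 : ClosedPolygons.det p (k • y) = k * ClosedPolygons.det p y := by
    simpa using det_smul_smul 1 k p y
  have h3 : ClosedPolygons.det (k • x) p = k * ClosedPolygons.det x p := by
    simpa using det_smul_smul k 1 x p
  have h0 := h.ne'
  apply Complex.ext
  · change ClosedPolygons.det p (k • y) / ClosedPolygons.det (k • x) (k • y) =
      (k⁻¹ • planeFrame x y h p).re
    rw [Complex.smul_re, h1, h2]
    change _ = k⁻¹ • (ClosedPolygons.det p y / ClosedPolygons.det x y)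
    rw [smul_eq_mul]
    field_simp
  · change ClosedPolygons.det (k • x) p / ClosedPolygons.det (k • x) (k • y) =
      (k⁻¹ • planeFrame x y h p).im
    rw [Complex.smul_im, h1, h3]
    change _ = k⁻¹ • (ClosedPolygons.det x p / ClosedPolygons.det x y)
    rw [smul_eq_mul]
    field_simp

/-- A size `ε` that suits `exists_refines_centered` and for which, in the frame of the two strands
at one given crossing, the disc of radius `ε` about this crossing meets no other edge. -/
theorem exists_crossing_radius (hP : K.shadow.IsRegular) {a b : Fin K.n} {s t : ℝ}
    (hs : s ∈ Ico (0 : ℝ) 1) (ht : t ∈ Ico (0 : ℝ) 1)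
    (e : K.shadow.point (a, s) = K.shadow.point (b, t))
    (hdet : 0 < ClosedPolygons.det (K.shadow.dir a) (K.shadow.dir b)) :
    ∃ ε > 0, (∀ p ∈ K.params, IsCrossingPoint K.carrier (K.point p) → ε < p.2 ∧ p.2 + ε < 1) ∧
    (∀ p ∈ K.params, IsCrossingPoint K.carrier (K.point p) → ∀ q ∈ K.params,
      IsCrossingPoint K.carrier (K.point q) → p.2 ≠ q.2 → 2 * ε < |p.2 - q.2|) ∧
    ∀ u, u ≠ a → u ≠ b → ∀ r ∈ Icc (0 : ℝ) 1,
      ε ≤ ‖planeFrame _ _ hdet (K.shadow.point (u, r) - K.shadow.point (a, s))‖ := by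
  have hCf := finite_isCrossingPoint hP
  have hab : a ≠ b := by
    rintro rfl
    simp [ClosedPolygons.det, mul_comm] at hdet
  have hlt : ∀ x : ℝ, 0 < x → ∀ᶠ ε in 𝓝[>] (0 : ℝ), ε < x := fun x hx =>
    (eventually_lt_nhds hx).filter_mono nhdsWithin_le_nhds
  have ev1 : ∀ᶠ ε in 𝓝[>] (0 : ℝ), ∀ p ∈ {p | p ∈ K.params ∧
      IsCrossingPoint K.carrier (K.point p)}, ε < p.2 ∧ p.2 + ε < 1 := by
    rw [Filter.eventually_all_finite hCf]
    rintro ⟨u, x⟩ ⟨hx, hcr⟩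
    filter_upwards [hlt x (param_pos_of_isCrossingPoint hP hx hcr), hlt (1 - x) (sub_pos.2 hx.2)]
      with ε h1 h2
    exact ⟨h1, by linarith⟩
  have ev2 : ∀ᶠ ε in 𝓝[>] (0 : ℝ), ∀ p ∈ {p | p ∈ K.params ∧
      IsCrossingPoint K.carrier (K.point p)}, ∀ q ∈ {p | p ∈ K.params ∧
      IsCrossingPoint K.carrier (K.point p)}, p.2 ≠ q.2 → 2 * ε < |p.2 - q.2| := by
    rw [Filter.eventually_all_finite hCf]
    rintro p -
    rw [Filter.eventually_all_finite hCf]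
    rintro q -
    by_cases h : p.2 = q.2
    · exact Filter.Eventually.of_forall fun _ h' => absurd h h'
    · filter_upwards [hlt (|p.2 - q.2| / 2) (half_pos (abs_pos.2 (sub_ne_zero.2 h)))] with ε h1 _
      linarith
  have ev3 : ∀ᶠ ε in 𝓝[>] (0 : ℝ), ∀ u, u ≠ a → u ≠ b → ∀ r ∈ Icc (0 : ℝ) 1,
      ε ≤ ‖planeFrame _ _ hdet (K.shadow.point (u, r) - K.shadow.point (a, s))‖ := by
    rw [Filter.eventually_all]
    intro u
    by_cases hu : u = a
    · exact Filter.Eventually.of_forall fun _ h' => absurd hu h'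
    by_cases hu' : u = b
    · exact Filter.Eventually.of_forall fun _ _ h' => absurd hu' h'
    have hc : Continuous fun r : ℝ =>
        ‖planeFrame _ _ hdet (K.shadow.point (u, r) - K.shadow.point (a, s))‖ := by
      refine ((planeFrame _ _ hdet).toLinearMap.continuous_of_finiteDimensional.comp ?_).norm
      refine Continuous.sub ?_ continuous_const
      change Continuous fun r : ℝ =>
        lineMap (K.shadow.pos u) (K.shadow.pos (K.shadow.next u)) r
      exact lineMap_continuous
    obtain ⟨r, hr, hmin⟩ := isCompact_Icc.exists_isMinOn (nonempty_Icc.2 zero_le_one) hc.continuousOn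
    have hpos : 0 < ‖planeFrame _ _ hdet (K.shadow.point (u, r) - K.shadow.point (a, s))‖ := by
      rw [norm_pos_iff, (planeFrame _ _ hdet).map_ne_zero_iff, sub_ne_zero]
      intro h
      rcases hr.2.eq_or_lt with rfl | hr1
      · have h' : K.shadow.point (a, s) = K.shadow.pos (K.shadow.next u) := by
          rw [← h]
          simp [ClosedPolygons.point]
        have h3 := hP.vertex_simple _ _ (show (a, s) ∈ K.shadow.params from hs) h'
        have h4 := hP.vertex_simple _ _ (show (b, t) ∈ K.shadow.params from ht) (e ▸ h')
        exact hab (Prod.ext_iff.1 (h3.trans h4.symm)).1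
      · rcases hP.no_triple (u, r) ⟨hr.1, hr1⟩ (a, s) hs (b, t) ht h e with h | h | h
        · exact hu (Prod.ext_iff.1 h).1
        · exact hab (Prod.ext_iff.1 h).1
        · exact hu' (Prod.ext_iff.1 h).1
    filter_upwards [hlt _ hpos] with ε h1 _ _ r' hr'
    exact h1.le.trans (hmin hr')
  obtain ⟨ε, ⟨⟨h1, h2⟩, h3⟩, hε⟩ := (((ev1.and ev2).and ev3).and self_mem_nhdsWithin).exists
  exact ⟨ε, hε, fun p hp hc => h1 p ⟨hp, hc⟩, fun p hp hc q hq hc' => h2 p ⟨hp, hc⟩ q ⟨hq, hc'⟩,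
    h3⟩

/-- Every link with a regular shadow has a subdivision whose crossings are midpoints of edges and
in which one given crossing is far away from all edges that do not run through it. -/
theorem exists_refines_midpointed (hP : K.shadow.IsRegular) {a b : Fin K.n} {s t : ℝ}
    (hs : s ∈ Ico (0 : ℝ) 1) (ht : t ∈ Ico (0 : ℝ) 1)
    (e : K.shadow.point (a, s) = K.shadow.point (b, t))
    (hdet : 0 < ClosedPolygons.det (K.shadow.dir a) (K.shadow.dir b)) :
    ∃ (K' : PolygonalLink) (a' b' : Fin K'.n), K.Equivalent K' ∧ K'.Refines K ∧
      K'.shadow.IsRegular ∧ K'.shadow.Midpointed ∧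
      K'.point (a', 1 / 2) = K.point (a, s) ∧ K'.point (b', 1 / 2) = K.point (b, t) ∧
      ∃ hdet' : 0 < ClosedPolygons.det (K'.shadow.dir a') (K'.shadow.dir b'),
        ∀ u, u ≠ a' → u ≠ b' → ∀ r ∈ Ico (0 : ℝ) 1, 1 / 2 ≤
          ‖planeFrame _ _ hdet' (K'.shadow.point (u, r) - K'.shadow.point (a', 1 / 2))‖ := by
  obtain ⟨ε, hε, h1, h2, h3⟩ := exists_crossing_radius hP hs ht e hdet
  obtain ⟨K', hK', href, hcen⟩ := exists_refines_centered hP hε h1 h2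
  have hab : a ≠ b := by
    rintro rfl
    simp [ClosedPolygons.det, mul_comm] at hdet
  -- A crossing of `K'` is the midpoint of its edge.
  have hmid : ∀ u' r, r ∈ Ico (0 : ℝ) 1 → IsCrossingPoint K.carrier (K'.point (u', r)) →
      r = 1 / 2 ∧ ∃ u x, x ∈ Ico (0 : ℝ) 1 ∧ K'.point (u', r) = K.point (u, x) ∧
        K'.pos u' = K.point (u, x - ε) ∧ K'.pos (K'.next u') = K.point (u, x + ε) := by
    intro u' r hr hcr
    obtain ⟨u, α, β, hα, hαβ, hβ, e1, e2⟩ := href.edge u'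
    have e3 := Refines.point e1 e2 r
    have hx : α + r * (β - α) ∈ Icc α β := ⟨by nlinarith [hr.1], by nlinarith [hr.2]⟩
    have hx1 : α + r * (β - α) < 1 := by nlinarith [hr.2]
    rw [e3] at hcr
    obtain ⟨e4, e5⟩ := hcen u' u α β _ hα hαβ hβ e1 e2 hx hx1 hcr
    refine ⟨?_, u, _, ⟨hα.trans hx.1, hx1⟩, e3, ?_, ?_⟩
    · nlinarith
    · rw [← e4, e1]
    · rw [← e5, e2]
  have hfind : ∀ {u x}, x ∈ Ico (0 : ℝ) 1 → IsCrossingPoint K.carrier (K.point (u, x)) →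
      ∃ u', K'.point (u', 1 / 2) = K.point (u, x) ∧ K'.pos u' = K.point (u, x - ε) ∧
        K'.pos (K'.next u') = K.point (u, x + ε) := by
    intro u x hx hcr
    have hmem : K.point (u, x) ∈ K'.carrier := by
      rw [href.carrier_eq]
      exact K.point_mem_carrier u (Ico_subset_unit hx)
    obtain ⟨⟨u', r⟩, hr, e1⟩ := hmem
    obtain ⟨rfl, v, y, hy, e2, e3, e4⟩ := hmid u' r hr (by rw [e1]; exact hcr)
    obtain ⟨rfl, rfl⟩ := K.point_inj hx hy (e1.symm.trans e2)
    exact ⟨u', e1, e3, e4⟩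
  have hca : IsCrossingPoint K.carrier (K.point (a, s)) :=
    isCrossingPoint_of_ne hs ht (fun h => hab (Prod.ext_iff.1 h).1) e
  have hcb : IsCrossingPoint K.carrier (K.point (b, t)) :=
    isCrossingPoint_of_ne ht hs (fun h => hab (Prod.ext_iff.1 h).1.symm) e.symm
  obtain ⟨a', ha, ha1, ha2⟩ := hfind hs hca
  obtain ⟨b', hb, hb1, hb2⟩ := hfind ht hcb
  have hda := Refines.dir ha1 ha2
  have hdb := Refines.dir hb1 hb2
  have h2ε : ∀ x : ℝ, x + ε - (x - ε) = 2 * ε := fun x => by ring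
  rw [h2ε] at hda hdb
  have hreg : K'.shadow.IsRegular := by
    refine href.isRegular hP fun v' hv' => ?_
    rw [href.carrier_eq, ← K'.point_zero] at hv'
    have := (hmid v' 0 ⟨le_rfl, zero_lt_one⟩ hv').1
    norm_num at this
  refine ⟨K', a', b', hK', href, hreg, ?_, ha, hb, ?_, ?_⟩
  · intro (p : Fin K'.n × ℝ) hp (q : Fin K'.n × ℝ) hq hne h
    have := isCrossingPoint_of_ne (K := K') hp hq hne h
    rw [href.carrier_eq] at this
    exact (hmid p.1 p.2 hp this).1
  · rw [hda, hdb, det_smul_smul]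
    positivity
  · intro u' hua hub r hr
    obtain ⟨u, α, β, hα, hαβ, hβ, e1, e2⟩ := href.edge u'
    have e3 := Refines.point e1 e2 r
    set y := α + r * (β - α) with hy
    have hyI : y ∈ Ico (0 : ℝ) 1 := ⟨by nlinarith [hr.1], by nlinarith [hr.2]⟩
    have e4 : K'.shadow.point (u', r) = K.shadow.point (u, y) := by
      erw [K'.shadow_point, K.shadow_point]
      exact congrArg Prod.fst e3
    have e5 : K'.shadow.point (a', 1 / 2) = K.shadow.point (a, s) := by
      erw [K'.shadow_point, K.shadow_point]
      exact congrArg Prod.fst ha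
    -- Outside its `ε`-neighbourhood a strand through the crossing is far away from it.
    have hstrand : ∀ {w w' x}, K'.pos w' = K.point (w, x - ε) →
        K'.pos (K'.next w') = K.point (w, x + ε) → u' ≠ w' → u = w → ε ≤ |y - x| := by
      intro w w' x f1 f2 hne huw
      by_contra hlt
      obtain ⟨g1, g2⟩ := abs_lt.1 (not_le.1 hlt)
      refine hne (K'.point_inj (s := r) (t := (y - x + ε) / (2 * ε)) hr
        ⟨div_nonneg (by linarith) (by linarith), (div_lt_one (by linarith)).2 (by linarith)⟩ ?_).1
      rw [e3, Refines.point f1 f2, h2ε, div_mul_cancel₀ _ (by positivity), huw]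
      congr 2
      ring
    have hfin : ε ≤ ‖planeFrame _ _ hdet (K.shadow.point (u, y) - K.shadow.point (a, s))‖ := by
      by_cases hu : u = a
      · have := hstrand ha1 ha2 hua hu
        rw [hu, shadow_point_sub, map_smul, planeFrame_left, norm_smul, norm_one, mul_one]
        exact this
      by_cases hu' : u = b
      · have := hstrand hb1 hb2 hub hu'
        rw [hu', e, shadow_point_sub, map_smul, planeFrame_right, norm_smul, Complex.norm_I,
          mul_one]
        exact this
      exact h3 u hu hu' y (Ico_subset_unit hyI)
    have hk : 0 < 2 * ε := by positivity
    have hfr : ∀ (x z : Plane) (hx : 0 < ClosedPolygons.det x z), x = (2 * ε) • K.shadow.dir a →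
        z = (2 * ε) • K.shadow.dir b → ∀ p, planeFrame x z hx p =
          (2 * ε)⁻¹ • planeFrame _ _ hdet p := by
      rintro x z hx rfl rfl p
      exact planeFrame_smul hk hdet hx p
    rw [hfr _ _ _ hda hdb, e4, e5, norm_smul, norm_inv, Real.norm_of_nonneg hk.le,
      le_inv_mul_iff₀ hk]
    linarith

end PolygonalLink

/-! ### Labels and alternating diagrams -/

namespace PolygonalLink

variable {K : PolygonalLink}

theorem fst_ne_of_shadow_eq (hP : K.shadow.IsRegular) {p q : Fin K.n × ℝ} (hp : p ∈ K.params)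
    (hq : q ∈ K.params) (hne : p ≠ q) (e : K.shadow.point p = K.shadow.point q) : p.1 ≠ q.1 := by
  intro h
  have hd : ClosedPolygons.det (K.shadow.dir p.1) (K.shadow.dir q.1) ≠ 0 :=
    hP.transverse p hp q hq hne e
  rw [h] at hd
  exact hd (by simp [ClosedPolygons.det, mul_comm])

theorem diagram_isOver_iff (hP : K.shadow.IsRegular) {p q : Fin K.n × ℝ} (hp : p ∈ K.params)
    (hq : q ∈ K.params) (hne : p ≠ q) (e : K.shadow.point p = K.shadow.point q) :
    (K.diagram hP).isOver p.1 q.1 ↔ (K.point q).2 < (K.point p).2 := by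
  have hne1 := fst_ne_of_shadow_eq hP hp hq hne e
  constructor
  · rintro ⟨-, s, hs, t, ht, e', hlt⟩
    obtain ⟨h1, h2⟩ := hP.unique (s := p.2) (t := q.2) hp hq hne1 e e'
    rw [← h1, ← h2] at hlt
    exact hlt
  · intro hlt
    exact ⟨hne1, p.2, hp, q.2, hq, e, hlt⟩

theorem isPassage_diagram_iff (hP : K.shadow.IsRegular) (p : Fin K.n × ℝ) :
    (K.diagram hP).IsPassage p ↔ p ∈ K.params ∧ IsCrossingPoint K.carrier (K.point p) :=
  and_congr_right fun hp => (K.isCrossingPoint_iff hp).symm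

theorem height_ne_of_shadow_eq {p q : Fin K.n × ℝ} (hp : p ∈ K.params) (hq : q ∈ K.params)
    (hne : p ≠ q) (e : K.shadow.point p = K.shadow.point q) : (K.point p).2 ≠ (K.point q).2 :=
  fun h => hne (K.embedded hp hq (Prod.ext ((K.shadow_point_eq_iff p q).1 e) h))

theorem liesOver_iff (hP : K.shadow.IsRegular) {p q : Fin K.n × ℝ} (hp : p ∈ K.params)
    (hq : q ∈ K.params) (hne : p ≠ q) (e : K.shadow.point p = K.shadow.point q) :
    LiesOver K.carrier (K.point p) ↔ (K.point q).2 < (K.point p).2 := by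
  have e1 := (K.shadow_point_eq_iff p q).1 e
  refine ⟨?_, fun h => ⟨_, ⟨q, hq, rfl⟩, e1.symm, h⟩⟩
  rintro ⟨_, ⟨r, hr, rfl⟩, e2, h⟩
  have e3 := (K.shadow_point_eq_iff r p).2 e2
  rcases hP.no_triple r hr p hp q hq e3 e with h' | h' | h'
  · rw [h'] at h
    exact absurd h (lt_irrefl _)
  · exact absurd h' hne
  · rwa [h'] at h

theorem liesUnder_iff (hP : K.shadow.IsRegular) {p q : Fin K.n × ℝ} (hp : p ∈ K.params)
    (hq : q ∈ K.params) (hne : p ≠ q) (e : K.shadow.point p = K.shadow.point q) :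
    LiesUnder K.carrier (K.point p) ↔ (K.point p).2 < (K.point q).2 := by
  have e1 := (K.shadow_point_eq_iff p q).1 e
  refine ⟨?_, fun h => ⟨_, ⟨q, hq, rfl⟩, e1.symm, h⟩⟩
  rintro ⟨_, ⟨r, hr, rfl⟩, e2, h⟩
  have e3 := (K.shadow_point_eq_iff r p).2 e2
  rcases hP.no_triple r hr p hp q hq e3 e with h' | h' | h'
  · rw [h'] at h
    exact absurd h (lt_irrefl _)
  · exact absurd h' hne
  · rwa [h'] at h

/-- The over-passages of a diagram with a changed crossing, as points of the link. -/
theorem isOverPassage_crossingChange_iff (hP : K.shadow.IsRegular) {v w : Fin K.n} {s t : ℝ}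
    (hs : s ∈ Ico (0 : ℝ) 1) (ht : t ∈ Ico (0 : ℝ) 1) (hvw : v ≠ w)
    (e : K.shadow.point (v, s) = K.shadow.point (w, t)) (p : Fin K.n × ℝ) :
    ((K.diagram hP).crossingChange v w).IsOverPassage p ↔
      p ∈ K.params ∧ ChangedOver K.carrier (K.shadow.point (v, s)) (K.point p) := by
  have hne : (v, s) ≠ (w, t) := fun h => hvw (Prod.ext_iff.1 h).1
  have hsym : ∀ q : Fin K.n × ℝ, p ∈ K.params → q ∈ K.params → p ≠ q →
      K.shadow.point p = K.shadow.point q →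
      (s(p.1, q.1) = s(v, w) ↔ (K.point p).1 = K.shadow.point (v, s)) := by
    intro q hp hq hpq e'
    have hpq1 := fst_ne_of_shadow_eq hP hp hq hpq e'
    rw [← shadow_point]
    constructor
    · intro h
      rcases Sym2.eq_iff.1 h with ⟨h1, h2⟩ | ⟨h1, h2⟩
      · have h3 := hP.unique (v := p.1) (w := q.1) (s := p.2) (t := q.2) (s' := s) (t' := t)
          hp hq hpq1 e' (by rw [h1, h2]; exact e)
        rw [← h1, ← h3.1]
        rfl
      · have h3 := hP.unique (v := p.1) (w := q.1) (s := p.2) (t := q.2) (s' := t) (t' := s)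
          hp hq hpq1 e' (by rw [h1, h2]; exact e.symm)
        rw [e, ← h1, ← h3.1]
        rfl
    · intro h
      have hp' : p = (v, s) ∨ p = (w, t) := by
        rcases hP.no_triple p hp (v, s) hs (w, t) ht h e with h' | h' | h'
        · exact Or.inl h'
        · exact absurd h' hne
        · exact Or.inr h'
      have hq' : q = (v, s) ∨ q = (w, t) := by
        rcases hP.no_triple q hq (v, s) hs (w, t) ht (e'.symm.trans h) e with h' | h' | h'
        · exact Or.inl h'
        · exact absurd h' hne
        · exact Or.inr h'
      rcases hp' with rfl | rfl <;> rcases hq' with rfl | rfl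
      · exact absurd rfl hpq
      · rfl
      · exact Sym2.eq_swap
      · exact absurd rfl hpq
  constructor
  · rintro ⟨hp, q, hq, hpq, e', h⟩
    have hp : p ∈ K.params := hp
    have hq : q ∈ K.params := hq
    have e' : K.shadow.point p = K.shadow.point q := e'
    refine ⟨hp, ?_⟩
    rcases h with ⟨h1, h2⟩ | ⟨h1, h2⟩
    · refine Or.inr ⟨(hsym q hp hq hpq e').1 h1, (liesUnder_iff hP hp hq hpq e').2 ?_⟩
      exact (diagram_isOver_iff hP hq hp hpq.symm e'.symm).1 h2
    · refine Or.inl ⟨fun h => h1 ((hsym q hp hq hpq e').2 h), (liesOver_iff hP hp hq hpq e').2 ?_⟩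
      exact (diagram_isOver_iff hP hp hq hpq e').1 h2
  · rintro ⟨hp, ⟨h1, _, ⟨q, hq, rfl⟩, e', h2⟩ | ⟨h1, _, ⟨q, hq, rfl⟩, e', h2⟩⟩
    · have hpq : p ≠ q := by
        rintro rfl
        exact lt_irrefl _ h2
      have e' := (K.shadow_point_eq_iff p q).2 e'.symm
      exact ⟨hp, q, hq, hpq, e', Or.inr ⟨fun h => h1 ((hsym q hp hq hpq e').1 h),
        (diagram_isOver_iff hP hp hq hpq e').2 h2⟩⟩
    · have hpq : p ≠ q := by
        rintro rfl
        exact lt_irrefl _ h2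
      have e' := (K.shadow_point_eq_iff p q).2 e'.symm
      exact ⟨hp, q, hq, hpq, e', Or.inl ⟨(hsym q hp hq hpq e').2 h1,
        (diagram_isOver_iff hP hq hp hpq.symm e'.symm).2 h2⟩⟩

theorem walk_mem_params (K : PolygonalLink) (u : Fin K.n) (x : ℝ) : K.walk u x ∈ K.params :=
  ⟨Int.fract_nonneg x, Int.fract_lt_one x⟩

theorem point_walk_of_mem (K : PolygonalLink) (u : Fin K.n) {x : ℝ} (hx : x ∈ Icc (0 : ℝ) 1) :
    K.point (K.walk u x) = K.point (u, x) := by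
  rcases hx.2.eq_or_lt with rfl | h
  · rw [K.point_one, ClosedPolygons.walk, Int.fract_one, K.point_zero, Nat.floor_one]
    rfl
  · rw [ClosedPolygons.walk, Int.fract_eq_self.2 ⟨hx.1, h⟩, Nat.floor_eq_zero.2 h]
    rfl

theorem walk_add_nat (K : PolygonalLink) (u : Fin K.n) (k : ℕ) {x : ℝ} (hx : 0 ≤ x) :
    K.walk u (x + k) = K.walk (K.next^[k] u) x := by
  rw [ClosedPolygons.walk, ClosedPolygons.walk, Nat.floor_add_natCast hx, Int.fract_add_natCast,
    Function.iterate_add_apply]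

theorem exists_first_crossing (hP : K.shadow.IsRegular) (u : Fin K.n) {s r : ℝ} (hs : 0 ≤ s)
    (hr : 0 ≤ r) (hs1 : s ≤ 1)
    (h : IsCrossingPoint K.carrier (K.point (K.walk u r))) :
    ∃ y, s ≤ y ∧ IsCrossingPoint K.carrier (K.point (K.walk u y)) ∧
      ∀ z, s ≤ z → z < y → ¬ IsCrossingPoint K.carrier (K.point (K.walk u z)) := by
  -- The walk from `u` returns to the crossing at `r` after `k` steps.
  obtain ⟨k, hk, hku⟩ : ∃ k : ℕ, 0 < k ∧ K.next^[k] u = u := by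
    refine ⟨orderOf K.next, orderOf_pos _, ?_⟩
    rw [Equiv.Perm.iterate_eq_pow, pow_orderOf_eq_one, Equiv.Perm.one_apply]
  have hk1 : (1 : ℝ) ≤ k := by exact_mod_cast hk
  let S : Set ℝ := {z | z ∈ Icc s (r + k) ∧ IsCrossingPoint K.carrier (K.point (K.walk u z))}
  have hfin : S.Finite := by
    refine (((finite_Iic ⌊r + k⌋₊).prod ((finite_isCrossingPoint hP).image Prod.snd)).image
      fun q : ℕ × ℝ => (q.1 : ℝ) + q.2).subset ?_
    rintro z ⟨hz, hc⟩
    refine ⟨(⌊z⌋₊, Int.fract z), ⟨Nat.floor_mono hz.2, K.walk u z, ⟨K.walk_mem_params u z, hc⟩,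
      rfl⟩, ?_⟩
    have hz0 : 0 ≤ z := hs.trans hz.1
    simp only
    rw [natCast_floor_eq_intCast_floor hz0]
    exact Int.floor_add_fract z
  have hne : S.Nonempty := by
    refine ⟨r + k, ⟨by linarith, le_rfl⟩, ?_⟩
    rw [K.walk_add_nat u k hr, hku]
    exact h
  obtain ⟨y, hy, hmin⟩ := exists_min_image S id hfin hne
  refine ⟨y, hy.1.1, hy.2, fun z hz hzy hc => ?_⟩
  exact absurd (hmin z ⟨⟨hz, hzy.le.trans hy.1.2⟩, hc⟩) (not_le.2 hzy)

/-- The first passage met on the way from the point at `s` on the edge `u` is one that is an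
under-passage after the change of the crossing at `c`. -/
def NextIsUnder (K : PolygonalLink) (c : Plane) (u : Fin K.n) (s : ℝ) : Prop :=
  ∃ y, s ≤ y ∧ IsCrossingPoint K.carrier (K.point (K.walk u y)) ∧
    (∀ z, s ≤ z → z < y → ¬ IsCrossingPoint K.carrier (K.point (K.walk u z))) ∧
    ¬ ChangedOver K.carrier c (K.point (K.walk u y))

/-- `NextIsUnder` as a property of points. -/
def underLabel (K : PolygonalLink) (c : Plane) (X : Space) : Prop :=
  ∃ u s, s ∈ Ico (0 : ℝ) 1 ∧ K.point (u, s) = X ∧ NextIsUnder K c u s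

theorem underLabel_iff (K : PolygonalLink) (c : Plane) {u : Fin K.n} {s : ℝ}
    (hs : s ∈ Icc (0 : ℝ) 1) : underLabel K c (K.point (u, s)) ↔ NextIsUnder K c u s := by
  have key : ∀ {u s}, s ∈ Ico (0 : ℝ) 1 →
      (underLabel K c (K.point (u, s)) ↔ NextIsUnder K c u s) := by
    intro u s hs
    refine ⟨?_, fun h => ⟨u, s, hs, rfl, h⟩⟩
    rintro ⟨v, t, ht, e, h⟩
    obtain ⟨rfl, rfl⟩ := K.point_inj ht hs e
    exact h
  rcases hs.2.eq_or_lt with rfl | hs1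
  · rw [K.point_one, ← K.point_zero, key ⟨le_rfl, zero_lt_one⟩]
    have hw : ∀ x : ℝ, 0 ≤ x → K.walk (K.next u) x = K.walk u (x + 1) := fun x hx => by
      simpa using (K.walk_add_nat u 1 hx).symm
    constructor
    · rintro ⟨y, hy, h1, h2, h3⟩
      rw [hw y hy] at h1 h3
      refine ⟨y + 1, by linarith, h1, fun z hz hzy => ?_, h3⟩
      have := h2 (z - 1) (by linarith) (by linarith)
      rwa [hw _ (by linarith), sub_add_cancel] at this
    · rintro ⟨y, hy, h1, h2, h3⟩
      have e : K.walk (K.next u) (y - 1) = K.walk u y := by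
        rw [hw _ (by linarith), sub_add_cancel]
      refine ⟨y - 1, by linarith, by rwa [e], fun z hz hzy => ?_, by rwa [e]⟩
      rw [hw z hz]
      exact h2 _ (by linarith) (by linarith)
  · exact key ⟨hs.1, hs1⟩

/-- A diagram that becomes alternating by a crossing change has an alternating label. -/
theorem alternatingLabel_of_crossingChange (hP : K.shadow.IsRegular) {v w : Fin K.n} {s t : ℝ}
    (hs : s ∈ Ico (0 : ℝ) 1) (ht : t ∈ Ico (0 : ℝ) 1) (hvw : v ≠ w)
    (e : K.shadow.point (v, s) = K.shadow.point (w, t))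
    (h : ((K.diagram hP).crossingChange v w).Alternating) :
    AlternatingLabel K (K.shadow.point (v, s)) (underLabel K (K.shadow.point (v, s))) := by
  set c := K.shadow.point (v, s)
  have hov : ∀ u x, ((K.diagram hP).crossingChange v w).IsOverPassage (K.walk u x) ↔
      ChangedOver K.carrier c (K.point (K.walk u x)) := fun u x => by
    rw [isOverPassage_crossingChange_iff hP hs ht hvw e]
    exact and_iff_right (K.walk_mem_params u x)
  have hpass : ∀ u x, ((K.diagram hP).crossingChange v w).IsPassage (K.walk u x) ↔
      IsCrossingPoint K.carrier (K.point (K.walk u x)) := fun u x =>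
    (isPassage_diagram_iff hP _).trans (and_iff_right (K.walk_mem_params u x))
  have halt : ∀ (u : Fin K.n) x y, 0 ≤ x → x < y →
      IsCrossingPoint K.carrier (K.point (K.walk u x)) →
      IsCrossingPoint K.carrier (K.point (K.walk u y)) →
      (∀ z, x < z → z < y → ¬ IsCrossingPoint K.carrier (K.point (K.walk u z))) →
      (ChangedOver K.carrier c (K.point (K.walk u x)) ↔
        ¬ ChangedOver K.carrier c (K.point (K.walk u y))) := by
    intro u x y hx hxy h1 h2 h3
    rw [← hov, ← hov]
    exact h u x y hx hxy ((hpass u x).2 h1) ((hpass u y).2 h2)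
      fun z hz hz' hp => h3 z hz hz' ((hpass u z).1 hp)
  constructor
  · intro u x x' hx hxx hx1 hno
    rw [underLabel_iff K c ⟨hx, hxx.trans hx1⟩, underLabel_iff K c ⟨hx.trans hxx, hx1⟩]
    have hno' : ∀ z, x ≤ z → z ≤ x' → ¬ IsCrossingPoint K.carrier (K.point (K.walk u z)) := by
      intro z h1 h2
      rw [K.point_walk_of_mem u ⟨hx.trans h1, h2.trans hx1⟩]
      exact hno z ⟨h1, h2⟩
    constructor
    · rintro ⟨y, h1, h2, h3, h4⟩
      have hy : x' < y := by
        by_contra hle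
        exact hno' y h1 (not_lt.1 hle) h2
      exact ⟨y, hy.le, h2, fun z hz => h3 z (hxx.trans hz), h4⟩
    · rintro ⟨y, h1, h2, h3, h4⟩
      refine ⟨y, hxx.trans h1, h2, fun z hz hzy => ?_, h4⟩
      rcases le_total z x' with h | h
      · exact hno' z hz h
      · exact h3 z h hzy
  · intro u x r x' hx hxr hrx hx1 honly hcr
    have hr0 : 0 ≤ r := hx.trans hxr.le
    have hr1 : r ≤ 1 := hrx.le.trans hx1
    rw [underLabel_iff K c ⟨hx, hxr.le.trans hr1⟩, underLabel_iff K c ⟨hr0.trans hrx.le, hx1⟩]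
    have honly' : ∀ z, x ≤ z → z ≤ x' →
        IsCrossingPoint K.carrier (K.point (K.walk u z)) → z = r := by
      intro z h1 h2
      rw [K.point_walk_of_mem u ⟨hx.trans h1, h2.trans hx1⟩]
      exact honly z ⟨h1, h2⟩
    rw [← K.point_walk_of_mem u ⟨hr0, hr1⟩] at hcr ⊢
    have hbefore : NextIsUnder K c u x ↔ ¬ ChangedOver K.carrier c (K.point (K.walk u r)) := by
      constructor
      · rintro ⟨y, h1, h2, h3, h4⟩
        rcases lt_trichotomy y r with hy | rfl | hy
        · exact absurd (honly' y h1 (hy.le.trans hrx.le) h2) hy.ne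
        · exact h4
        · exact absurd hcr (h3 r hxr.le hy)
      · intro h4
        refine ⟨r, hxr.le, hcr, fun z hz hzr hc => ?_, h4⟩
        exact hzr.ne (honly' z hz (hzr.le.trans hrx.le) hc)
    have hnext : ∀ y, x' ≤ y → IsCrossingPoint K.carrier (K.point (K.walk u y)) →
        (∀ z, x' ≤ z → z < y → ¬ IsCrossingPoint K.carrier (K.point (K.walk u z))) →
        (ChangedOver K.carrier c (K.point (K.walk u r)) ↔
          ¬ ChangedOver K.carrier c (K.point (K.walk u y))) := by
      intro y h1 h2 h3
      refine halt u r y hr0 (hrx.trans_le h1) hcr h2 fun z hz hzy hc => ?_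
      rcases le_total z x' with h | h
      · exact hz.ne' (honly' z (hxr.le.trans hz.le) h hc)
      · exact h3 z h hzy hc
    have hafter : NextIsUnder K c u x' ↔ ChangedOver K.carrier c (K.point (K.walk u r)) := by
      constructor
      · rintro ⟨y, h1, h2, h3, h4⟩
        exact (hnext y h1 h2 h3).2 h4
      · intro h4
        obtain ⟨y, h1, h2, h3⟩ := exists_first_crossing hP u (hr0.trans hrx.le) hr0 hx1 hcr
        exact ⟨y, h1, h2, h3, (hnext y h1 h2 h3).1 h4⟩
    rw [hbefore, hafter]
    tauto

/-- If all crossings are midpoints of edges, a closed edge contains no other point of a crossing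
than its midpoint. -/
theorem eq_half_of_isCrossingPoint (hP : K.shadow.IsRegular) (hmid : K.shadow.Midpointed)
    {u : Fin K.n} {x : ℝ} (hx : x ∈ Icc (0 : ℝ) 1)
    (h : IsCrossingPoint K.carrier (K.point (u, x))) :
    x = 1 / 2 ∧ ∃ w, K.shadow.MidCross u w := by
  rcases hx.2.eq_or_lt with rfl | hx1
  · rw [K.point_one] at h
    exact absurd h (not_isCrossingPoint_pos hP _)
  have hp : (u, x) ∈ K.params := ⟨hx.1, hx1⟩
  obtain ⟨q, hq, hne, e⟩ := (K.isCrossingPoint_iff hp).1 h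
  have h1 : x = 1 / 2 := hmid (u, x) hp q hq hne e
  have h2 : q.2 = 1 / 2 := hmid q hq (u, x) hp hne.symm e.symm
  refine ⟨h1, q.1, fst_ne_of_shadow_eq hP hp hq hne e, ?_⟩
  rw [← h1]
  refine e.trans ?_
  rw [h1, ← h2]
  rfl

theorem isCrossingPoint_of_midCross {u w : Fin K.n} (h : K.shadow.MidCross u w) :
    IsCrossingPoint K.carrier (K.point (u, 1 / 2)) :=
  isCrossingPoint_of_ne (K.shadow.half_mem_params u) (K.shadow.half_mem_params w)
    (fun e => h.1 (Prod.ext_iff.1 e).1) h.2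

/-- The label of the vertices of a subdivision does not change along edges without crossings. -/
theorem AlternatingLabel.next_iff {K' : PolygonalLink} {c : Plane} {ℓ : Space → Prop}
    (hℓ : AlternatingLabel K c ℓ) (href : K'.Refines K) (hP : K'.shadow.IsRegular)
    (hmid : K'.shadow.Midpointed) {u : Fin K'.n} (hu : ∀ w, ¬ K'.shadow.MidCross u w) :
    ℓ (K'.pos (K'.next u)) ↔ ℓ (K'.pos u) := by
  obtain ⟨v, α, β, hα, hαβ, hβ, e1, e2⟩ := href.edge u
  have hd := sub_pos.2 hαβ
  rw [e1, e2]
  refine (hℓ.const v α β hα hαβ.le hβ fun x hx hcr => ?_).symm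
  have hx' : (x - α) / (β - α) ∈ Icc (0 : ℝ) 1 :=
    ⟨div_nonneg (sub_nonneg.2 hx.1) hd.le, (div_le_one hd).2 (sub_le_sub_right hx.2 _)⟩
  have e3 : K'.point (u, (x - α) / (β - α)) = K.point (v, x) := by
    rw [Refines.point e1 e2, div_mul_cancel₀ _ hd.ne', add_sub_cancel]
  rw [← e3, ← href.carrier_eq] at hcr
  obtain ⟨-, w, hw⟩ := eq_half_of_isCrossingPoint hP hmid hx' hcr
  exact hu w hw

/-- The label of the vertices of a subdivision changes at a crossing. -/
theorem AlternatingLabel.switch_midCross {K' : PolygonalLink} {c : Plane} {ℓ : Space → Prop}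
    (hℓ : AlternatingLabel K c ℓ) (href : K'.Refines K) (hP : K'.shadow.IsRegular)
    (hmid : K'.shadow.Midpointed) {u w : Fin K'.n} (huw : K'.shadow.MidCross u w) :
    (ChangedOver K'.carrier c (K'.point (u, 1 / 2)) →
      ¬ ℓ (K'.pos u) ∧ ℓ (K'.pos (K'.next u))) ∧
    (¬ ChangedOver K'.carrier c (K'.point (u, 1 / 2)) →
      ℓ (K'.pos u) ∧ ¬ ℓ (K'.pos (K'.next u))) := by
  obtain ⟨v, α, β, hα, hαβ, hβ, e1, e2⟩ := href.edge u
  have hd := sub_pos.2 hαβ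
  have hcr := isCrossingPoint_of_midCross huw
  rw [href.carrier_eq] at hcr ⊢
  rw [Refines.point e1 e2] at hcr ⊢
  rw [e1, e2]
  refine hℓ.switch v α _ β hα (by linarith) (by linarith) hβ (fun x hx hx' => ?_) hcr
  have hxI : (x - α) / (β - α) ∈ Icc (0 : ℝ) 1 :=
    ⟨div_nonneg (sub_nonneg.2 hx.1) hd.le, (div_le_one hd).2 (sub_le_sub_right hx.2 _)⟩
  have e3 : K'.point (u, (x - α) / (β - α)) = K.point (v, x) := by
    rw [Refines.point e1 e2, div_mul_cancel₀ _ hd.ne', add_sub_cancel]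
  rw [← e3, ← href.carrier_eq] at hx'
  have h := (eq_half_of_isCrossingPoint hP hmid hxI hx').1
  rw [← h, div_mul_cancel₀ _ hd.ne', add_sub_cancel]

theorem walk_natCast_add_half (K : PolygonalLink) (u : Fin K.n) (k : ℕ) :
    K.walk u (k + 1 / 2) = (K.next^[k] u, 1 / 2) := by
  rw [add_comm, K.walk_add_nat u k (by norm_num), ClosedPolygons.walk,
    Int.fract_eq_self.2 (by norm_num), Nat.floor_eq_zero.2 (by norm_num)]
  rfl

/-- The diagram is alternating if its vertices carry a label that changes from false to true at
over-passages, from true to false at under-passages, and nowhere else. -/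
theorem diagram_alternating_of_label (hP : K.shadow.IsRegular) (hmid : K.shadow.Midpointed)
    {L : Fin K.n → Prop} (hconst : ∀ u : Fin K.n, (∀ w, ¬ K.shadow.MidCross u w) → (L (K.next u) ↔ L u))
    (hswitch : ∀ u w : Fin K.n, K.shadow.MidCross u w →
      (K.point (w, 1 / 2)).2 < (K.point (u, 1 / 2)).2 →
      ¬ L u ∧ L (K.next u) ∧ L w ∧ ¬ L (K.next w)) :
    (K.diagram hP).Alternating := by
  have hpass : ∀ (v : Fin K.n) x, 0 ≤ x → (K.diagram hP).IsPassage (K.walk v x) →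
      ∃ k : ℕ, x = k + 1 / 2 ∧ ∃ w, K.shadow.MidCross (K.next^[k] v) w := by
    intro v x hx h
    obtain ⟨h1, h2⟩ := (isPassage_diagram_iff hP _).1 h
    obtain ⟨h3, h4⟩ := eq_half_of_isCrossingPoint (u := K.next^[⌊x⌋₊] v) (x := Int.fract x) hP hmid
      ⟨Int.fract_nonneg x, (Int.fract_lt_one x).le⟩ h2
    refine ⟨⌊x⌋₊, ?_, h4⟩
    rw [← h3, natCast_floor_eq_intCast_floor hx]
    exact (Int.floor_add_fract x).symm
  have hover : ∀ u : Fin K.n, (∃ w, K.shadow.MidCross u w) →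
      ((K.diagram hP).IsOverPassage (u, 1 / 2) ↔ ¬ L u) ∧
      ((K.diagram hP).IsOverPassage (u, 1 / 2) ↔ L (K.next u)) := by
    rintro u ⟨w, hw⟩
    have hpu := K.shadow.half_mem_params u
    have hpw := K.shadow.half_mem_params w
    have hne : ((u, 1 / 2) : Fin K.n × ℝ) ≠ (w, 1 / 2) := fun e => hw.1 (Prod.ext_iff.1 e).1
    have hiff : (K.diagram hP).IsOverPassage (u, 1 / 2) ↔
        (K.point (w, 1 / 2)).2 < (K.point (u, 1 / 2)).2 := by
      refine Iff.trans ?_ (diagram_isOver_iff (K := K) hP hpu hpw hne hw.2)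
      constructor
      · rintro ⟨-, q, hq, hne', e, h⟩
        rcases hP.no_triple q hq (u, 1 / 2) hpu (w, 1 / 2) hpw e.symm hw.2 with h' | h' | h'
        · exact absurd h'.symm hne'
        · exact absurd h' hne
        · rw [h'] at h
          exact h
      · exact fun h => ⟨hpu, (w, 1 / 2), hpw, hne, hw.2, h⟩
    rw [hiff]
    rcases (height_ne_of_shadow_eq (K := K) hpu hpw hne hw.2).lt_or_gt with h | h
    · have := hswitch w u hw.symm h
      have := h.asymm
      tauto
    · have := hswitch u w hw h
      tauto
  intro (v : Fin K.n) x y hx hxy h1 h2 hno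
  obtain ⟨i, rfl, hi⟩ := hpass v x hx h1
  obtain ⟨j, rfl, hj⟩ := hpass v y (hx.trans hxy.le) h2
  have hij : i < j := by
    have : (i : ℝ) < j := by linarith
    exact_mod_cast this
  have hstep : ∀ k, i + 1 ≤ k → k ≤ j → (L (K.next^[k] v) ↔ L (K.next^[i + 1] v)) := by
    intro k hk
    induction k, hk using Nat.le_induction with
    | base => exact fun _ => Iff.rfl
    | succ k hk ih =>
      intro hkj
      rw [← ih (by omega), Function.iterate_succ_apply']
      refine hconst _ fun w hw => ?_
      have hik : (i : ℝ) < k := by exact_mod_cast hk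
      have hkj : (k : ℝ) < j := by exact_mod_cast hkj
      refine hno (k + 1 / 2) (by linarith) (by linarith) ?_
      refine (isPassage_diagram_iff hP _).2 ⟨K.walk_mem_params v _, ?_⟩
      change IsCrossingPoint K.carrier (K.point (K.walk v (k + 1 / 2)))
      rw [K.walk_natCast_add_half]
      exact isCrossingPoint_of_midCross hw
  have e1 : (K.diagram hP).walk v (i + 1 / 2) = (K.next^[i] v, 1 / 2) :=
    K.walk_natCast_add_half v i
  have e2 : (K.diagram hP).walk v (j + 1 / 2) = (K.next^[j] v, 1 / 2) :=
    K.walk_natCast_add_half v j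
  rw [e1, e2]
  refine (hover _ hi).2.trans (Iff.trans ?_ (not_congr (hover _ hj).1).symm)
  rw [not_not, hstep j hij le_rfl, Function.iterate_succ_apply']

end PolygonalLink

/-! ### Positive almost alternating diagrams -/

namespace PolygonalLink

variable {K : PolygonalLink}

theorem height_half (K : PolygonalLink) (u : Fin K.n) :
    (K.point (u, 1 / 2)).2 = ((K.pos u).2 + (K.pos (K.next u)).2) / 2 := by
  rw [point_eq, lineMap_apply_module', Prod.snd_add, Prod.smul_snd, Prod.snd_sub, smul_eq_mul]
  ring

theorem height_half_lt_iff (K : PolygonalLink) (u w : Fin K.n) :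
    (K.point (u, 1 / 2)).2 < (K.point (w, 1 / 2)).2 ↔
      (K.pos u).2 + (K.pos (K.next u)).2 < (K.pos w).2 + (K.pos (K.next w)).2 := by
  rw [height_half, height_half, div_lt_div_iff_of_pos_right two_pos]

theorem half_ne {u w : Fin K.n} (h : K.shadow.MidCross u w) :
    ((u, 1 / 2) : Fin K.n × ℝ) ≠ (w, 1 / 2) := fun e => h.1 (Prod.ext_iff.1 e).1

/-- A link is alternating if it has a positive diagram, with the crossings at midpoints of edges,
that carries a label of the vertices as in an alternating diagram, except that it is the other way
round at the crossing of `a` and `b`. -/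
theorem alternating_of_label (hP : K.shadow.IsRegular) (hmid : K.shadow.Midpointed)
    {a b : Fin K.n} (hab : K.shadow.MidCross a b)
    (hdet : 0 < ClosedPolygons.det (K.shadow.dir a) (K.shadow.dir b))
    (hout : ∀ u, u ≠ a → u ≠ b → ∀ s ∈ Ico (0 : ℝ) 1, 1 / 2 ≤ ‖planeFrame _ _ hdet
      (K.shadow.point (u, s) - K.shadow.point (a, 1 / 2))‖)
    (hpos : ∀ u w : Fin K.n, K.shadow.MidCross u w →
      (K.point (w, 1 / 2)).2 < (K.point (u, 1 / 2)).2 →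
      0 < ClosedPolygons.det (K.shadow.dir u) (K.shadow.dir w))
    {L : Fin K.n → Prop} (hconst : ∀ u : Fin K.n, (∀ w, ¬ K.shadow.MidCross u w) →
      (L (K.next u) ↔ L u))
    (hswitch : ∀ u w : Fin K.n, K.shadow.MidCross u w → u ≠ a → u ≠ b →
      (K.point (w, 1 / 2)).2 < (K.point (u, 1 / 2)).2 →
      ¬ L u ∧ L (K.next u) ∧ L w ∧ ¬ L (K.next w))
    (hL : L a ∧ ¬ L (K.next a) ∧ ¬ L b ∧ L (K.next b)) : K.Alternating := by
  have hheight : ∀ u w : Fin K.n, K.shadow.MidCross u w →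
      0 < ClosedPolygons.det (K.shadow.dir u) (K.shadow.dir w) →
      (K.point (w, 1 / 2)).2 < (K.point (u, 1 / 2)).2 := by
    intro u w h hd
    have hne := height_ne_of_shadow_eq (K := K) (K.shadow.half_mem_params u)
      (K.shadow.half_mem_params w) (half_ne h) h.2
    refine hne.lt_or_gt.resolve_left fun h' => ?_
    have h1 := hpos w u h.symm h'
    have h2 : ClosedPolygons.det (K.shadow.dir w) (K.shadow.dir u) =
        -ClosedPolygons.det (K.shadow.dir u) (K.shadow.dir w) := by
      simp only [ClosedPolygons.det]
      ring
    linarith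
  obtain ⟨R, haR, haR', hbR, hbR', hR, hcross⟩ := ClosedPolygons.exists_separation hP hmid hab hdet
    (ℓ := L) hconst (fun u w h hua hub hd => hswitch u w h hua hub (hheight u w h hd)) hL
  obtain ⟨pos, hemb, heq, hfst, hlt, hab'⟩ := exists_equivalent_crossing_changed K hP hmid hab hdet
    ((K.height_half_lt_iff b a).1 (hheight a b hab hdet)) hout haR haR' hbR hbR' hR hcross
  have hsh : (ofPos hemb).shadow = K.shadow := by
    change ClosedPolygons.mk K.n K.next (fun v => (pos v).1) = ClosedPolygons.mk K.n K.next _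
    rw [funext hfst]
  have hmc : ∀ u w : Fin K.n, (ofPos hemb).shadow.MidCross u w → K.shadow.MidCross u w := by
    intro u w h
    change ClosedPolygons.MidCross (ClosedPolygons.mk K.n K.next fun v => (pos v).1) u w at h
    rw [funext hfst] at h
    exact h
  have hmc' : ∀ u w : Fin K.n, K.shadow.MidCross u w → (ofPos hemb).shadow.MidCross u w := by
    intro u w h
    change ClosedPolygons.MidCross (ClosedPolygons.mk K.n K.next fun v => (pos v).1) u w
    rw [funext hfst]
    exact h
  have hreg : (ofPos hemb).shadow.IsRegular := hsh ▸ hP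
  refine ⟨_, ⟨ofPos hemb, heq, hreg, rfl⟩, diagram_alternating_of_label (K := ofPos hemb) hreg
    (hsh ▸ hmid) (L := L) (fun u hu => hconst u fun w hw => hu w (hmc' u w hw)) ?_⟩
  intro (u : Fin K.n) (w : Fin K.n) huw h
  have h := ((ofPos hemb).height_half_lt_iff w u).1 h
  change (pos w).2 + (pos (K.next w)).2 < (pos u).2 + (pos (K.next u)).2 at h
  have huw := hmc u w huw
  by_cases hua : u = a
  · obtain rfl : w = b := hP.midCross_unique (hua ▸ huw) hab
    rw [hua] at h
    exact absurd h hab'.asymm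
  by_cases hub : u = b
  · obtain rfl : w = a := hP.midCross_unique (hub ▸ huw) hab.symm
    rw [hub]
    exact ⟨hL.2.2.1, hL.2.2.2, hL.1, hL.2.1⟩
  refine hswitch u w huw hua hub ((K.height_half_lt_iff w u).2 ((hlt w u huw.symm ?_ ?_).1 h))
  · rintro rfl
    exact hub (hP.midCross_unique huw.symm hab)
  · rintro rfl
    exact hua (hP.midCross_unique huw.symm hab.symm)

/-- A link with a positive diagram that becomes alternating by a change of the crossing of `v` over
`w` is alternating. -/
theorem alternating_of_isOver (hP : K.shadow.IsRegular) (hpos : (K.diagram hP).Positive)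
    {v w : Fin K.n} (hvw : (K.diagram hP).isOver v w)
    (halt : ((K.diagram hP).crossingChange v w).Alternating) :
    ∃ K', K.Equivalent K' ∧ K'.Alternating := by
  have hdet : 0 < ClosedPolygons.det (K.shadow.dir v) (K.shadow.dir w) := hpos v w hvw
  obtain ⟨hne, s, hs, t, ht, e, hlt⟩ := hvw
  have hs : s ∈ Ico (0 : ℝ) 1 := hs
  have ht : t ∈ Ico (0 : ℝ) 1 := ht
  have hℓ := alternatingLabel_of_crossingChange hP hs ht hne e halt
  obtain ⟨K', a, b, heq, href, hP', hmid, ha, hb, hdet', hout⟩ :=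
    exists_refines_midpointed hP hs ht e hdet
  set c := K.shadow.point (v, s) with hc
  set ℓ := underLabel K c
  have hca : K'.shadow.point (a, 1 / 2) = c :=
    (K'.shadow_point _).trans ((congrArg Prod.fst ha).trans (K.shadow_point _).symm)
  have hcb : K'.shadow.point (b, 1 / 2) = c :=
    (K'.shadow_point _).trans ((congrArg Prod.fst hb).trans ((K.shadow_point _).symm.trans e.symm))
  have hab : K'.shadow.MidCross a b := by
    refine ⟨?_, hca.trans hcb.symm⟩
    rintro rfl
    rw [ClosedPolygons.det, mul_comm, sub_self] at hdet'
    exact lt_irrefl _ hdet'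
  have hlt' : (K'.point (b, 1 / 2)).2 < (K'.point (a, 1 / 2)).2 := by
    rw [ha, hb]
    exact hlt
  have hhalf : ∀ u : Fin K'.n, ((u, 1 / 2) : Fin K'.n × ℝ) ∈ K'.params :=
    K'.shadow.half_mem_params
  have hfst : ∀ u : Fin K'.n, (K'.point (u, 1 / 2)).1 = K'.shadow.point (u, 1 / 2) :=
    fun u => (K'.shadow_point _).symm
  -- The edges `a` and `b` are the only ones through `c`.
  have honly : ∀ u : Fin K'.n, u ≠ a → u ≠ b → (K'.point (u, 1 / 2)).1 ≠ c := by
    intro u hua hub h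
    rw [hfst, ← hca] at h
    exact hub (hP'.midCross_unique (u := a) ⟨Ne.symm hua, h.symm⟩ hab)
  refine ⟨K', heq, alternating_of_label hP' hmid hab hdet' hout ?_ (L := fun u => ℓ (K'.pos u))
    (fun u hu => hℓ.next_iff href hP' hmid hu) ?_ ?_⟩
  · intro u w h hh
    obtain ⟨p, hp, e1, k, hk, d1⟩ := href.exists_param (hhalf u)
    obtain ⟨q, hq, e2, l, hl, d2⟩ := href.exists_param (hhalf w)
    have d1 : K'.shadow.dir u = k • K.shadow.dir p.1 := d1
    have d2 : K'.shadow.dir w = l • K.shadow.dir q.1 := d2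
    rw [← e1, ← e2] at hh
    rw [d1, d2, det_smul_smul]
    refine mul_pos (mul_pos hk hl) (hpos _ _ ((diagram_isOver_iff hP hp hq ?_ ?_).2 hh))
    · rintro rfl
      exact lt_irrefl _ hh
    · rw [shadow_point_eq_iff, e1, e2, ← shadow_point_eq_iff]
      exact h.2
  · intro u w h hua hub hh
    have hwa : w ≠ a := by
      rintro rfl
      exact hub (hP'.midCross_unique h.symm hab)
    have hwb : w ≠ b := by
      rintro rfl
      exact hua (hP'.midCross_unique h.symm hab.symm)
    have h1 := (hℓ.switch_midCross href hP' hmid h).1 (Or.inl ⟨honly u hua hub,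
      (liesOver_iff hP' (hhalf u) (hhalf w) (half_ne h) h.2).2 hh⟩)
    have h2 := (hℓ.switch_midCross href hP' hmid h.symm).2 (by
      rintro (⟨-, h'⟩ | ⟨h', -⟩)
      · exact hh.asymm ((liesOver_iff hP' (hhalf w) (hhalf u) (half_ne h.symm) h.2.symm).1 h')
      · exact honly w hwa hwb h')
    exact ⟨h1.1, h1.2, h2.1, h2.2⟩
  · have h1 := (hℓ.switch_midCross href hP' hmid hab).2 (by
      rintro (⟨h', -⟩ | ⟨-, h'⟩)
      · exact h' ((hfst a).trans hca)
      · exact hlt'.asymm ((liesUnder_iff hP' (hhalf a) (hhalf b) (half_ne hab) hab.2).1 h'))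
    have h2 := (hℓ.switch_midCross href hP' hmid hab.symm).1 (Or.inr ⟨(hfst b).trans hcb,
      (liesUnder_iff hP' (hhalf b) (hhalf a) (half_ne hab.symm) hab.2.symm).2 hlt'⟩)
    exact ⟨h1.1, h1.2, h2.1, h2.2⟩

end PolygonalLink

theorem LinkDiagram.crossingChange_comm (D : LinkDiagram) (v w : Fin D.n) :
    D.crossingChange v w = D.crossingChange w v := by
  simp only [LinkDiagram.crossingChange, Sym2.eq_swap (a := v) (b := w)]

theorem theorem3p1 (L : PolygonalLink) :
    ((∃ D : LinkDiagram, L.HasDiagram D ∧ D.Positive ∧ D.AlmostAlternating) → L.Alternating) ∧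
    (L.Positive ∧ L.AlmostAlternating →
      ¬ ∃ D : LinkDiagram, L.HasDiagram D ∧ D.Positive ∧ D.AlmostAlternating) := by
  have main : (∃ D : LinkDiagram, L.HasDiagram D ∧ D.Positive ∧ D.AlmostAlternating) →
      L.Alternating := by
    rintro ⟨_, ⟨K, hLK, hP, rfl⟩, hpos, v, w, hvw, halt⟩
    have hmain : ∃ K', K.Equivalent K' ∧ K'.Alternating := by
      by_cases h : (K.diagram hP).isOver v w
      · exact PolygonalLink.alternating_of_isOver hP hpos h halt
      · rw [LinkDiagram.crossingChange_comm] at halt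
        exact PolygonalLink.alternating_of_isOver hP hpos
          (((K.diagram hP).isOver_iff w v hvw.symm).2 h) halt
    obtain ⟨K', hKK', D, ⟨K'', hK'', hD⟩, hDalt⟩ := hmain
    exact ⟨D, ⟨K'', (hLK.trans hKK').trans hK'', hD⟩, hDalt⟩
  exact ⟨main, fun h hD => h.2.2 (main hD)⟩
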